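/- A dessin with a finite nonempty edge set $E$ is encoded by a pair of permutations $(\sigma,\alpha)$ of $E$ generating a transitive group; the cycles of $\sigma$ (of $\alpha$) are the sets of edges at the black (white) vertices in counterclockwise order, and the cycles of $(\sigma\alpha)^{-1}$ (with $\alpha$ applied first in $\sigma\alpha$) are the faces. Its automorphisms are the permutations of $E$ commuting with $\sigma$ and $\alpha$, and for a subgroup $G$ of the automorphism group the quotient dessin has as edges the $G$-orbits in $E$, with the induced permutations. Let $(\sigma,\alpha)$ be the pair of the regular icosahedron with white vertices at the mid-points of its edges (60 half-edges), and let $I_4$, the icosahedron of genus $4$, be the dessin with the pair $(\sigma^2,\alpha)$. A rational function $\beta:\mathbb{CP}^1\to\mathbb{CP}^1$ is a Belyi function for a dessin $M$ if it is non-constant, its critical values lie in $\{0,1,\infty\}$, and $M$ is embedded in $\mathbb{CP}^1$ as $\beta^{-1}([0,1])$ in such a way that the black (white) vertices are the roots of $\beta=0$ (of $\beta=1$), with multiplicity equal to the degree of the vertex, the edges are the lifts of $[0,1]$ with the cyclic orders at the vertices prescribed by $M$, and the complement is a disjoint union of open disks, the faces of $M$, each containing exactly one pole, with multiplicity equal to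 the degree of the face. **Proposition.** The automorphism group of $I_4$ has subgroups isomorphic to the dihedral group $D_{10}$ of order $10$, and for every such subgroup the quotient dessin $I_4/D_{10}$ is planar with Belyi function $$\beta(x)=\frac{(x-1)^5\bigl((2+i)x+(2-i)\bigr)}{(x+1)^5\bigl((2+i)x-(2-i)\bigr)}.$$ -/

import Mathlib

open Polynomial Filter Topology

noncomputable section

/-! ### Dessins d'enfants, encoded by permutations of their edges -/

/-- A dessin with (finite, nonempty) edge set `E`. The cycles of `σ` are the edges around the black
vertices, those of `α` the edges around the white vertices, both in counterclockwise order; a pair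
`(σ, α)` comes from a connected bicoloured map iff the group it generates is transitive. -/
structure Dessin (E : Type) where
  σ : Equiv.Perm E
  α : Equiv.Perm E
  finite : Finite E
  nonempty : Nonempty E
  transitive : MulAction.IsPretransitive (Subgroup.closure {σ, α}) E

namespace Dessin

variable {E : Type}

/-- The automorphism group: the permutations of the edges that commute with `σ` and `α`. -/
def aut (D : Dessin E) : Subgroup (Equiv.Perm E) :=
  Subgroup.centralizer {D.σ, D.α}

/-- The edges of the quotient by `G`: the `G`-orbits of edges. -/
abbrev QuotientEdge (D : Dessin E) (G : Subgroup D.aut) : Type :=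
  MulAction.orbitRel.Quotient G E

/-- A permutation of the edges commuting with all automorphisms acts on the `G`-orbits. -/
def quotientPerm (D : Dessin E) (G : Subgroup D.aut) (τ : Equiv.Perm E)
    (hτ : ∀ g ∈ D.aut, g * τ = τ * g) : Equiv.Perm (D.QuotientEdge G) :=
  Quotient.congr τ (by
    have key : ∀ (g : G) (x : E), g • τ x = τ (g • x) := fun g x =>
      Equiv.congr_fun (hτ (g : D.aut) (g : D.aut).2) x
    intro a b
    change MulAction.orbitRel G E a b ↔ MulAction.orbitRel G E (τ a) (τ b)
    rw [MulAction.orbitRel_apply, MulAction.orbitRel_apply]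
    constructor
    · rintro ⟨g, rfl⟩
      exact ⟨g, key g b⟩
    · rintro ⟨g, hg⟩
      exact ⟨g, τ.injective ((key g b).symm.trans hg)⟩)

theorem aut_comm_σ (D : Dessin E) : ∀ g ∈ D.aut, g * D.σ = D.σ * g := fun _ hg =>
  ((Subgroup.mem_centralizer_iff.1 hg) D.σ (by simp)).symm

theorem aut_comm_α (D : Dessin E) : ∀ g ∈ D.aut, g * D.α = D.α * g := fun _ hg =>
  ((Subgroup.mem_centralizer_iff.1 hg) D.α (by simp)).symm

/-- The quotient dessin `D / G`: edges in the same `G`-orbit are identified. -/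
def quotient (D : Dessin E) (G : Subgroup D.aut) : Dessin (D.QuotientEdge G) where
  σ := D.quotientPerm G D.σ D.aut_comm_σ
  α := D.quotientPerm G D.α D.aut_comm_α
  finite := by
    have := D.finite
    exact Quotient.finite _
  nonempty := by
    obtain ⟨e⟩ := D.nonempty
    exact ⟨Quotient.mk _ e⟩
  transitive := by
    have := D.transitive
    constructor
    intro x y
    induction x using Quotient.inductionOn with | _ x
    induction y using Quotient.inductionOn with | _ y
    obtain ⟨⟨g, hg⟩, hxy⟩ := MulAction.exists_smul_eq (Subgroup.closure {D.σ, D.α}) x y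
    change g x = y at hxy
    suffices h : ∃ q ∈ Subgroup.closure {D.quotientPerm G D.σ D.aut_comm_σ,
        D.quotientPerm G D.α D.aut_comm_α}, ∀ z : E,
          q (Quotient.mk _ z) = (Quotient.mk _ (g z) : D.QuotientEdge G) by
      obtain ⟨q, hq, h⟩ := h
      exact ⟨⟨q, hq⟩, (h x).trans (by rw [hxy])⟩
    clear hxy
    induction hg using Subgroup.closure_induction with
    | mem τ hτ =>
      rcases hτ with rfl | rfl
      · exact ⟨_, Subgroup.subset_closure (Set.mem_insert _ _), fun _ => rfl⟩
      · exact ⟨_, Subgroup.subset_closure (Set.mem_insert_of_mem _ rfl), fun _ => rfl⟩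
    | one => exact ⟨1, one_mem _, fun _ => rfl⟩
    | mul a b _ _ ha hb =>
      obtain ⟨p, hp, hp'⟩ := ha
      obtain ⟨q, hq, hq'⟩ := hb
      exact ⟨p * q, mul_mem hp hq, fun z => by
        rw [Equiv.Perm.mul_apply, hq', hp']; rfl⟩
    | inv a _ ha =>
      obtain ⟨p, hp, hp'⟩ := ha
      refine ⟨p⁻¹, inv_mem hp, fun z => ?_⟩
      rw [Equiv.Perm.inv_eq_iff_eq, hp']
      simp

end Dessin

/-! ### The icosahedron and the icosahedron of genus 4 -/

/-- The vertices of a regular icosahedron with two opposite vertices as poles: `upper k` has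
longitude `72k` degrees and `lower k` has longitude `72k + 36` degrees (`k` modulo 5, as for all
arithmetic in `Fin 5`). -/
inductive IcoVertex : Type
  | north : IcoVertex
  | south : IcoVertex
  | upper : Fin 5 → IcoVertex
  | lower : Fin 5 → IcoVertex
  deriving DecidableEq, Fintype

/-- The half-edges of the icosahedron: `(v, i)` is the half of an edge at the vertex `v` which is
the `i`-th in counterclockwise order (seen from outside). With the mid-points of the edges as white
vertices, these are the 60 edges of the bicoloured graph. The neighbours of each vertex, in
counterclockwise order starting with the one numbered `0`, are
* `north`: `upper 0, upper 1, upper 2, upper 3, upper 4`;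
* `south`: `lower 0, lower 4, lower 3, lower 2, lower 1`;
* `upper k`: `north, upper (k-1), lower (k-1), lower k, upper (k+1)`;
* `lower k`: `south, lower (k+1), upper (k+1), upper k, lower (k-1)`. -/
abbrev IcoDart : Type := IcoVertex × Fin 5

/-- The other half of the same edge of the icosahedron. -/
def icoFlip : IcoDart → IcoDart
  | (.north, i) => (.upper i, 0)
  | (.south, i) => (.lower (-i), 0)
  | (.upper k, 0) => (.north, k)
  | (.upper k, 1) => (.upper (k - 1), 4)
  | (.upper k, 2) => (.lower (k - 1), 2)
  | (.upper k, 3) => (.lower k, 3)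
  | (.upper k, 4) => (.upper (k + 1), 1)
  | (.lower k, 0) => (.south, -k)
  | (.lower k, 1) => (.lower (k + 1), 4)
  | (.lower k, 2) => (.upper (k + 1), 2)
  | (.lower k, 3) => (.upper k, 3)
  | (.lower k, 4) => (.lower (k - 1), 1)

theorem icoFlip_icoFlip : Function.Involutive icoFlip := by
  unfold Function.Involutive
  decide

/-- The counterclockwise rotation of the half-edges around their vertices. -/
def icoσ : Equiv.Perm IcoDart := Equiv.prodCongr (Equiv.refl _) (Equiv.addRight 1)

/-- The exchange of the two halves of each edge: the rotation around the white mid-points. -/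
def icoα : Equiv.Perm IcoDart := icoFlip_icoFlip.toPerm

theorem ico_transitive (τ : Equiv.Perm IcoDart) (n : ℕ) (hn : τ ^ n = icoσ) :
    MulAction.IsPretransitive (Subgroup.closure {τ, icoα}) IcoDart := by
  have hσ : icoσ ∈ Subgroup.closure {τ, icoα} := by
    rw [← hn]
    exact pow_mem (Subgroup.subset_closure (by simp)) n
  have hα : icoα ∈ Subgroup.closure {τ, icoα} := Subgroup.subset_closure (by simp)
  set H := Subgroup.closure {τ, icoα}
  have slot : ∀ (v : IcoVertex) (i j : Fin 5), (v, j) ∈ MulAction.orbit H (v, i) := by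
    intro v i j
    refine ⟨⟨icoσ ^ (j - i).val, pow_mem hσ _⟩, ?_⟩
    change (icoσ ^ (j - i).val) (v, i) = (v, j)
    revert v i j
    decide
  have flip : ∀ d : IcoDart, icoFlip d ∈ MulAction.orbit H d := fun d => ⟨⟨icoα, hα⟩, rfl⟩
  have tr : ∀ {a b c : IcoDart}, b ∈ MulAction.orbit H a → c ∈ MulAction.orbit H b →
      c ∈ MulAction.orbit H a := fun {a b c} h₁ h₂ => MulAction.orbit_eq_iff.2 h₁ ▸ h₂
  have up : ∀ (k j : Fin 5), (.upper k, j) ∈ MulAction.orbit H ((.north, 0) : IcoDart) :=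
    fun k j => tr (slot _ 0 k) (tr (flip (.north, k)) (slot _ 0 j))
  have lo : ∀ (k j : Fin 5), (.lower k, j) ∈ MulAction.orbit H ((.north, 0) : IcoDart) :=
    fun k j => tr (up k 3) (tr (flip (.upper k, 3)) (slot _ 3 j))
  have all : ∀ d : IcoDart, d ∈ MulAction.orbit H ((.north, 0) : IcoDart) := by
    rintro ⟨_ | _ | k | k, j⟩
    · exact slot _ 0 j
    · exact tr (lo 0 0) (tr (flip (.lower 0, 0)) (slot _ _ j))
    · exact up k j
    · exact lo k j
  constructor
  intro x y
  have h : y ∈ MulAction.orbit H x := MulAction.orbit_eq_iff.2 (all x) ▸ all y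
  exact h

/-- The regular icosahedron `I₀`, a dessin on the sphere. -/
def icosahedron : Dessin IcoDart where
  σ := icoσ
  α := icoα
  finite := inferInstance
  nonempty := ⟨(.north, 0)⟩
  transitive := ico_transitive icoσ 1 (pow_one _)

/-- The icosahedron `I₄` of genus 4: the dessin with the pair of permutations `(σ², α)`, where
`(σ, α)` is the pair of the regular icosahedron. -/
def icosahedronGenusFour : Dessin IcoDart where
  σ := icosahedron.σ ^ 2
  α := icosahedron.α
  finite := inferInstance
  nonempty := ⟨(.north, 0)⟩
  transitive := ico_transitive (icoσ ^ 2) 3 (by decide)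

/-! ### Rational functions on the Riemann sphere `OnePoint ℂ` -/

open OnePoint in
/-- The holomorphic self-map of the Riemann sphere given by a rational function. At `∞` its value is
the limit, read off from the coefficients. -/
def RatFunc.onSphere (f : RatFunc ℂ) : OnePoint ℂ → OnePoint ℂ
  | ∞ =>
    if f.denom.natDegree < f.num.natDegree then ∞
    else ((f.num.coeff f.denom.natDegree / f.denom.leadingCoeff : ℂ) : OnePoint ℂ)
  | OnePoint.some z =>
    if f.denom.eval z = 0 then ∞ else ((f.num.eval z / f.denom.eval z : ℂ) : OnePoint ℂ)

open OnePoint in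
/-- The polynomial whose finite roots are the finite solutions of `f(x) = c`. -/
def RatFunc.fiberPoly (f : RatFunc ℂ) : OnePoint ℂ → ℂ[X]
  | ∞ => f.denom
  | OnePoint.some c => f.num - Polynomial.C c * f.denom

open OnePoint in
/-- The multiplicity of `x` as a solution of the equation `f(·) = f(x)` on the Riemann sphere: the
solutions, with multiplicity, number `max (deg num) (deg denom)`, and those which are missing among
the roots of `fiberPoly` lie at `∞`. -/
def RatFunc.mult (f : RatFunc ℂ) : OnePoint ℂ → ℕ
  | ∞ => max f.num.natDegree f.denom.natDegree - (f.fiberPoly (f.onSphere ∞)).natDegree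
  | OnePoint.some z => (f.fiberPoly (f.onSphere (OnePoint.some z))).rootMultiplicity z

open OnePoint in
/-- `(ℂP¹, f)` is a Belyi pair: `f` is not constant, and its critical values lie in
`{0, 1, ∞}`. -/
def RatFunc.IsBelyi (f : RatFunc ℂ) : Prop :=
  0 < max f.num.natDegree f.denom.natDegree ∧
    ∀ x : OnePoint ℂ, 2 ≤ f.mult x →
      f.onSphere x = ((0 : ℂ) : OnePoint ℂ) ∨ f.onSphere x = ((1 : ℂ) : OnePoint ℂ) ∨
        f.onSphere x = ∞

open OnePoint in
/-- The holomorphic local coordinate centred at `v`: `z ↦ z - v` if `v` is finite, `z ↦ 1 / z` if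
`v = ∞`. (It is only used near `v`.) -/
def localCoord : OnePoint ℂ → OnePoint ℂ → ℂ
  | OnePoint.some v, OnePoint.some z => z - v
  | OnePoint.some _, ∞ => 0
  | ∞, OnePoint.some z => z⁻¹
  | ∞, ∞ => 0

/-! ### Belyi functions of planar dessins -/

/-- The segment `[0, 1]` in the Riemann sphere. -/
def unitSegment : Set (OnePoint ℂ) := Set.range fun t : unitInterval => (((t : ℝ) : ℂ) : OnePoint ℂ)

open OnePoint in
/-- An embedding of the dessin `D` into the Riemann sphere as `f⁻¹([0, 1])`. -/
structure Dessin.Drawing {E : Type} (D : Dessin E) (f : RatFunc ℂ) where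
  /-- The edge `e`, as a curve from its black end (`t = 0`) to its white end (`t = 1`). -/
  arc : E → C(unitInterval, OnePoint ℂ)
  /-- The edges are parametrized by the value of `f`; so black ends are roots of `f = 0` and
  white ends are roots of `f = 1`. -/
  apply_arc : ∀ e t, f.onSphere (arc e t) = (((t : ℝ) : ℂ) : OnePoint ℂ)
  /-- The union of the edges is `f⁻¹([0, 1])`. -/
  iUnion_arc : ⋃ e, Set.range (arc e) = f.onSphere ⁻¹' unitSegment
  /-- Different edges do not meet outside their ends. -/
  arc_inj : ∀ e e' t, 0 < t → t < 1 → arc e t = arc e' t → e = e'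
  /-- The cycles of `σ` are the sets of edges at the black vertices. -/
  black : ∀ e e', arc e 0 = arc e' 0 ↔ D.σ.SameCycle e e'
  /-- The multiplicity of `f` at a black vertex is the degree of the vertex. -/
  black_mult : ∀ e, f.mult (arc e 0) = {e' | arc e' 0 = arc e 0}.ncard
  /-- `σ e` is the edge that follows `e` counterclockwise around the black end of `e`: at a vertex
  of degree `m`, the `m` edges start in directions that are `2π / m` apart. -/
  black_ccw : ∀ e, Tendsto
    (fun t => localCoord (arc e 0) (arc (D.σ e) t) / localCoord (arc e 0) (arc e t))
    (𝓝[>] 0) (𝓝 (Complex.exp (2 * Real.pi * Complex.I / f.mult (arc e 0))))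
  /-- The cycles of `α` are the sets of edges at the white vertices. -/
  white : ∀ e e', arc e 1 = arc e' 1 ↔ D.α.SameCycle e e'
  /-- The multiplicity of `f` at a white vertex is the degree of the vertex. -/
  white_mult : ∀ e, f.mult (arc e 1) = {e' | arc e' 1 = arc e 1}.ncard
  /-- `α e` is the edge that follows `e` counterclockwise around the white end of `e`. -/
  white_ccw : ∀ e, Tendsto
    (fun t => localCoord (arc e 1) (arc (D.α e) t) / localCoord (arc e 1) (arc e t))
    (𝓝[<] 1) (𝓝 (Complex.exp (2 * Real.pi * Complex.I / f.mult (arc e 1))))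
  /-- The face on the right-hand side of the edge `e`, directed from black to white. -/
  face : E → Set (OnePoint ℂ)
  face_isOpen : ∀ e, IsOpen (face e)
  /-- The faces are homeomorphic to an open disk. -/
  face_disk : ∀ e, Nonempty (face e ≃ₜ Metric.ball (0 : ℂ) 1)
  /-- The union of the faces is the complement of the graph. -/
  iUnion_face : ⋃ e, face e = (f.onSphere ⁻¹' unitSegment)ᶜ
  /-- The faces are the cycles of `(σ α)⁻¹`. -/
  face_eq : ∀ e e', (D.σ * D.α)⁻¹.SameCycle e e' → face e = face e'
  face_disjoint : ∀ e e', ¬ (D.σ * D.α)⁻¹.SameCycle e e' → Disjoint (face e) (face e')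
  /-- Near the edge `e`, its right-hand side is where `f` takes values in the lower half-plane, as
  `f` maps `e` to the segment from `0` to `1` and preserves the orientation. -/
  face_right : ∀ e t, 0 < t → t < 1 → ∀ᶠ x in 𝓝 (arc e t),
    (∃ c : ℂ, f.onSphere x = c ∧ c.im < 0) → x ∈ face e
  /-- Each face contains exactly one pole, whose multiplicity is the degree of the face. -/
  face_pole : ∀ e, ∃ p ∈ face e, f.onSphere p = ∞ ∧
    f.mult p = {e' | (D.σ * D.α)⁻¹.SameCycle e e'}.ncard ∧
    ∀ q ∈ face e, f.onSphere q = ∞ → q = p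

/-- The rational function `f` on `ℂP¹` is a Belyi function for the dessin `D`. -/
def Dessin.IsBelyiFunction {E : Type} (D : Dessin E) (f : RatFunc ℂ) : Prop :=
  f.IsBelyi ∧ Nonempty (D.Drawing f)

end

noncomputable section

/-! ### The rational function -/

/-! The proof has a combinatorial and an analytic half, which meet in `modelDessin`, a dessin on six
edges with `σ = (0 1 2 3 4)` and `α = (0 5)(2 3)`.

Combinatorics. The rotations of the icosahedron that preserve an axis through two opposite vertices
give one dihedral subgroup (`dihedralHom`). All such subgroups are treated at once, without
computing the automorphism group, through its action on the set `ModelMap` of equivariant maps to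
the model. This set has six elements and the action is faithful. The number of maps fixed by an
automorphism of order 5 is congruent to 6 modulo 5 and is not 6, hence it is 1. A dihedral group of
order 10 normalizes its rotations, so it fixes the same map. That map factors through the quotient,
which has 60/10 = 6 edges, and is therefore an isomorphism (`exists_quotient_equiv`).

Analysis. The function has degree 6, with fibres of type 5+1 over 0 and over ∞ and of type 2+2+1+1
over 1; its derivative shows that nothing else is ramified. So it is a covering over `ℂ ∖ {0, 1}`,
and lifts exist and are unique. Near a special point `v` of multiplicity `m` it looks like `ζ ↦ h (ζ
^ m)` for a model function `h`; pulling back by `exp` gives a `HalfPlaneLift`, on which adding `2πi`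
is the turn from one edge at `v` to the next. Edges are images of the negative real axis under lifts
at black vertices, faces are conformal images of the unit disk under lifts at the poles. As
multiplicities in a fibre add up to 6, these lifts exhaust the fibres
(`HalfPlaneLift.exists_apply_eq`).

What remains is to find the white end of each edge, and this needs no numerical path tracking. The
function is real on the unit circle, where an explicit formula shows that the edges 0 and 5 meet at
`whiteMid`. Reflection in the circle exchanges the edges `j` and `5 - j`, so the other double white
vertex joins either 1 and 4 or 2 and 3 (`whiteIndex_dichotomy`). The edge beside the face of degree
1 must be fixed by `σ α`; in the first case no edge is fixed, so the second case holds
(`whiteIndex_values`). -/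

/-- The simple root of the Belyi function. -/
def blackTip : ℂ := (-3 + 4 * Complex.I) / 5

/-- One of the two double roots of `β = 1`; the other one is its negative. -/
def whiteMid : ℂ := (-1 + 2 * Complex.I) / (√5 : ℝ)

/-- The numerator of the Belyi function. -/
def belyiNum (z : ℂ) : ℂ := (z - 1) ^ 5 * (z - blackTip)

/-- The denominator of the Belyi function. -/
def belyiDen (z : ℂ) : ℂ := (z + 1) ^ 5 * (z + blackTip)

/-- The Belyi function on the finite plane; it has the junk value `0` at the poles. -/
def belyi (z : ℂ) : ℂ := belyiNum z / belyiDen z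

/-- The roots of `X ^ 2 + (6/5) X + 1` are `blackTip` and its conjugate, both of modulus 1. The
identities below for the fibre over 1, the derivative and the reflection hold modulo this relation.
-/
theorem blackTip_sq : blackTip ^ 2 = -(6 / 5) * blackTip - 1 := by
  rw [blackTip]; ring_nf; rw [Complex.I_sq]; ring

theorem sqrt_five_sq : ((√5 : ℝ) : ℂ) ^ 2 = 5 := by
  rw [← Complex.ofReal_pow, Real.sq_sqrt (by norm_num)]; norm_num

theorem sqrt_five_ne : ((√5 : ℝ) : ℂ) ≠ 0 := by
  intro h; have := sqrt_five_sq; rw [h] at this; norm_num at this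

/-- The right-hand side is the conjugate of `blackTip`. The polynomial identities involve `whiteMid`
only through its square, which keeps `√5` out of them. -/
theorem whiteMid_sq : whiteMid ^ 2 = -(6 / 5) - blackTip := by
  rw [whiteMid, blackTip, div_pow, sqrt_five_sq]; ring_nf; rw [Complex.I_sq]; ring

theorem blackTip_im : blackTip.im = 4 / 5 := by
  simp [blackTip]

theorem blackTip_re : blackTip.re = -3 / 5 := by
  simp [blackTip]

/-- Numbers `p + q u` with real `p`, `q` and `q ≠ 0` do not vanish. -/
theorem add_mul_blackTip_ne_zero (p q : ℝ) (hq : q ≠ 0) : (p : ℂ) + q * blackTip ≠ 0 := by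
  intro h
  have := congrArg Complex.im h
  simp [blackTip_im, hq] at this

theorem blackTip_ne_zero : blackTip ≠ 0 := by
  simpa using add_mul_blackTip_ne_zero 0 1 one_ne_zero

theorem blackTip_ne_one : blackTip ≠ 1 := by
  intro h; have := add_mul_blackTip_ne_zero (-1) 1 one_ne_zero; simp [h] at this

theorem blackTip_ne_neg_one : blackTip ≠ -1 := by
  intro h; have := add_mul_blackTip_ne_zero 1 1 one_ne_zero; simp [h] at this

theorem blackTip_add_five_ne_zero : blackTip + 5 ≠ 0 := by
  have := add_mul_blackTip_ne_zero 5 1 one_ne_zero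
  simpa [add_comm] using this

theorem blackTip_ne_neg : blackTip ≠ -blackTip := by
  intro h
  exact blackTip_ne_zero (by linear_combination h / 2)

theorem whiteMid_ne_zero : whiteMid ≠ 0 := by
  intro h
  have h2 := whiteMid_sq
  rw [h] at h2
  have := add_mul_blackTip_ne_zero (-(6 / 5)) (-1) (by norm_num)
  apply this
  push_cast
  linear_combination -h2

theorem whiteMid_ne_neg : whiteMid ≠ -whiteMid := by
  intro h
  exact whiteMid_ne_zero (by linear_combination h / 2)

/-- This is the fibre over 1: one simple and two double points. The degree is 5 and not 6 because
the sixth point of the fibre is `∞`. -/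
theorem belyiDen_sub_belyiNum (z : ℂ) :
    belyiDen z - belyiNum z = 2 * (blackTip + 5) * z * (z ^ 2 - whiteMid ^ 2) ^ 2 := by
  have h1 := blackTip_sq
  rw [belyiDen, belyiNum, whiteMid_sq]
  linear_combination (-(4 * z^3) - 2*z*(blackTip + 5 + 12/5 - 6/5)) * h1

theorem belyiNum_eq_zero {z : ℂ} : belyiNum z = 0 ↔ z = 1 ∨ z = blackTip := by
  simp [belyiNum, sub_eq_zero]

theorem belyiDen_eq_zero {z : ℂ} : belyiDen z = 0 ↔ z = -1 ∨ z = -blackTip := by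
  simp [belyiDen, add_eq_zero_iff_eq_neg]

theorem belyiNum_eq_belyiDen {z : ℂ} :
    belyiNum z = belyiDen z ↔ z = 0 ∨ z = whiteMid ∨ z = -whiteMid := by
  rw [eq_comm, ← sub_eq_zero, belyiDen_sub_belyiNum]
  simp only [mul_eq_zero, blackTip_add_five_ne_zero, OfNat.ofNat_ne_zero, false_or,
    pow_eq_zero_iff, ne_eq, not_false_eq_true, sub_eq_zero, sq_eq_sq_iff_eq_or_eq_neg]

theorem belyiNum_ne_zero_of_belyiDen {z : ℂ} (h : belyiDen z = 0) : belyiNum z ≠ 0 := by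
  rw [belyiDen_eq_zero] at h
  rw [Ne, belyiNum_eq_zero]
  rintro (rfl | rfl) <;> rcases h with h | h
  · norm_num at h
  · exact blackTip_ne_neg_one (by rw [h, neg_neg])
  · exact blackTip_ne_neg_one h
  · exact blackTip_ne_neg h

theorem belyi_eq_zero {z : ℂ} : belyi z = 0 ↔ belyiNum z = 0 ∨ belyiDen z = 0 := by
  rw [belyi, div_eq_zero_iff]

theorem belyi_eq_one {z : ℂ} : belyi z = 1 ↔ z = 0 ∨ z = whiteMid ∨ z = -whiteMid := by
  rw [← belyiNum_eq_belyiDen, belyi]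
  constructor
  · intro h
    exact eq_of_div_eq_one h
  · intro h
    by_cases h0 : belyiDen z = 0
    · exact absurd (h.trans h0) (belyiNum_ne_zero_of_belyiDen h0)
    · rw [h, div_self h0]

/-- The regular values: those outside `{0, 1}`. -/
def regularValues : Set ℂ := {w | w ≠ 0 ∧ w ≠ 1}

theorem belyiDen_ne_zero {z : ℂ} (h : belyi z ≠ 0) : belyiDen z ≠ 0 := fun h0 =>
  h (belyi_eq_zero.2 (.inr h0))

/-- The fourth powers come from the fivefold root 1 and the fivefold pole -1, the quadratic factor
from the two double points over 1. By Riemann–Hurwitz this is everything: `4 + 4 + 1 + 1 = 2 * 6 -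
2`. -/
theorem hasStrictDerivAt_belyi {z : ℂ} (h : belyiDen z ≠ 0) :
    HasStrictDerivAt belyi
      (2 * (blackTip + 5) * (z - 1) ^ 4 * (z + 1) ^ 4 * (z ^ 2 - whiteMid ^ 2) / belyiDen z ^ 2)
      z := by
  have h1 : HasStrictDerivAt belyiNum
      (5 * (z - 1) ^ 4 * (z - blackTip) + (z - 1) ^ 5) z := by
    have := (HasStrictDerivAt.fun_pow ((hasStrictDerivAt_id z).sub_const 1) 5).mul
      ((hasStrictDerivAt_id z).sub_const blackTip)
    refine this.congr_deriv ?_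
    simp
  have h2 : HasStrictDerivAt belyiDen
      (5 * (z + 1) ^ 4 * (z + blackTip) + (z + 1) ^ 5) z := by
    have := (HasStrictDerivAt.fun_pow ((hasStrictDerivAt_id z).add_const 1) 5).mul
      ((hasStrictDerivAt_id z).add_const blackTip)
    refine this.congr_deriv ?_
    simp
  refine (h1.div h2 h).congr_deriv ?_
  congr 1
  rw [belyiNum, belyiDen, whiteMid_sq]
  have h3 := blackTip_sq
  linear_combination (-12 * (z - 1) ^ 4 * (z + 1) ^ 4) * h3

theorem belyi_deriv_ne_zero {z : ℂ} (h : belyi z ∈ regularValues) :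
    2 * (blackTip + 5) * (z - 1) ^ 4 * (z + 1) ^ 4 * (z ^ 2 - whiteMid ^ 2) / belyiDen z ^ 2 ≠ 0 := by
  have hd := belyiDen_ne_zero h.1
  have hn : belyiNum z ≠ 0 := fun h0 => h.1 (belyi_eq_zero.2 (.inl h0))
  have h1 : z - 1 ≠ 0 := fun h0 => hn (by simp [belyiNum, h0])
  have h2 : z + 1 ≠ 0 := fun h0 => hd (by simp [belyiDen, h0])
  have h3 : z ^ 2 - whiteMid ^ 2 ≠ 0 := by
    rw [sub_ne_zero, Ne, sq_eq_sq_iff_eq_or_eq_neg]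
    exact fun h0 => h.2 (belyi_eq_one.2 (.inr h0))
  exact div_ne_zero (mul_ne_zero (mul_ne_zero (mul_ne_zero (mul_ne_zero two_ne_zero
    blackTip_add_five_ne_zero) (pow_ne_zero _ h1)) (pow_ne_zero _ h2)) h3) (pow_ne_zero _ hd)

/-! ### Symmetry in the unit circle, and the values on it. -/

theorem conj_blackTip : (starRingEnd ℂ) blackTip = -(6 / 5) - blackTip := by
  apply Complex.ext <;> norm_num [blackTip_re, blackTip_im]

theorem conj_whiteMid_mul : (starRingEnd ℂ) whiteMid * whiteMid = 1 := by
  have : (starRingEnd ℂ) whiteMid = (-1 - 2 * Complex.I) / (√5 : ℝ) := by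
    simp [whiteMid, Complex.conj_ofNat]; ring
  rw [this, whiteMid, div_mul_div_comm, ← sq, sqrt_five_sq]
  ring_nf; rw [Complex.I_sq]; norm_num

/-- The reflection in the unit circle. -/
def circleReflection (z : ℂ) : ℂ := ((starRingEnd ℂ) z)⁻¹

/-- All roots and poles lie on the unit circle and are fixed by the reflection. Numerator and
denominator are conjugated and acquire the same factor `blackTip * (y⁻¹) ^ 6`, which cancels. -/
theorem belyi_circleReflection {z : ℂ} (hz : z ≠ 0) :
    belyi (circleReflection z) = (starRingEnd ℂ) (belyi z) := by
  have hc : (starRingEnd ℂ) z ≠ 0 := by simpa using hz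
  have h3 := blackTip_sq
  simp only [circleReflection, belyi, belyiNum, belyiDen, map_div₀, map_mul, map_pow, map_sub,
    map_add, map_one, conj_blackTip]
  set y := (starRingEnd ℂ) z
  have e1 : (y⁻¹ - 1) ^ 5 * (y⁻¹ - blackTip) =
      ((y - 1) ^ 5 * (y - (-(6 / 5) - blackTip))) * (blackTip * (y⁻¹) ^ 6) := by
    field_simp
    linear_combination (-5 * (y - 1) ^ 5) * h3
  have e2 : (y⁻¹ + 1) ^ 5 * (y⁻¹ + blackTip) =
      ((y + 1) ^ 5 * (y + (-(6 / 5) - blackTip))) * (blackTip * (y⁻¹) ^ 6) := by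
    field_simp
    linear_combination (5 * (y + 1) ^ 5) * h3
  rw [e1, e2, mul_div_mul_right]
  have := blackTip_ne_zero
  positivity

/-- The unit circle without `-1`, parametrized by the real line. -/
def circlePoint (y : ℝ) : ℂ := (1 + y * Complex.I) / (1 - y * Complex.I)

theorem one_sub_mul_I_ne_zero (y : ℝ) : (1 : ℂ) - y * Complex.I ≠ 0 := by
  intro h
  have := congrArg Complex.re h
  simp at this

theorem circleReflection_circlePoint (y : ℝ) :
    circleReflection (circlePoint y) = circlePoint y := by
  simp [circleReflection, circlePoint, ← sub_eq_add_neg]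

theorem continuous_circlePoint : Continuous circlePoint := by
  unfold circlePoint
  exact Continuous.div (by fun_prop) (by fun_prop) one_sub_mul_I_ne_zero

theorem circlePoint_zero : circlePoint 0 = 1 := by simp [circlePoint]

theorem circlePoint_two : circlePoint 2 = blackTip := by
  have := one_sub_mul_I_ne_zero 2
  rw [circlePoint, div_eq_iff this, blackTip]
  push_cast
  ring_nf; rw [Complex.I_sq]; ring

theorem circlePoint_goldenRatio : circlePoint Real.goldenRatio = whiteMid := by
  have := one_sub_mul_I_ne_zero Real.goldenRatio
  rw [circlePoint, div_eq_iff this, whiteMid, Real.goldenRatio]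
  have h5 := sqrt_five_sq
  have := sqrt_five_ne
  push_cast
  field_simp
  linear_combination (2 : ℂ) * Complex.I_sq + 2 * (√5:ℝ) * Complex.I_sq + Complex.I * h5

/-- In the Cayley coordinate `y` the roots 1 and `blackTip` become 0 and 2, the poles -1 and
`-blackTip` become `∞` and `-1/2`; the non-real factors cancel. -/
theorem belyi_circlePoint {y : ℝ} (hy : 2 * y + 1 ≠ 0) :
    belyi (circlePoint y) = ((y ^ 5 * (2 - y) / (2 * y + 1) : ℝ) : ℂ) := by
  have h0 := one_sub_mul_I_ne_zero y
  have hy' : (2 * y + 1 : ℂ) ≠ 0 := by exact_mod_cast hy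
  have hI : Complex.I ^ 2 = -1 := Complex.I_sq
  set k : ℂ := 2 * Complex.I / (1 - y * Complex.I) with hk
  have a1 : circlePoint y - 1 = y * k := by
    rw [hk, circlePoint]; field_simp; ring
  have a2 : circlePoint y + 1 = -Complex.I * k := by
    rw [hk, circlePoint]; field_simp; linear_combination (2:ℂ) * hI
  have a3 : circlePoint y - blackTip = (2 - y) * ((2 - Complex.I) / 5 * 2 / (1 - y * Complex.I)) := by
    rw [circlePoint, blackTip]; field_simp; linear_combination (4 * y : ℂ) * hI
  have a4 : circlePoint y + blackTip =
      (2 * y + 1) * Complex.I * ((2 - Complex.I) / 5 * 2 / (1 - y * Complex.I)) := by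
    rw [circlePoint, blackTip]; field_simp; linear_combination (2 : ℂ) * hI
  have hk0 : k ≠ 0 := by
    exact div_ne_zero (mul_ne_zero two_ne_zero Complex.I_ne_zero) h0
  have h5 : (2 - Complex.I) / 5 * 2 / (1 - y * Complex.I) ≠ 0 := by
    have : (2 : ℂ) - Complex.I ≠ 0 := by
      intro h; have := congrArg Complex.re h; simp at this
    exact div_ne_zero (mul_ne_zero (div_ne_zero this (by norm_num)) two_ne_zero) h0
  have hI5 : (-Complex.I) ^ 5 = -Complex.I := by
    linear_combination (-Complex.I ^ 3 + Complex.I) * hI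
  rw [belyi, belyiNum, belyiDen, a1, a2, a3, a4, mul_pow, mul_pow, hI5]
  push_cast
  rw [div_eq_div_iff (mul_ne_zero (mul_ne_zero (neg_ne_zero.2 Complex.I_ne_zero)
    (pow_ne_zero _ hk0)) (mul_ne_zero (mul_ne_zero hy' Complex.I_ne_zero) h5)) hy']
  linear_combination (y ^ 5 * k ^ 5 * (2 - y) * (2 * y + 1) * ((2 - Complex.I) / 5 * 2 / (1 - y * Complex.I))) * hI

/-- A value is taken at most six times. -/
theorem card_le_of_belyi_eq {w : ℂ} (hw : w ∈ regularValues) :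
    ∃ s : Finset ℂ, s.card ≤ 6 ∧ ∀ z, belyi z = w → z ∈ s := by
  classical
  set p : ℂ[X] := (X - 1) ^ 5 * (X - C blackTip) - C w * ((X + 1) ^ 5 * (X + C blackTip)) with hp
  have hp0 : p ≠ 0 := by
    intro h
    -- At -1 the term with `w` vanishes, and the other one is `(-2) ^ 5 * (-1 - blackTip)`.
    have h1 := congrArg (Polynomial.eval (-1 : ℂ)) h
    rw [hp] at h1
    have : blackTip + 1 ≠ 0 := fun h => blackTip_ne_neg_one (by linear_combination h)
    simp at h1
    rcases h1 with h1 | h1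
    · norm_num at h1
    · exact this (by linear_combination -h1)
  have hd : p.natDegree ≤ 6 := by
    rw [hp]
    compute_degree
  refine ⟨p.roots.toFinset, (Multiset.toFinset_card_le _).trans ((card_roots' p).trans hd), ?_⟩
  intro z hz
  rw [Multiset.mem_toFinset, mem_roots hp0, IsRoot.def, hp]
  have h0 := belyiDen_ne_zero (hz ▸ hw.1)
  rw [belyi, div_eq_iff h0, belyiNum, belyiDen] at hz
  simp [hz]

/-! ### The rational function on the Riemann sphere -/

/-- The numerator of the Belyi function, as a polynomial. -/
def belyiNumPoly : ℂ[X] := (X - C 1) ^ 5 * (X - C blackTip)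

/-- The denominator of the Belyi function, as a polynomial. -/
def belyiDenPoly : ℂ[X] := (X - C (-1)) ^ 5 * (X - C (-blackTip))

/-- The Belyi function, as an element of the field of rational functions. -/
def belyiRat : RatFunc ℂ :=
  ((RatFunc.X - 1) ^ 5 *
      (RatFunc.C (2 + Complex.I) * RatFunc.X + RatFunc.C (2 - Complex.I))) /
    ((RatFunc.X + 1) ^ 5 *
      (RatFunc.C (2 + Complex.I) * RatFunc.X - RatFunc.C (2 - Complex.I)))

theorem monic_belyiNumPoly : belyiNumPoly.Monic :=
  ((monic_X_sub_C 1).pow 5).mul (monic_X_sub_C _)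

theorem monic_belyiDenPoly : belyiDenPoly.Monic :=
  ((monic_X_sub_C (-1)).pow 5).mul (monic_X_sub_C _)

theorem eval_belyiNumPoly (z : ℂ) : belyiNumPoly.eval z = belyiNum z := by
  simp [belyiNumPoly, belyiNum]

theorem eval_belyiDenPoly (z : ℂ) : belyiDenPoly.eval z = belyiDen z := by
  simp [belyiDenPoly, belyiDen]

theorem natDegree_belyiNumPoly : belyiNumPoly.natDegree = 6 := by
  rw [belyiNumPoly, ((monic_X_sub_C 1).pow 5).natDegree_mul (monic_X_sub_C _), natDegree_pow,
    natDegree_X_sub_C, natDegree_X_sub_C]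

theorem natDegree_belyiDenPoly : belyiDenPoly.natDegree = 6 := by
  rw [belyiDenPoly, ((monic_X_sub_C (-1)).pow 5).natDegree_mul (monic_X_sub_C _), natDegree_pow,
    natDegree_X_sub_C, natDegree_X_sub_C]

theorem isCoprime_belyiPoly : IsCoprime belyiNumPoly belyiDenPoly := by
  have key : ∀ p q : ℂ, p ≠ q → IsCoprime (X - C p) (X - C q) := fun p q h =>
    isCoprime_X_sub_C_of_isUnit_sub (sub_ne_zero.2 h).isUnit
  unfold belyiNumPoly belyiDenPoly
  refine IsCoprime.mul_left (IsCoprime.pow_left ?_) ?_ <;>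
    refine IsCoprime.mul_right (IsCoprime.pow_right (key _ _ ?_)) (key _ _ ?_)
  · norm_num
  · exact fun h => blackTip_ne_neg_one (by rw [h, neg_neg])
  · exact blackTip_ne_neg_one
  · exact blackTip_ne_neg

/-- Dividing numerator and denominator by `2 + I` makes them monic; being coprime as well, they are
`num` and `denom` of the rational function. -/
theorem belyiRat_eq : belyiRat =
    algebraMap ℂ[X] (RatFunc ℂ) belyiNumPoly / algebraMap ℂ[X] (RatFunc ℂ) belyiDenPoly := by
  have ha : (2 + Complex.I : ℂ) ≠ 0 := by
    intro h; have := congrArg Complex.re h; simp at this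
  have hb : (2 + Complex.I) * blackTip = -(2 - Complex.I) := by
    rw [blackTip]; ring_nf; rw [Complex.I_sq]; ring
  have hC : RatFunc.C (2 + Complex.I : ℂ) ≠ 0 := by
    rw [Ne, map_eq_zero]; exact ha
  have hb' : RatFunc.C (2 + Complex.I) * RatFunc.C blackTip = -RatFunc.C (2 - Complex.I) := by
    rw [← map_mul, hb, map_neg]
  rw [belyiRat]
  generalize RatFunc.C (2 - Complex.I) = q at hb'
  generalize RatFunc.C (2 + Complex.I) = p at hb' hC
  have e1 : ((RatFunc.X : RatFunc ℂ) - 1) ^ 5 *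
      (p * RatFunc.X + q) =
      p * algebraMap ℂ[X] (RatFunc ℂ) belyiNumPoly := by
    simp only [belyiNumPoly, map_mul, map_pow, map_sub, RatFunc.algebraMap_X,
      RatFunc.algebraMap_C, map_one]
    linear_combination (((RatFunc.X : RatFunc ℂ) - 1) ^ 5) * hb'
  have e2 : ((RatFunc.X : RatFunc ℂ) + 1) ^ 5 *
      (p * RatFunc.X - q) =
      p * algebraMap ℂ[X] (RatFunc ℂ) belyiDenPoly := by
    simp only [belyiDenPoly, map_mul, map_pow, map_sub, RatFunc.algebraMap_X,
      RatFunc.algebraMap_C, map_one, map_neg]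
    linear_combination (-((RatFunc.X : RatFunc ℂ) + 1) ^ 5) * hb'
  rw [e1, e2, mul_div_mul_left _ _ hC]

theorem num_belyiRat : belyiRat.num = belyiNumPoly := by
  classical
  rw [belyiRat_eq, RatFunc.num_div]
  have : gcd belyiNumPoly belyiDenPoly = 1 := by
    rw [← normalize_gcd, normalize_eq_one]
    exact (gcd_isUnit_iff _ _).2 isCoprime_belyiPoly
  rw [this, EuclideanDomain.div_one, EuclideanDomain.div_one, monic_belyiDenPoly.leadingCoeff]
  simp

theorem denom_belyiRat : belyiRat.denom = belyiDenPoly := by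
  classical
  rw [belyiRat_eq, RatFunc.denom_div _ monic_belyiDenPoly.ne_zero]
  have : gcd belyiNumPoly belyiDenPoly = 1 := by
    rw [← normalize_gcd, normalize_eq_one]
    exact (gcd_isUnit_iff _ _).2 isCoprime_belyiPoly
  rw [this, EuclideanDomain.div_one, monic_belyiDenPoly.leadingCoeff]
  simp

open OnePoint

theorem onSphere_infty : belyiRat.onSphere ∞ = ((1 : ℂ) : OnePoint ℂ) := by
  have h : belyiNumPoly.coeff 6 = 1 := by
    rw [← natDegree_belyiNumPoly]; exact monic_belyiNumPoly.coeff_natDegree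
  simp only [RatFunc.onSphere, num_belyiRat, denom_belyiRat, natDegree_belyiNumPoly,
    natDegree_belyiDenPoly, lt_irrefl, if_false, monic_belyiDenPoly.leadingCoeff, h, div_one]

theorem onSphere_pole {z : ℂ} (h : belyiDen z = 0) : belyiRat.onSphere z = ∞ := by
  change (if belyiRat.denom.eval z = 0 then _ else _) = _
  rw [denom_belyiRat, eval_belyiDenPoly, if_pos h]

theorem onSphere_coe {z : ℂ} (h : belyiDen z ≠ 0) :
    belyiRat.onSphere z = (belyi z : OnePoint ℂ) := by
  change (if belyiRat.denom.eval z = 0 then _ else _) = _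
  rw [denom_belyiRat, num_belyiRat, eval_belyiDenPoly, eval_belyiNumPoly, if_neg h, belyi]

theorem onSphere_eq_coe_iff {z w : ℂ} :
    belyiRat.onSphere z = (w : OnePoint ℂ) ↔ belyiDen z ≠ 0 ∧ belyi z = w := by
  by_cases h : belyiDen z = 0
  · simp [onSphere_pole h, h]
  · simp [onSphere_coe h, h]

theorem onSphere_coe_of_ne_zero {z : ℂ} (h : belyi z ≠ 0) :
    belyiRat.onSphere z = (belyi z : OnePoint ℂ) :=
  onSphere_coe (belyiDen_ne_zero h)

theorem onSphere_eq_infty_iff {x : OnePoint ℂ} :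
    belyiRat.onSphere x = ∞ ↔ x = ((-1 : ℂ) : OnePoint ℂ) ∨ x = ((-blackTip : ℂ) : OnePoint ℂ) := by
  induction x using OnePoint.rec with
  | infty => simp [onSphere_infty]
  | coe z =>
    rw [OnePoint.coe_eq_coe, OnePoint.coe_eq_coe, ← belyiDen_eq_zero]
    by_cases h : belyiDen z = 0
    · simp [onSphere_pole h, h]
    · simp [onSphere_coe h, h]

theorem onSphere_eq_zero_iff {x : OnePoint ℂ} :
    belyiRat.onSphere x = ((0 : ℂ) : OnePoint ℂ) ↔
      x = ((1 : ℂ) : OnePoint ℂ) ∨ x = (blackTip : OnePoint ℂ) := by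
  induction x using OnePoint.rec with
  | infty => simp [onSphere_infty]
  | coe z =>
    rw [OnePoint.coe_eq_coe, OnePoint.coe_eq_coe, ← belyiNum_eq_zero, onSphere_eq_coe_iff,
      belyi_eq_zero]
    have := @belyiNum_ne_zero_of_belyiDen z
    tauto

theorem onSphere_eq_one_iff {x : OnePoint ℂ} :
    belyiRat.onSphere x = ((1 : ℂ) : OnePoint ℂ) ↔
      x = (whiteMid : OnePoint ℂ) ∨ x = ((-whiteMid : ℂ) : OnePoint ℂ) ∨
        x = ((0 : ℂ) : OnePoint ℂ) ∨ x = ∞ := by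
  induction x using OnePoint.rec with
  | infty => simp [onSphere_infty]
  | coe z =>
    simp only [OnePoint.coe_eq_coe, OnePoint.coe_ne_infty, or_false, onSphere_eq_coe_iff,
      belyi_eq_one]
    constructor
    · tauto
    · intro h
      have h1 : belyi z = 1 := belyi_eq_one.2 (by tauto)
      exact ⟨belyiDen_ne_zero (by rw [h1]; exact one_ne_zero), by tauto⟩

/-! ### Multiplicities at the special points. -/

theorem rootMultiplicity_X_sub_C_pow_mul {p : ℂ[X]} {a : ℂ} (n : ℕ) (h : p.eval a ≠ 0) :
    ((X - C a) ^ n * p).rootMultiplicity a = n := by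
  have hp : p ≠ 0 := by rintro rfl; simp at h
  rw [mul_comm, rootMultiplicity_mul_X_sub_C_pow hp, rootMultiplicity_eq_zero h, zero_add]

theorem mult_coe {z c : ℂ} (h : belyiRat.onSphere z = (c : OnePoint ℂ)) :
    belyiRat.mult z = (belyiNumPoly - C c * belyiDenPoly).rootMultiplicity z := by
  change (belyiRat.fiberPoly (belyiRat.onSphere z)).rootMultiplicity z = _
  rw [h]
  change (belyiRat.num - C c * belyiRat.denom).rootMultiplicity z = _
  rw [num_belyiRat, denom_belyiRat]

theorem mult_pole {z : ℂ} (h : belyiDen z = 0) :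
    belyiRat.mult z = belyiDenPoly.rootMultiplicity z := by
  change (belyiRat.fiberPoly (belyiRat.onSphere z)).rootMultiplicity z = _
  rw [onSphere_pole h]
  change belyiRat.denom.rootMultiplicity z = _
  rw [denom_belyiRat]

theorem mult_one : belyiRat.mult ((1 : ℂ) : OnePoint ℂ) = 5 := by
  rw [mult_coe (onSphere_eq_zero_iff.2 (.inl rfl)), C_0, zero_mul, sub_zero, belyiNumPoly]
  apply rootMultiplicity_X_sub_C_pow_mul
  simpa [sub_eq_zero] using blackTip_ne_one.symm

theorem mult_blackTip : belyiRat.mult (blackTip : OnePoint ℂ) = 1 := by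
  rw [mult_coe (onSphere_eq_zero_iff.2 (.inr rfl)), C_0, zero_mul, sub_zero, belyiNumPoly,
    mul_comm, ← pow_one (X - C blackTip)]
  apply rootMultiplicity_X_sub_C_pow_mul
  simpa [sub_eq_zero] using blackTip_ne_one

theorem mult_neg_one : belyiRat.mult ((-1 : ℂ) : OnePoint ℂ) = 5 := by
  rw [mult_pole (belyiDen_eq_zero.2 (.inl rfl)), belyiDenPoly]
  apply rootMultiplicity_X_sub_C_pow_mul
  rw [eval_sub, eval_X, eval_C, sub_ne_zero]
  exact fun h => blackTip_ne_one (neg_injective h).symm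

theorem mult_neg_blackTip : belyiRat.mult ((-blackTip : ℂ) : OnePoint ℂ) = 1 := by
  rw [mult_pole (belyiDen_eq_zero.2 (.inr rfl)), belyiDenPoly, mul_comm,
    ← pow_one (X - C (-blackTip))]
  apply rootMultiplicity_X_sub_C_pow_mul
  rw [eval_pow, eval_sub, eval_X, eval_C]
  exact pow_ne_zero _ (sub_ne_zero.2 fun h => blackTip_ne_one (neg_injective h))

theorem belyiPoly_sub : belyiNumPoly - C 1 * belyiDenPoly =
    X * ((X - C whiteMid) ^ 2 * ((X - C (-whiteMid)) ^ 2 * C (-2 * (blackTip + 5)))) := by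
  refine Polynomial.funext fun z => ?_
  have := belyiDen_sub_belyiNum z
  simp only [eval_sub, eval_mul, eval_C, eval_X, eval_pow, eval_belyiNumPoly, eval_belyiDenPoly]
  linear_combination -this

theorem leading_ne_zero : -2 * (blackTip + 5) ≠ 0 :=
  mul_ne_zero (by norm_num) blackTip_add_five_ne_zero

theorem mult_zero : belyiRat.mult ((0 : ℂ) : OnePoint ℂ) = 1 := by
  rw [mult_coe (onSphere_eq_one_iff.2 (by simp)), belyiPoly_sub]
  have := rootMultiplicity_X_sub_C_pow_mul (a := 0) (n := 1)
    (p := (X - C whiteMid) ^ 2 * ((X - C (-whiteMid)) ^ 2 * C (-2 * (blackTip + 5))))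
    (by simp [whiteMid_ne_zero, blackTip_add_five_ne_zero])
  simpa using this

theorem mult_whiteMid : belyiRat.mult (whiteMid : OnePoint ℂ) = 2 := by
  rw [mult_coe (onSphere_eq_one_iff.2 (by simp)), belyiPoly_sub, mul_left_comm]
  apply rootMultiplicity_X_sub_C_pow_mul
  have : whiteMid + whiteMid ≠ 0 := by rw [← two_mul]; simp [whiteMid_ne_zero]
  simp [whiteMid_ne_zero, blackTip_add_five_ne_zero, this]

theorem mult_neg_whiteMid : belyiRat.mult ((-whiteMid : ℂ) : OnePoint ℂ) = 2 := by
  rw [mult_coe (onSphere_eq_one_iff.2 (by simp)), belyiPoly_sub,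
    mul_left_comm ((X - C whiteMid) ^ 2), mul_left_comm]
  apply rootMultiplicity_X_sub_C_pow_mul
  have : -whiteMid - whiteMid ≠ 0 := by
    rw [← neg_add', ← two_mul]; simp [whiteMid_ne_zero]
  simp [whiteMid_ne_zero, blackTip_add_five_ne_zero, this]

/-- The value is 6 − 5: the fibre polynomial over 1 loses one degree. -/
theorem mult_infty : belyiRat.mult ∞ = 1 := by
  change max belyiRat.num.natDegree belyiRat.denom.natDegree -
    (belyiRat.fiberPoly (belyiRat.onSphere ∞)).natDegree = 1
  rw [onSphere_infty]
  change max belyiRat.num.natDegree belyiRat.denom.natDegree -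
    (belyiRat.num - C 1 * belyiRat.denom).natDegree = 1
  rw [num_belyiRat, denom_belyiRat, natDegree_belyiNumPoly, natDegree_belyiDenPoly, belyiPoly_sub,
    ← mul_assoc, ← mul_assoc, natDegree_mul_C leading_ne_zero,
    (monic_X.mul ((monic_X_sub_C _).pow 2)).natDegree_mul ((monic_X_sub_C _).pow 2),
    monic_X.natDegree_mul ((monic_X_sub_C _).pow 2), natDegree_pow, natDegree_pow]
  simp

/-- Near a point `z` with regular value `c`, the fibre polynomial is `(belyi - c) * belyiDen`. A
multiple root would make its derivative vanish at `z`, but this derivative is `belyi' z * belyiDen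
z`, a product of nonzero numbers. -/
theorem isBelyi_belyiRat : belyiRat.IsBelyi := by
  refine ⟨by rw [num_belyiRat, natDegree_belyiNumPoly]; simp, fun x hx => ?_⟩
  induction x using OnePoint.rec with
  | infty => exact .inr (.inl onSphere_infty)
  | coe z =>
    by_cases h : belyiDen z = 0
    · exact .inr (.inr (onSphere_pole h))
    rw [onSphere_coe h, OnePoint.coe_eq_coe, OnePoint.coe_eq_coe]
    by_contra! hreg
    obtain ⟨h0, h1, -⟩ := hreg
    rw [mult_coe (onSphere_coe h)] at hx
    set c := belyi z
    set p := belyiNumPoly - C c * belyiDenPoly with hp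
    have hp0 : p ≠ 0 := by
      intro h
      rw [h] at hx
      simp at hx
    have hroot : p.derivative.IsRoot z := by
      have := (one_lt_rootMultiplicity_iff_isRoot hp0).1 hx
      exact this.2
    have hd : HasDerivAt (fun y => p.eval y) (p.derivative.eval z) z := p.hasDerivAt z
    have hq : HasDerivAt (fun y => (belyi y - c) * belyiDen y)
        (2 * (blackTip + 5) * (z - 1) ^ 4 * (z + 1) ^ 4 * (z ^ 2 - whiteMid ^ 2) /
          belyiDen z ^ 2 * belyiDen z) z := by
      have hden : HasDerivAt belyiDen (belyiDenPoly.derivative.eval z) z := by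
        have := belyiDenPoly.hasDerivAt z
        simpa only [eval_belyiDenPoly] using this
      have := ((hasStrictDerivAt_belyi h).hasDerivAt.sub_const c).mul hden
      refine this.congr_deriv ?_
      simp [c]
    have hev : (fun y => (belyi y - c) * belyiDen y) =ᶠ[𝓝 z] fun y => p.eval y := by
      have hcont : ContinuousAt belyiDen z := by unfold belyiDen; fun_prop
      filter_upwards [hcont.eventually_ne h] with y hy
      rw [hp, eval_sub, eval_mul, eval_C, eval_belyiNumPoly, eval_belyiDenPoly, belyi, sub_mul,
        div_mul_cancel₀ _ hy]
    have := hd.unique (hq.congr_of_eventuallyEq hev.symm)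
    rw [hroot.eq_zero] at this
    exact mul_ne_zero (belyi_deriv_ne_zero ⟨h0, h1⟩) h this.symm

/-! ### Lifting along the Belyi function -/

open OnePoint

theorem tendsto_belyi_cobounded : Tendsto belyi (Bornology.cobounded ℂ) (𝓝 1) := by
  have h1 : Tendsto (fun z : ℂ => z⁻¹) (Bornology.cobounded ℂ) (𝓝 0) := tendsto_inv₀_cobounded
  have h2 : ContinuousAt (fun y : ℂ => ((1 - y) ^ 5 * (1 - blackTip * y)) /
      ((1 + y) ^ 5 * (1 + blackTip * y))) 0 := by
    refine ContinuousAt.div (by fun_prop) (by fun_prop) (by simp)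
  have h3 := h2.tendsto.comp h1
  simp only [sub_zero, mul_zero, one_pow, mul_one, add_zero, div_one] at h3
  refine h3.congr' ?_
  filter_upwards [Bornology.eventually_ne_cobounded (0 : ℂ)] with z hz
  simp only [Function.comp_apply, belyi, belyiNum, belyiDen]
  have e1 : (z - 1) ^ 5 * (z - blackTip) = (1 - z⁻¹) ^ 5 * (1 - blackTip * z⁻¹) * z ^ 6 := by
    field_simp
  have e2 : (z + 1) ^ 5 * (z + blackTip) = (1 + z⁻¹) ^ 5 * (1 + blackTip * z⁻¹) * z ^ 6 := by
    field_simp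
  rw [e1, e2, mul_div_mul_right _ _ (pow_ne_zero _ hz)]

theorem continuousAt_belyi {z : ℂ} (h : belyiDen z ≠ 0) : ContinuousAt belyi z :=
  (hasStrictDerivAt_belyi h).hasDerivAt.continuousAt

theorem continuous_belyiDen : Continuous belyiDen := by unfold belyiDen; fun_prop

theorem continuous_belyiNum : Continuous belyiNum := by unfold belyiNum; fun_prop

theorem continuous_onSphere : Continuous belyiRat.onSphere := by
  rw [continuous_iff_continuousAt]
  intro x
  induction x using OnePoint.rec with
  | infty =>
    rw [continuousAt_infty', onSphere_infty, coclosedCompact_eq_cocompact,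
      ← Metric.cobounded_eq_cocompact]
    have h := (continuous_coe.tendsto (1 : ℂ)).comp tendsto_belyi_cobounded
    refine h.congr' ?_
    have h0 : ∀ᶠ z in Bornology.cobounded ℂ, belyi z ≠ 0 :=
      tendsto_belyi_cobounded.eventually_ne one_ne_zero
    filter_upwards [h0] with z hz
    simp [onSphere_coe_of_ne_zero hz]
  | coe z =>
    rw [continuousAt_coe]
    by_cases h : belyiDen z = 0
    · rw [ContinuousAt, Function.comp_apply, onSphere_pole h]
      have hn : belyiNum z ≠ 0 := belyiNum_ne_zero_of_belyiDen h
      rw [tendsto_nhds]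
      intro s hs hmem
      -- Near a pole the continuous quantity is the reciprocal, which tends to 0; inverting sends
      -- punctured neighbourhoods of 0 to neighbourhoods of `∞`.
      have h1 : Tendsto (fun y => belyiDen y / belyiNum y) (𝓝 z) (𝓝 0) := by
        have := (continuous_belyiDen.continuousAt (x := z)).div continuous_belyiNum.continuousAt hn
        rw [ContinuousAt, Pi.div_apply, h, zero_div] at this
        exact this
      have h2 : ∀ᶠ w in Bornology.cobounded ℂ, ((w : ℂ) : OnePoint ℂ) ∈ s := by
        have h3 : s ∈ 𝓝 (∞ : OnePoint ℂ) := hs.mem_nhds hmem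
        have h4 := tendsto_coe_infty (X := ℂ) h3
        rwa [coclosedCompact_eq_cocompact, ← Metric.cobounded_eq_cocompact] at h4
      have h5 : ∀ᶠ w in 𝓝[≠] (0 : ℂ), ((w⁻¹ : ℂ) : OnePoint ℂ) ∈ s :=
        tendsto_inv₀_nhdsNE_zero.eventually h2
      rw [eventually_nhdsWithin_iff] at h5
      filter_upwards [h1.eventually h5, continuous_belyiNum.continuousAt.eventually_ne hn]
        with y hy hyn
      change belyiRat.onSphere y ∈ s
      by_cases hyd : belyiDen y = 0
      · rw [onSphere_pole hyd]; exact hmem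
      · rw [onSphere_coe hyd]
        have := hy (div_ne_zero hyd hyn)
        rwa [inv_div] at this
    · rw [ContinuousAt, Function.comp_apply, onSphere_coe h]
      refine ((continuous_coe.tendsto _).comp (continuousAt_belyi h).tendsto).congr' ?_
      filter_upwards [continuous_belyiDen.continuousAt.eventually_ne h] with y hy
      simp [onSphere_coe hy]

/-- The inverse function theorem gives local homeomorphisms at the points over regular values. The
sphere is compact, so this is already a covering there. -/
theorem isCoveringMapOn_onSphere :
    IsCoveringMapOn belyiRat.onSphere ((↑) '' regularValues : Set (OnePoint ℂ)) := by
  refine IsCoveringMapOn.of_isLocalHomeomorphOn continuous_onSphere ?_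
  refine IsLocalHomeomorphOn.mk _ _ fun x hx => ?_
  obtain ⟨w, hw, hwx⟩ := hx
  induction x using OnePoint.rec with
  | infty =>
    rw [onSphere_infty, OnePoint.coe_eq_coe] at hwx
    exact absurd hwx hw.2
  | coe z =>
    obtain ⟨hd, hz⟩ := onSphere_eq_coe_iff.1 hwx.symm
    rw [← hz] at hw
    set φ := ((hasStrictDerivAt_belyi hd).hasStrictFDerivAt_equiv
      (belyi_deriv_ne_zero hw)).toOpenPartialHomeomorph with hφ
    have hφz : z ∈ φ.source := HasStrictFDerivAt.mem_toOpenPartialHomeomorph_source _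
    have hopen : IsOpen {y | belyiDen y ≠ 0} := isOpen_ne_fun continuous_belyiDen continuous_const
    set ι : OpenPartialHomeomorph ℂ (OnePoint ℂ) :=
      (isOpenEmbedding_coe (X := ℂ)).toOpenPartialHomeomorph with hι
    -- The local inverse chart of ℂ is carried to the sphere, after removing the poles, where
    -- `belyi` and `onSphere` differ.
    refine ⟨(ι.symm.trans (φ.restrOpen _ hopen)).trans ι, ?_, ?_⟩
    · have : ι.symm (z : OnePoint ℂ) = z := ι.left_inv (x := z) (by simp [hι])
      simp [hι] at this ⊢
      simp [this, hφz, hd]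
    · rintro y hy
      simp only [OpenPartialHomeomorph.trans_source, Set.mem_inter_iff, Set.mem_preimage] at hy
      obtain ⟨⟨hy1, hy2⟩, -⟩ := hy
      have hy1' : y ∈ ι.target := hy1
      obtain ⟨t, rfl⟩ : ∃ t : ℂ, (t : OnePoint ℂ) = y := by
        simpa [hι] using hy1'
      have : ι.symm (t : OnePoint ℂ) = t := ι.left_inv (x := t) (by simp [hι])
      simp only [OpenPartialHomeomorph.trans_apply, this]
      rw [this] at hy2
      have h2 : belyiDen t ≠ 0 := by
        have := hy2; simp at this; exact this.2
      rw [onSphere_coe h2]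
      rfl

/-- Lifting along the Belyi function from open sets that are star-shaped. -/
theorem exists_belyi_lift {U : Set ℂ} (hU : IsOpen U) {a : ℂ} (hs : StarConvex ℝ a U) (ha : a ∈ U)
    {φ : ℂ → ℂ} (hφ : ContinuousOn φ U) (hreg : ∀ s ∈ U, φ s ∈ regularValues)
    {s₀ : ℂ} (hs₀ : s₀ ∈ U) {z : ℂ} (hz : belyi z = φ s₀) :
    ∃ g : ℂ → ℂ, ContinuousOn g U ∧ (∀ s ∈ U, belyi (g s) = φ s) ∧ g s₀ = z := by
  have : ContractibleSpace U := hs.contractibleSpace ⟨a, ha⟩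
  have : LocallyPathConnectedSpace U := hU.locallyPathConnectedSpace
  have hc : Continuous fun s : U => ((φ s : ℂ) : OnePoint ℂ) :=
    continuous_coe.comp (continuousOn_iff_continuous_domRestrict.1 hφ)
  have hz0 : belyi z ≠ 0 := by rw [hz]; exact (hreg _ hs₀).1
  obtain ⟨G, ⟨hG0, hG⟩, -⟩ := isCoveringMapOn_onSphere.existsUnique_continuousMap_lifts
    (A := U) ⟨_, hc⟩ (a₀ := ⟨s₀, hs₀⟩) (e₀ := (z : OnePoint ℂ))
    (by rw [onSphere_coe_of_ne_zero hz0, hz]; rfl) (fun s => ⟨φ s, hreg _ s.2, rfl⟩)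
  have hG' : ∀ s : U, belyiRat.onSphere (G s) = (φ s : OnePoint ℂ) := fun s => congrFun hG s
  -- The lift stays in the finite plane because `∞` lies over the excluded value 1.
  have hfin : ∀ s : U, ∃ y : ℂ, (y : OnePoint ℂ) = G s := by
    intro s
    rw [← ne_infty_iff_exists]
    intro h
    have := hG' s
    rw [h, onSphere_infty, OnePoint.coe_eq_coe] at this
    exact (hreg _ s.2).2 this.symm
  choose g hg using hfin
  have hgc : Continuous g := by
    rw [isOpenEmbedding_coe.isEmbedding.continuous_iff]
    exact G.continuous.congr fun s => (hg s).symm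
  classical
  refine ⟨fun s => if h : s ∈ U then g ⟨s, h⟩ else 0, ?_, ?_, ?_⟩
  · rw [continuousOn_iff_continuous_domRestrict]
    refine hgc.congr fun s => ?_
    simp
  · intro s h
    simp only [h, dite_true]
    have := hG' ⟨s, h⟩
    rw [← hg] at this
    exact (onSphere_eq_coe_iff.1 this).2
  · simp only [hs₀, dite_true]
    rw [← OnePoint.coe_eq_coe, hg, hG0]

theorem exists_nhds_injOn_belyi {z : ℂ} (hz : belyi z ∈ regularValues) :
    ∃ V ∈ 𝓝 z, Set.InjOn belyi V :=
  ⟨_, ((hasStrictDerivAt_belyi (belyiDen_ne_zero hz.1)).hasStrictFDerivAt_equiv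
    (belyi_deriv_ne_zero hz)).toOpenPartialHomeomorph.open_source.mem_nhds
      (HasStrictFDerivAt.mem_toOpenPartialHomeomorph_source _),
    OpenPartialHomeomorph.injOn _⟩

/-- Lifts along the Belyi function that agree at a point agree on a preconnected set. -/
theorem belyi_lift_unique {A : Type*} [TopologicalSpace A] {U : Set A} (hU : IsPreconnected U)
    {g₁ g₂ : A → ℂ} (h₁ : ContinuousOn g₁ U) (h₂ : ContinuousOn g₂ U)
    (hreg : ∀ s ∈ U, belyi (g₁ s) ∈ regularValues) (h : ∀ s ∈ U, belyi (g₁ s) = belyi (g₂ s))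
    {a : A} (ha : a ∈ U) (hag : g₁ a = g₂ a) : Set.EqOn g₁ g₂ U := by
  have : PreconnectedSpace U := isPreconnected_iff_preconnectedSpace.1 hU
  have hinj : IsLocallyInjective fun z : {z : ℂ // belyi z ∈ regularValues} => belyi z := by
    rw [isLocallyInjective_iff_nhds]
    rintro ⟨z, hz⟩
    obtain ⟨V, hV, hVi⟩ := exists_nhds_injOn_belyi hz
    refine ⟨Subtype.val ⁻¹' V, continuous_subtype_val.continuousAt.preimage_mem_nhds hV, ?_⟩
    intro x hx y hy hxy
    exact Subtype.ext (hVi hx hy hxy)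
  set G₁ : U → {z : ℂ // belyi z ∈ regularValues} := fun s => ⟨g₁ s, hreg s s.2⟩ with hG₁
  set G₂ : U → {z : ℂ // belyi z ∈ regularValues} :=
    fun s => ⟨g₂ s, h s s.2 ▸ hreg s s.2⟩ with hG₂
  have c₁ : Continuous G₁ := (continuousOn_iff_continuous_domRestrict.1 h₁).subtype_mk _
  have c₂ : Continuous G₂ := (continuousOn_iff_continuous_domRestrict.1 h₂).subtype_mk _
  have he : (fun z : {z : ℂ // belyi z ∈ regularValues} => belyi z) ∘ G₁ =
      (fun z : {z : ℂ // belyi z ∈ regularValues} => belyi z) ∘ G₂ := funext fun s => h s s.2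
  have := (T2Space.isSeparatedMap _).eq_of_comp_eq hinj c₁ c₂ he ⟨a, ha⟩ (Subtype.ext hag)
  intro s hs
  exact congrArg Subtype.val (congrFun this ⟨s, hs⟩)

/-- Continuous lifts of holomorphic functions along the Belyi function are holomorphic. -/
theorem differentiableAt_belyi_lift {g φ : ℂ → ℂ} {s : ℂ} (hg : ContinuousAt g s)
    (hφ : DifferentiableAt ℂ φ s) (hreg : φ s ∈ regularValues)
    (h : ∀ᶠ t in 𝓝 s, belyi (g t) = φ t) : DifferentiableAt ℂ g s := by
  have hs : belyi (g s) = φ s := h.self_of_nhds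
  rw [← hs] at hreg
  have hd := hasStrictDerivAt_belyi (belyiDen_ne_zero hreg.1)
  have hne := belyi_deriv_ne_zero hreg
  have hl := hd.to_localInverse hne
  have hev := hd.hasStrictFDerivAt_equiv hne |>.eventually_left_inverse
  have : g =ᶠ[𝓝 s] fun t => hd.localInverse _ _ _ hne (φ t) := by
    filter_upwards [hg.eventually hev, h] with t ht ht'
    rw [← ht']
    exact ht.symm
  refine DifferentiableAt.congr_of_eventuallyEq ?_ this
  rw [hs] at hl
  exact DifferentiableAt.comp (f := φ) s hl.hasDerivAt.differentiableAt hφ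

/-! ### Local uniformization -/

/-- Dividing by `H v` brings the value at `v` to 1, away from the cut of the logarithm; the constant
is corrected by a root `c` of `H v`. -/
theorem AnalyticAt.exists_root {H : ℂ → ℂ} {v : ℂ} (hH : AnalyticAt ℂ H v) (h0 : H v ≠ 0) {m : ℕ}
    (hm : m ≠ 0) : ∃ r : ℂ → ℂ, AnalyticAt ℂ r v ∧ r v ≠ 0 ∧ ∀ᶠ z in 𝓝 v, r z ^ m = H z := by
  have hm' : (m : ℂ) ≠ 0 := Nat.cast_ne_zero.2 hm
  set c := (H v) ^ ((m : ℂ)⁻¹) with hc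
  have hcm : c ^ m = H v := Complex.cpow_nat_inv_pow _ hm
  have hc0 : c ≠ 0 := by
    intro h; rw [h, zero_pow hm] at hcm; exact h0 hcm.symm
  have hq : AnalyticAt ℂ (fun z => H z / H v) v := hH.div analyticAt_const h0
  refine ⟨fun z => c * Complex.exp (Complex.log (H z / H v) / m), ?_, ?_, ?_⟩
  · refine analyticAt_const.mul (AnalyticAt.cexp ?_)
    exact (hq.clog (by simp [h0])).div analyticAt_const hm'
  · exact mul_ne_zero hc0 (Complex.exp_ne_zero _)
  · filter_upwards [hH.continuousAt.eventually_ne h0] with z hz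
    rw [mul_pow, hcm, ← Complex.exp_nat_mul, mul_div_cancel₀ _ hm',
      Complex.exp_log (div_ne_zero hz h0), mul_div_cancel₀ _ h0]

/-- Both sides are `m`-th powers: `K = k ^ m` with a local coordinate `k = (z - v) r`, and `N (ζ ^
m) = n ζ ^ m` with `n = ζ q (ζ ^ m)`. So `g` is the local inverse of `k` after `n`. -/
theorem exists_local_uniformizer {K H N M : ℂ → ℂ} {v : ℂ} {m : ℕ} (hm : m ≠ 0)
    (hH : AnalyticAt ℂ H v) (hH0 : H v ≠ 0) (hK : ∀ᶠ z in 𝓝 v, K z = (z - v) ^ m * H z)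
    (hM : AnalyticAt ℂ M 0) (hM0 : M 0 ≠ 0) (hN : ∀ ζ, N ζ = ζ * M ζ) :
    ∃ g : ℂ → ℂ, AnalyticAt ℂ g 0 ∧ g 0 = v ∧ deriv g 0 ≠ 0 ∧
      ∀ᶠ ζ in 𝓝 0, K (g ζ) = N (ζ ^ m) := by
  obtain ⟨r, hr, hr0, hrm⟩ := hH.exists_root hH0 hm
  obtain ⟨q, hq, hq0, hqm⟩ := hM.exists_root hM0 hm
  have hpow : Tendsto (fun ζ : ℂ => ζ ^ m) (𝓝 0) (𝓝 0) := by
    have : ContinuousAt (fun ζ : ℂ => ζ ^ m) 0 := by fun_prop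
    simpa [ContinuousAt, zero_pow hm] using this
  set k : ℂ → ℂ := fun z => (z - v) * r z with hk
  set n : ℂ → ℂ := fun ζ => ζ * q (ζ ^ m) with hn
  have hka : AnalyticAt ℂ k v := (analyticAt_id.sub analyticAt_const).mul hr
  have hqa : AnalyticAt ℂ (fun ζ => q (ζ ^ m)) 0 :=
    AnalyticAt.fun_comp (by simpa [zero_pow hm] using hq) (analyticAt_id.pow m)
  have hna : AnalyticAt ℂ n 0 := analyticAt_id.mul hqa
  have hkv : k v = 0 := by simp [hk]
  have hn0 : n 0 = 0 := by simp [hn]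
  have hkd : deriv k v ≠ 0 := by
    have h1 : HasDerivAt k (1 * r v + (v - v) * deriv r v) v :=
      ((hasDerivAt_id v).sub_const v).mul hr.differentiableAt.hasDerivAt
    rw [h1.deriv]; simpa using hr0
  have hnd : HasDerivAt n (q 0) 0 := by
    have h1 := (hasDerivAt_id (0 : ℂ)).mul hqa.differentiableAt.hasDerivAt
    refine h1.congr_deriv ?_
    simp [zero_pow hm]
  set j := hka.hasStrictDerivAt.localInverse _ _ _ hkd with hj
  have hja : AnalyticAt ℂ j 0 := hkv ▸ hka.analyticAt_localInverse hkd
  have hj0 : j 0 = v := by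
    have : j (k v) = v := HasStrictFDerivAt.localInverse_apply_image ..
    rwa [hkv] at this
  have hjr : ∀ᶠ y in 𝓝 0, k (j y) = y :=
    hkv ▸ hka.hasStrictDerivAt.eventually_right_inverse hkd
  have hjd : HasDerivAt j (deriv k v)⁻¹ 0 :=
    hkv ▸ (hka.hasStrictDerivAt.to_localInverse hkd).hasDerivAt
  have hnt : Tendsto n (𝓝 0) (𝓝 0) := by
    simpa [ContinuousAt, hn0] using hna.continuousAt
  have hjt : Tendsto (fun ζ => j (n ζ)) (𝓝 0) (𝓝 v) := by
    have h1 : Tendsto j (𝓝 0) (𝓝 v) := by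
      simpa [ContinuousAt, hj0] using hja.continuousAt
    exact h1.comp hnt
  refine ⟨fun ζ => j (n ζ), AnalyticAt.fun_comp (by rwa [hn0]) hna, by simp only [hn0, hj0], ?_, ?_⟩
  · have h1 : HasDerivAt j (deriv k v)⁻¹ (n 0) := by rwa [hn0]
    have := h1.comp 0 hnd
    have h2 := this.deriv
    simp only [Function.comp_def] at h2
    rw [h2]
    exact mul_ne_zero (inv_ne_zero hkd) hq0
  · filter_upwards [hnt.eventually hjr, hjt.eventually hrm, hjt.eventually hK, hpow.eventually hqm]
      with ζ h1 h2 h3 h4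
    rw [h3, ← h2, ← mul_pow]
    change k (j (n ζ)) ^ m = _
    rw [h1, hn]
    simp only
    rw [mul_pow, h4, hN]

/-! ### Lifts to the left half-plane -/

/-- The left half-plane, the universal cover of the punctured unit disk by `exp`. -/
def leftHalfPlane : Set ℂ := {s | s.re < 0}

/-- The filter of complex numbers whose real part tends to `-∞`. -/
def reAtBot : Filter ℂ := comap Complex.re atBot

theorem isOpen_leftHalfPlane : IsOpen leftHalfPlane :=
  isOpen_lt Complex.continuous_re continuous_const

theorem convex_re_lt (c : ℝ) : Convex ℝ {s : ℂ | s.re < c} := convex_halfSpace_re_lt c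

instance neBot_reAtBot : NeBot reAtBot := by
  refine comap_neBot fun t ht => ?_
  obtain ⟨x, hx⟩ := (atBot_neBot (α := ℝ)).nonempty_of_mem ht
  exact ⟨x, by simpa using hx⟩

theorem eventually_reAtBot_lt (c : ℝ) : ∀ᶠ s in reAtBot, s.re < c :=
  tendsto_comap.eventually (eventually_lt_atBot c)

theorem tendsto_add_reAtBot {c : ℂ} : Tendsto (fun s => s + c) reAtBot reAtBot := by
  rw [reAtBot, tendsto_comap_iff]
  have : Complex.re ∘ (fun s => s + c) = fun s => s.re + c.re := by ext; simp
  rw [this]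
  exact tendsto_atBot_add_const_right _ _ tendsto_comap

theorem re_div_natCast (s : ℂ) (m : ℕ) : (s / m).re = s.re / m := by
  rw [← Complex.ofReal_natCast, Complex.div_ofReal_re]

theorem tendsto_exp_reAtBot {m : ℕ} (hm : m ≠ 0) :
    Tendsto (fun s : ℂ => Complex.exp (s / m)) reAtBot (𝓝[≠] 0) := by
  refine tendsto_nhdsWithin_iff.2 ⟨?_, Eventually.of_forall fun s => Complex.exp_ne_zero _⟩
  rw [tendsto_zero_iff_norm_tendsto_zero]
  simp only [Complex.norm_exp, re_div_natCast]
  refine Real.tendsto_exp_atBot.comp ?_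
  exact (tendsto_comap (f := Complex.re)).atBot_div_const (by positivity)

/-- The period of `exp`. -/
def period : ℂ := 2 * Real.pi * Complex.I

@[simp] theorem period_re : period.re = 0 := by simp [period]

@[simp] theorem period_im : period.im = 2 * Real.pi := by simp [period]

theorem period_ne_zero : period ≠ 0 := Complex.two_pi_I_ne_zero

@[simp] theorem exp_add_int_mul_period (s : ℂ) (n : ℤ) :
    Complex.exp (s + n * period) = Complex.exp s := by
  rw [Complex.exp_eq_exp_iff_exists_int]; exact ⟨n, rfl⟩

/-- A lift of `h ∘ exp` along the Belyi function which tends to `v`, as the real part of the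
argument tends to `-∞`, like an `m`-th root. -/
structure HalfPlaneLift (v : OnePoint ℂ) (m : ℕ) (h : ℂ → ℂ) where
  toFun : ℂ → ℂ
  continuousOn : ContinuousOn toFun leftHalfPlane
  belyi_apply : ∀ s ∈ leftHalfPlane, belyi (toFun s) = h (Complex.exp s)
  coeff : ℂ
  coeff_ne_zero : coeff ≠ 0
  asymp : Tendsto (fun s => localCoord v (toFun s) / Complex.exp (s / m)) reAtBot (𝓝 coeff)
  periodic : ∀ s ∈ leftHalfPlane, toFun (s + m * period) = toFun s

instance (v : OnePoint ℂ) (m : ℕ) (h : ℂ → ℂ) : CoeFun (HalfPlaneLift v m h) fun _ => ℂ → ℂ :=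
  ⟨HalfPlaneLift.toFun⟩

/-- A function on the punctured disk whose values are regular. -/
def RegularOnDisk (h : ℂ → ℂ) : Prop :=
  ∀ ζ, ζ ≠ 0 → ‖ζ‖ < 1 → h ζ ∈ regularValues

theorem norm_exp_lt_one {s : ℂ} (hs : s ∈ leftHalfPlane) : ‖Complex.exp s‖ < 1 := by
  rw [Complex.norm_exp]; exact Real.exp_lt_one_iff.2 hs

theorem add_mem_leftHalfPlane {s : ℂ} (hs : s ∈ leftHalfPlane) (n : ℂ) (hn : n.re = 0) :
    s + n ∈ leftHalfPlane := by
  simpa [leftHalfPlane, hn] using hs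

theorem int_mul_period_re (n : ℤ) : ((n : ℂ) * period).re = 0 := by
  simp [period]

theorem nat_mul_period_re (n : ℕ) : ((n : ℂ) * period).re = 0 := by
  simp [period]

theorem int_periodic_of_periodic {L : ℂ → ℂ} {m : ℕ}
    (hper : ∀ s ∈ leftHalfPlane, L (s + m * period) = L s) (n : ℤ) :
    ∀ s ∈ leftHalfPlane, L (s + n * (m * period)) = L s := by
  induction n using Int.induction_on with
  | zero => intro s hs; simp
  | succ i ih =>
    intro s hs
    have h1 : s + (i : ℤ) * (m * period) ∈ leftHalfPlane :=
      add_mem_leftHalfPlane hs _ (by simp)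
    have h2 := hper _ h1
    rw [← ih s hs, ← h2]
    push_cast; congr 1; ring
  | pred i ih =>
    intro s hs
    have h1 : s + ((-i - 1 : ℤ)) * (m * period) ∈ leftHalfPlane :=
      add_mem_leftHalfPlane hs _ (by simp)
    have h2 := hper _ h1
    rw [← ih s hs, ← h2]
    push_cast; congr 1; ring

/-- A germ of a solution `g` of `β (g ζ) = h (ζ ^ m)` extends to the unit disk. -/
theorem exists_disk_lift {v : ℂ} {m : ℕ} (hm : m ≠ 0) {h : ℂ → ℂ}
    (hd : ∀ ζ, ζ ≠ 0 → ‖ζ‖ < 1 → DifferentiableAt ℂ h ζ) (hreg : RegularOnDisk h)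
    {g : ℂ → ℂ} (hg : AnalyticAt ℂ g 0) (hg0 : g 0 = v) (hg' : deriv g 0 ≠ 0)
    (hgh : ∀ᶠ ζ in 𝓝[≠] 0, belyi (g ζ) = h (ζ ^ m)) :
    ∃ (L : HalfPlaneLift v m h) (Φ : ℂ → ℂ), DifferentiableOn ℂ Φ (Metric.ball 0 1) ∧ Φ 0 = v ∧
      ∀ s ∈ leftHalfPlane, Φ (Complex.exp (s / m)) = L s := by
  have hm' : (m : ℂ) ≠ 0 := Nat.cast_ne_zero.2 hm
  have hmpos : (0 : ℝ) < m := by positivity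
  obtain ⟨ε, hε, hε1, hεg⟩ : ∃ ε > 0, ε < 1 ∧ ∀ ζ, ‖ζ‖ < ε →
      AnalyticAt ℂ g ζ ∧ (ζ ≠ 0 → belyi (g ζ) = h (ζ ^ m)) := by
    have h1 := hg.eventually_analyticAt.and (eventually_nhdsWithin_iff.1 hgh)
    obtain ⟨ε, hε, h2⟩ := Metric.eventually_nhds_iff.1 h1
    refine ⟨min ε (1 / 2), by positivity, (min_le_right _ _).trans_lt (by norm_num),
      fun ζ hζ => h2 ?_⟩
    rw [dist_zero_right]
    exact hζ.trans_le (min_le_left _ _)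
  have hpowexp : ∀ s : ℂ, Complex.exp (s / m) ^ m = Complex.exp s := fun s => by
    rw [← Complex.exp_nat_mul, mul_div_cancel₀ _ hm']
  -- For `re s < c` the point `exp (s / m)` lies in the disk of radius `ε` on which the germ `g`
  -- solves the equation.
  set c : ℝ := m * Real.log ε with hc
  have hc0 : c < 0 := mul_neg_of_pos_of_neg hmpos (Real.log_neg hε hε1)
  have hsub : {s : ℂ | s.re < c} ⊆ leftHalfPlane := fun s hs => lt_trans hs hc0
  have hsmall : ∀ s : ℂ, s.re < c → ‖Complex.exp (s / m)‖ < ε := by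
    intro s hs
    rw [Complex.norm_exp, re_div_natCast, ← Real.lt_log_iff_exp_lt hε, div_lt_iff₀ hmpos, mul_comm]
    exact hs
  set s₀ : ℂ := ((c - 1 : ℝ) : ℂ) with hs₀
  have hs₀c : s₀.re < c := by simp [hs₀]
  have hhe : ∀ s ∈ leftHalfPlane, DifferentiableAt ℂ (fun s => h (Complex.exp s)) s := by
    intro s hs
    exact DifferentiableAt.comp (f := Complex.exp) s
      (hd _ (Complex.exp_ne_zero _) (norm_exp_lt_one hs)) Complex.differentiable_exp.differentiableAt
  have hreg' : ∀ s ∈ leftHalfPlane, h (Complex.exp s) ∈ regularValues := fun s hs =>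
    hreg _ (Complex.exp_ne_zero _) (norm_exp_lt_one hs)
  obtain ⟨L, hLc, hLb, hL0⟩ := exists_belyi_lift isOpen_leftHalfPlane
    ((convex_re_lt 0).starConvex (hsub hs₀c)) (hsub hs₀c)
    (fun s hs => (hhe s hs).continuousAt.continuousWithinAt) hreg' (hsub hs₀c)
    (z := g (Complex.exp (s₀ / m)))
    (by rw [(hεg _ (hsmall _ hs₀c)).2 (Complex.exp_ne_zero _), hpowexp])
  have hLg : Set.EqOn L (fun s => g (Complex.exp (s / m))) {s | s.re < c} := by
    refine belyi_lift_unique (convex_re_lt c).isPreconnected (hLc.mono hsub) ?_ ?_ ?_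
      hs₀c hL0
    · intro s hs
      refine ContinuousAt.continuousWithinAt ?_
      exact ContinuousAt.comp (f := fun s : ℂ => Complex.exp (s / m))
        (hεg _ (hsmall s hs)).1.continuousAt (by fun_prop)
    · intro s hs
      rw [hLb s (hsub hs)]
      exact hreg' s (hsub hs)
    · intro s hs
      rw [hLb s (hsub hs), (hεg _ (hsmall s hs)).2 (Complex.exp_ne_zero _), hpowexp]
  have hshift : ∀ s ∈ leftHalfPlane, s + m * period ∈ leftHalfPlane := fun s hs =>
    add_mem_leftHalfPlane hs _ (nat_mul_period_re m)
  -- Far to the left `L s` is `g (exp (s / m))`, which has this period; uniqueness of lifts extends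
  -- the periodicity to the whole half-plane.
  have hper : ∀ s ∈ leftHalfPlane, L (s + m * period) = L s := by
    refine belyi_lift_unique (U := leftHalfPlane) (a := s₀) (convex_re_lt 0).isPreconnected
      (hLc.comp (by fun_prop) hshift) hLc ?_ ?_ (hsub hs₀c) ?_
    · intro s hs
      rw [hLb _ (hshift s hs)]
      exact hreg' _ (hshift s hs)
    · intro s hs
      rw [hLb _ (hshift s hs), hLb _ hs]
      have := exp_add_int_mul_period s m
      push_cast at this
      rw [this]
    · have h1 : (s₀ + m * period).re < c := by simpa using hs₀c
      rw [hLg h1, hLg hs₀c]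
      simp only
      rw [add_div, mul_div_cancel_left₀ _ hm', period, Complex.exp_periodic]
  have hperInt := int_periodic_of_periodic hper
  have hLd : ∀ s ∈ leftHalfPlane, DifferentiableAt ℂ L s := fun s hs =>
    differentiableAt_belyi_lift (hLc.continuousAt (isOpen_leftHalfPlane.mem_nhds hs)) (hhe s hs)
      (hreg' s hs) (by filter_upwards [isOpen_leftHalfPlane.mem_nhds hs] with t ht using hLb t ht)
  classical
  -- By the periodicity of `L` the choice of branch of the logarithm does not matter.
  set Φ : ℂ → ℂ := fun ζ => if ζ = 0 then v else L (m * Complex.log ζ) with hΦ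
  have hΦL : ∀ s ∈ leftHalfPlane, Φ (Complex.exp (s / m)) = L s := by
    intro s hs
    simp only [hΦ, Complex.exp_ne_zero, if_false]
    obtain ⟨n, hn⟩ := Complex.exp_eq_exp_iff_exists_int.1
      (Complex.exp_log (Complex.exp_ne_zero (s / m)))
    rw [hn, ← hperInt n s hs]
    congr 1
    rw [period]
    field_simp
  have hlogmem : ∀ ζ : ℂ, ζ ≠ 0 → ‖ζ‖ < 1 → m * Complex.log ζ ∈ leftHalfPlane := by
    intro ζ h0 h1
    simp only [leftHalfPlane, Set.mem_ofPred_eq, Complex.mul_re, Complex.natCast_re,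
      Complex.natCast_im, zero_mul, sub_zero, Complex.log_re]
    exact mul_neg_of_pos_of_neg hmpos (Real.log_neg (norm_pos_iff.2 h0) h1)
  have hΦg : ∀ ζ, ‖ζ‖ < ε → Φ ζ = g ζ := by
    intro ζ hζ
    by_cases h0 : ζ = 0
    · simp [hΦ, h0, hg0]
    · simp only [hΦ, h0, if_false]
      rw [hLg]
      · simp only
        rw [mul_div_cancel_left₀ _ hm', Complex.exp_log h0]
      · simp only [Set.mem_ofPred_eq, Complex.mul_re, Complex.natCast_re,
          Complex.natCast_im, zero_mul, sub_zero, Complex.log_re, hc]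
        exact mul_lt_mul_of_pos_left (Real.log_lt_log (norm_pos_iff.2 h0) hζ) hmpos
  refine ⟨⟨L, hLc, hLb, deriv g 0, hg', ?_, hper⟩, Φ, ?_, by simp [hΦ], hΦL⟩
  · have h1 := hg.differentiableAt.hasDerivAt.tendsto_slope.comp (tendsto_exp_reAtBot hm)
    refine h1.congr' ?_
    filter_upwards [eventually_reAtBot_lt c] with s hs
    simp only [Function.comp_apply, slope_def_field, sub_zero, hg0]
    change _ = (L s - v) / _
    rw [hLg hs]
  · intro ζ hζ
    rw [mem_ball_zero_iff] at hζ
    refine DifferentiableAt.differentiableWithinAt ?_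
    by_cases h0 : ζ = 0
    · have : Φ =ᶠ[𝓝 ζ] g := by
        filter_upwards [Metric.ball_mem_nhds ζ hε] with y hy
        exact hΦg y (by simpa [h0] using hy)
      rw [h0] at this ⊢
      exact hg.differentiableAt.congr_of_eventuallyEq this
    · have hmem := hlogmem ζ h0 hζ
      -- The principal logarithm may jump at `ζ`. Near `ζ` it is replaced by the branch `log ζ + log
      -- (y / ζ)`, which is holomorphic there.
      have hdl : DifferentiableAt ℂ (fun y => m * Complex.log ζ + m * Complex.log (y / ζ)) ζ := by
        refine (differentiableAt_const _).add ((differentiableAt_const _).mul ?_)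
        refine DifferentiableAt.clog (by fun_prop) (by simp [h0])
      have hz : m * Complex.log ζ + m * Complex.log (ζ / ζ) = m * Complex.log ζ := by simp [h0]
      have hcomp : DifferentiableAt ℂ
          (fun y => L (m * Complex.log ζ + m * Complex.log (y / ζ))) ζ := by
        refine DifferentiableAt.comp (g := L) ζ ?_ hdl
        rw [hz]
        exact hLd _ hmem
      refine hcomp.congr_of_eventuallyEq ?_
      have hev : ∀ᶠ y in 𝓝 ζ, m * Complex.log ζ + m * Complex.log (y / ζ) ∈ leftHalfPlane := by
        refine hdl.continuousAt.eventually (p := fun x => x ∈ leftHalfPlane) ?_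
        simp only [hz]
        exact isOpen_leftHalfPlane.mem_nhds hmem
      filter_upwards [hev, eventually_ne_nhds h0] with y hy hy0
      rw [← hΦL _ hy, ← mul_add, mul_div_cancel_left₀ _ hm', Complex.exp_add, Complex.exp_log h0,
        Complex.exp_log (div_ne_zero hy0 h0), mul_div_cancel₀ _ h0]

/-- Injectivity on the punctured unit disk. -/
def InjectiveOnDisk (h : ℂ → ℂ) : Prop :=
  ∀ ζ ξ, ζ ≠ 0 → ‖ζ‖ < 1 → ξ ≠ 0 → ‖ξ‖ < 1 → h ζ = h ξ → ζ = ξ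

theorem exp_natMul_period_div {m : ℕ} (hm : m ≠ 0) (k : ℤ)
    (h : Complex.exp (k * period / m) = 1) : ∃ n : ℤ, k = n * m := by
  obtain ⟨n, hn⟩ := Complex.exp_eq_one_iff.1 h
  refine ⟨n, ?_⟩
  have hm' : (m : ℂ) ≠ 0 := Nat.cast_ne_zero.2 hm
  rw [div_eq_iff hm'] at hn
  have : (k : ℂ) = n * m := by
    have h0 := period_ne_zero
    change _ = (n : ℂ) * period * m at hn
    apply mul_right_cancel₀ h0
    linear_combination hn
  exact_mod_cast this

/-! ### Comparing lifts and counting their values. -/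

namespace HalfPlaneLift

variable {v v' : OnePoint ℂ} {m m' : ℕ} {h : ℂ → ℂ}

theorem belyi_mem (L : HalfPlaneLift v m h) (hreg : RegularOnDisk h) {s : ℂ}
    (hs : s ∈ leftHalfPlane) : belyi (L s) ∈ regularValues := by
  rw [L.belyi_apply s hs]
  exact hreg _ (Complex.exp_ne_zero _) (norm_exp_lt_one hs)

theorem tendsto_localCoord (L : HalfPlaneLift v m h) (hm : m ≠ 0) :
    Tendsto (fun s => localCoord v (L s)) reAtBot (𝓝 0) := by
  have := L.asymp.mul (tendsto_nhdsWithin_iff.1 (tendsto_exp_reAtBot hm)).1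
  rw [mul_zero] at this
  refine this.congr fun s => ?_
  rw [div_mul_cancel₀ _ (Complex.exp_ne_zero _)]

theorem eventually_localCoord_ne_zero (L : HalfPlaneLift v m h) :
    ∀ᶠ s in reAtBot, localCoord v (L s) ≠ 0 := by
  filter_upwards [L.asymp.eventually_ne L.coeff_ne_zero] with s hs h0
  rw [h0, zero_div] at hs
  exact hs rfl

theorem tendsto (L : HalfPlaneLift v m h) (hm : m ≠ 0) :
    Tendsto (fun s => (L s : OnePoint ℂ)) reAtBot (𝓝 v) := by
  have h1 := L.tendsto_localCoord hm
  have h2 := L.eventually_localCoord_ne_zero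
  induction v using OnePoint.rec with
  | infty =>
    have h3 : Tendsto (fun s => (L s)⁻¹) reAtBot (𝓝[≠] 0) := tendsto_nhdsWithin_iff.2 ⟨h1, h2⟩
    have h4 := tendsto_inv₀_nhdsNE_zero.comp h3
    rw [Metric.cobounded_eq_cocompact, ← coclosedCompact_eq_cocompact] at h4
    refine (OnePoint.tendsto_coe_infty.comp h4).congr fun s => ?_
    simp
  | coe z =>
    have h3 : Tendsto (fun s => L s - z) reAtBot (𝓝 0) := h1
    refine (OnePoint.continuous_coe.tendsto _).comp ?_
    simpa using h3.add_const z

theorem periodic_int (L : HalfPlaneLift v m h) (n : ℤ) {s : ℂ} (hs : s ∈ leftHalfPlane) :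
    L (s + n * (m * period)) = L s :=
  int_periodic_of_periodic L.periodic n s hs

/-- Two lifts of the same function with a common value differ by a shift. -/
theorem exists_shift (L : HalfPlaneLift v m h) (L' : HalfPlaneLift v' m' h)
    (hreg : RegularOnDisk h) (hinj : InjectiveOnDisk h) {s s' : ℂ} (hs : s ∈ leftHalfPlane)
    (hs' : s' ∈ leftHalfPlane) (heq : L s = L' s') :
    ∃ k : ℤ, s' = s + k * period ∧ ∀ t ∈ leftHalfPlane, L t = L' (t + k * period) := by
  have h1 : Complex.exp s' = Complex.exp s := by
    refine (hinj _ _ (Complex.exp_ne_zero _) (norm_exp_lt_one hs) (Complex.exp_ne_zero _)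
      (norm_exp_lt_one hs') ?_).symm
    rw [← L.belyi_apply s hs, ← L'.belyi_apply s' hs', heq]
  obtain ⟨k, hk⟩ := Complex.exp_eq_exp_iff_exists_int.1 h1
  have hsh : ∀ t ∈ leftHalfPlane, t + k * period ∈ leftHalfPlane := fun t ht =>
    add_mem_leftHalfPlane ht _ (int_mul_period_re k)
  refine ⟨k, hk, ?_⟩
  refine belyi_lift_unique (U := leftHalfPlane) (a := s) (convex_re_lt 0).isPreconnected
    L.continuousOn (L'.continuousOn.comp (by fun_prop) hsh) (fun t ht => L.belyi_mem hreg ht) ?_ hs ?_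
  · intro t ht
    rw [L.belyi_apply t ht, L'.belyi_apply _ (hsh t ht), exp_add_int_mul_period]
  · rw [heq, hk]; rfl

/-- One common value makes the two lifts agree up to a shift by periods, and a shift does not change
the limit as the real part tends to `-∞`. -/
theorem vertex_eq (L : HalfPlaneLift v m h) (L' : HalfPlaneLift v' m' h) (hm : m ≠ 0)
    (hm' : m' ≠ 0)
    (hreg : RegularOnDisk h) (hinj : InjectiveOnDisk h) {s s' : ℂ} (hs : s ∈ leftHalfPlane)
    (hs' : s' ∈ leftHalfPlane) (heq : L s = L' s') : v = v' := by
  obtain ⟨k, -, hk⟩ := L.exists_shift L' hreg hinj hs hs' heq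
  refine tendsto_nhds_unique_of_eventuallyEq (L.tendsto hm)
    ((L'.tendsto hm').comp (tendsto_add_reAtBot (c := k * period))) ?_
  filter_upwards [eventually_reAtBot_lt 0] with t ht
  simp [hk t ht]

/-- A shift by `k` periods multiplies `exp (s / m)` by `exp (2πik / m)`. This is the source of the
counterclockwise order in the drawing. -/
theorem tendsto_localCoord_div (L : HalfPlaneLift v m h) (k : ℤ) :
    Tendsto (fun s => localCoord v (L (s + k * period)) / localCoord v (L s)) reAtBot
      (𝓝 (Complex.exp (k * period / m))) := by
  have h1 := L.asymp.comp (tendsto_add_reAtBot (c := k * period))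
  have h2 := (h1.div L.asymp L.coeff_ne_zero).mul_const (Complex.exp (k * period / m))
  rw [div_self L.coeff_ne_zero, one_mul] at h2
  refine h2.congr fun s => ?_
  simp only [Pi.div_apply, Function.comp_apply, add_div, Complex.exp_add]
  have := Complex.exp_ne_zero (s / m)
  have := Complex.exp_ne_zero (k * period / m)
  field_simp

/-- If `L` coincides with its shift by `k` periods, the quotient of local coordinates tends both to
1 and to `exp (2πik / m)`, so `m` divides `k`. -/
theorem apply_eq_iff (L : HalfPlaneLift v m h) (hm : m ≠ 0)
    (hreg : RegularOnDisk h) (hinj : InjectiveOnDisk h) {s s' : ℂ} (hs : s ∈ leftHalfPlane)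
    (hs' : s' ∈ leftHalfPlane) : L s = L s' ↔ ∃ n : ℤ, s' = s + n * (m * period) := by
  constructor
  · intro heq
    obtain ⟨k, hk1, hk⟩ := L.exists_shift L hreg hinj hs hs' heq
    have h1 := L.tendsto_localCoord_div k
    have h2 : Tendsto (fun s => localCoord v (L (s + k * period)) / localCoord v (L s)) reAtBot
        (𝓝 1) := by
      refine tendsto_const_nhds.congr' ?_
      filter_upwards [eventually_reAtBot_lt 0, L.eventually_localCoord_ne_zero] with t ht ht'
      rw [← hk t ht, div_self ht']
    obtain ⟨n, hn⟩ := exp_natMul_period_div hm k (tendsto_nhds_unique h1 h2)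
    refine ⟨n, ?_⟩
    rw [hk1, hn]; push_cast; ring
  · rintro ⟨n, rfl⟩
    exact (L.periodic_int n hs).symm

/-- Shifting a lift by a multiple of the period. -/
def shift (L : HalfPlaneLift v m h) (k : ℤ) : HalfPlaneLift v m h where
  toFun s := L (s + k * period)
  continuousOn := L.continuousOn.comp (by fun_prop) fun t ht =>
    add_mem_leftHalfPlane ht _ (int_mul_period_re k)
  belyi_apply s hs := by
    rw [L.belyi_apply _ (add_mem_leftHalfPlane hs _ (int_mul_period_re k)), exp_add_int_mul_period]
  coeff := L.coeff * Complex.exp (k * period / m)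
  coeff_ne_zero := mul_ne_zero L.coeff_ne_zero (Complex.exp_ne_zero _)
  asymp := by
    have h1 := (L.asymp.comp (tendsto_add_reAtBot (c := k * period))).mul_const
      (Complex.exp (k * period / m))
    refine h1.congr fun s => ?_
    simp only [Function.comp_apply, add_div, Complex.exp_add]
    have := Complex.exp_ne_zero (s / m)
    have := Complex.exp_ne_zero (k * period / m)
    field_simp
  periodic s hs := by
    rw [← L.periodic _ (add_mem_leftHalfPlane hs _ (int_mul_period_re k))]
    congr 1; ring

theorem shift_apply (L : HalfPlaneLift v m h) (k : ℤ) (s : ℂ) :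
    L.shift k s = L (s + k * period) := rfl

theorem apply_natCast_eq (L : HalfPlaneLift v m h) (hm : m ≠ 0)
    (hreg : RegularOnDisk h) (hinj : InjectiveOnDisk h) {s : ℂ} (hs : s ∈ leftHalfPlane) {j k : ℕ}
    (hj : j < m) (hk : k < m) (heq : L (s + j * period) = L (s + k * period)) : j = k := by
  obtain ⟨n, hn⟩ := (L.apply_eq_iff hm hreg hinj
    (add_mem_leftHalfPlane hs _ (nat_mul_period_re j))
    (add_mem_leftHalfPlane hs _ (nat_mul_period_re k))).1 heq
  have h1 : (k : ℂ) = j + n * m := by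
    apply mul_right_cancel₀ period_ne_zero
    linear_combination hn
  have h2 : (k : ℤ) = j + n * m := by exact_mod_cast h1
  have h3 : (k : ℤ) % m = j % m := by rw [h2, Int.add_mul_emod_self_right]
  rw [Int.emod_eq_of_lt (by positivity) (by exact_mod_cast hk),
    Int.emod_eq_of_lt (by positivity) (by exact_mod_cast hj)] at h3
  exact_mod_cast h3.symm

/-- If the multiplicities add up to the degree, the lifts exhaust the fibres. -/
theorem exists_apply_eq {ι : Type} [Fintype ι] {v : ι → OnePoint ℂ} (hv : Function.Injective v)
    {m : ι → ℕ} (L : ∀ i, HalfPlaneLift (v i) (m i) h) (hm0 : ∀ i, m i ≠ 0) (hm : ∑ i, m i = 6)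
    (hreg : RegularOnDisk h) (hinj : InjectiveOnDisk h) {s : ℂ} (hs : s ∈ leftHalfPlane) {x : ℂ}
    (hx : belyi x = h (Complex.exp s)) : ∃ i, ∃ k < m i, x = L i (s + k * period) := by
  classical
  obtain ⟨t, ht6, ht⟩ := card_le_of_belyi_eq
    (hreg _ (Complex.exp_ne_zero s) (norm_exp_lt_one hs))
  have hmem : ∀ k : ℕ, s + k * period ∈ leftHalfPlane := fun k =>
    add_mem_leftHalfPlane hs _ (nat_mul_period_re k)
  -- Equal values force equal vertices, hence equal indices; at a single vertex, shifts by fewer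
  -- than `m` periods give different points. So there are 6 such points, and the fibre has no
  -- others.
  have hF : Function.Injective fun p : (i : ι) × Fin (m i) => L p.1 (s + (p.2 : ℕ) * period) := by
    rintro ⟨i, k⟩ ⟨j, k'⟩ heq
    simp only at heq
    obtain rfl : i = j := hv ((L i).vertex_eq (L j) (hm0 i) (hm0 j) hreg hinj (hmem _) (hmem _) heq)
    have := (L i).apply_natCast_eq (hm0 i) hreg hinj hs k.2 k'.2 heq
    rw [Fin.ext this]
  have hsub : (Finset.univ.image fun p : (i : ι) × Fin (m i) =>
      L p.1 (s + (p.2 : ℕ) * period)) ⊆ t := by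
    intro y hy
    obtain ⟨p, -, rfl⟩ := Finset.mem_image.1 hy
    apply ht
    rw [(L p.1).belyi_apply _ (hmem _)]
    have := exp_add_int_mul_period s (p.2 : ℕ)
    push_cast at this
    rw [this]
  have hcard : (Finset.univ.image fun p : (i : ι) × Fin (m i) =>
      L p.1 (s + (p.2 : ℕ) * period)).card = 6 := by
    rw [Finset.card_image_of_injective _ hF, Finset.card_univ, Fintype.card_sigma]
    simpa using hm
  have hx' := ht x hx
  rw [← Finset.eq_of_subset_of_card_le hsub (by rw [hcard]; exact ht6)] at hx'
  obtain ⟨p, -, hp⟩ := Finset.mem_image.1 hx'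
  exact ⟨p.1, p.2, p.2.2, hp.symm⟩

theorem tendsto_conj_reAtBot : Tendsto (starRingEnd ℂ) reAtBot reAtBot := by
  rw [reAtBot, tendsto_comap_iff]
  have : Complex.re ∘ (starRingEnd ℂ) = Complex.re := by ext; simp
  rw [this]
  exact tendsto_comap

theorem conj_mem_leftHalfPlane {s : ℂ} (hs : s ∈ leftHalfPlane) :
    (starRingEnd ℂ) s ∈ leftHalfPlane := by
  simpa [leftHalfPlane] using hs

theorem apply_ne_zero (L : HalfPlaneLift v m h) (hreg : RegularOnDisk h) {s : ℂ}
    (hs : s ∈ leftHalfPlane) : L s ≠ 0 := fun h0 =>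
  (L.belyi_mem hreg hs).2 (h0 ▸ belyi_eq_one.2 (.inl rfl))

theorem continuousOn_reflect (L : HalfPlaneLift v m h) (hreg : RegularOnDisk h) :
    ContinuousOn (fun s => circleReflection (L ((starRingEnd ℂ) s))) leftHalfPlane := by
  unfold circleReflection
  refine ContinuousOn.inv₀ (Complex.continuous_conj.comp_continuousOn (L.continuousOn.comp
    Complex.continuous_conj.continuousOn fun s hs => conj_mem_leftHalfPlane hs)) fun s hs => ?_
  simpa using L.apply_ne_zero hreg (conj_mem_leftHalfPlane hs)

theorem belyi_reflect (L : HalfPlaneLift v m h) (hreg : RegularOnDisk h)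
    (hconj : ∀ ζ, h ((starRingEnd ℂ) ζ) = (starRingEnd ℂ) (h ζ)) {s : ℂ} (hs : s ∈ leftHalfPlane) :
    belyi (circleReflection (L ((starRingEnd ℂ) s))) = h (Complex.exp s) := by
  rw [belyi_circleReflection (L.apply_ne_zero hreg (conj_mem_leftHalfPlane hs)),
    L.belyi_apply _ (conj_mem_leftHalfPlane hs), ← hconj, ← Complex.exp_conj, Complex.conj_conj]

/-- The reflection in the unit circle of a lift at `0` is a lift at `∞`. -/
def reflect (L : HalfPlaneLift ((0 : ℂ) : OnePoint ℂ) m h) (hreg : RegularOnDisk h)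
    (hconj : ∀ ζ, h ((starRingEnd ℂ) ζ) = (starRingEnd ℂ) (h ζ)) :
    HalfPlaneLift OnePoint.infty m h where
  toFun s := circleReflection (L ((starRingEnd ℂ) s))
  continuousOn := L.continuousOn_reflect hreg
  belyi_apply s hs := L.belyi_reflect hreg hconj hs
  coeff := (starRingEnd ℂ) L.coeff
  coeff_ne_zero := by simpa using L.coeff_ne_zero
  asymp := by
    have h1 := (Complex.continuous_conj.tendsto _).comp (L.asymp.comp tendsto_conj_reAtBot)
    refine h1.congr fun s => ?_
    -- The local coordinate at `∞` is the reciprocal, so that of the reflected point is the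
    -- conjugate of the coordinate at 0.
    change (starRingEnd ℂ) ((L ((starRingEnd ℂ) s) - 0) / _) = (circleReflection _)⁻¹ / _
    rw [map_div₀, sub_zero, circleReflection, inv_inv, ← Complex.exp_conj]
    simp
  periodic s hs := by
    have : (starRingEnd ℂ) (s + m * period) = (starRingEnd ℂ) s + (-1 : ℤ) * (m * period) := by
      have hp : (starRingEnd ℂ) period = -period := by
        simp [period, Complex.conj_ofNat]
      rw [map_add, map_mul, hp, Complex.conj_natCast]
      push_cast; ring
    rw [this, L.periodic_int _ (conj_mem_leftHalfPlane hs)]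

end HalfPlaneLift

/-! ### The three model functions -/

/-- The disk around `0` in the target. -/
def blackModel (ζ : ℂ) : ℂ := ζ

/-- The disk around `1` in the target. -/
def whiteModel (ζ : ℂ) : ℂ := 1 - ζ

/-- A conformal map from the unit disk to the complement of `[0, 1]`, with `0 ↦ ∞`. -/
def poleModel (ζ : ℂ) : ℂ := (1 + ζ) ^ 2 / (4 * ζ)

theorem one_add_ne_zero_of_norm_lt {ζ : ℂ} (h : ‖ζ‖ < 1) : 1 + ζ ≠ 0 := by
  intro h0
  rw [← neg_eq_iff_add_eq_zero.2 h0] at h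
  simp at h

theorem regular_blackModel : RegularOnDisk blackModel := by
  intro ζ h0 h1
  refine ⟨h0, ?_⟩
  rintro rfl
  simp at h1

theorem injective_blackModel : InjectiveOnDisk blackModel := fun _ _ _ _ _ _ h => h

theorem regular_whiteModel : RegularOnDisk whiteModel := by
  intro ζ h0 h1
  refine ⟨fun h => ?_, fun h => h0 (by simpa [whiteModel] using h)⟩
  rw [whiteModel, sub_eq_zero] at h
  rw [← h] at h1
  simp at h1

theorem injective_whiteModel : InjectiveOnDisk whiteModel := fun _ _ _ _ _ _ h => by
  simpa [whiteModel] using h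

theorem regular_poleModel : RegularOnDisk poleModel := by
  intro ζ h0 h1
  have h2 := one_add_ne_zero_of_norm_lt h1
  have h4 : (4 * ζ) ≠ 0 := by simp [h0]
  refine ⟨div_ne_zero (pow_ne_zero _ h2) h4, fun h => ?_⟩
  rw [poleModel, div_eq_one_iff_eq h4] at h
  have h3 : (ζ - 1) ^ 2 = 0 := by linear_combination h
  rw [sub_eq_zero.1 (pow_eq_zero_iff two_ne_zero |>.1 h3)] at h1
  simp at h1

/-- Two points have the same value only if they are equal or inverse to each other, and the inverse
of a point of the disk lies outside. -/
theorem injective_poleModel : InjectiveOnDisk poleModel := by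
  intro ζ ξ h0 h1 h2 h3 h
  rw [poleModel, poleModel, div_eq_div_iff (by simp [h0]) (by simp [h2])] at h
  have h4 : (ζ - ξ) * (1 - ζ * ξ) = 0 := by linear_combination -h / 4
  rcases mul_eq_zero.1 h4 with h5 | h5
  · exact sub_eq_zero.1 h5
  · exfalso
    have h6 : ‖ζ * ξ‖ = 1 := by rw [← sub_eq_zero.1 h5]; simp
    rw [norm_mul] at h6
    have := mul_lt_one_of_nonneg_of_lt_one_left (norm_nonneg ζ) h1 h3.le
    linarith

theorem differentiableAt_poleModel {ζ : ℂ} (h : ζ ≠ 0) : DifferentiableAt ℂ poleModel ζ := by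
  unfold poleModel
  exact DifferentiableAt.div (by fun_prop) (by fun_prop) (by simp [h])

/-- With `w = poleModel ζ`, the number `2 w - 1` is the mean of `ζ` and `ζ⁻¹`. The candidates `2 w -
1 ± d` have product 1, so one of them lies in the disk unless both are on the circle. -/
theorem exists_poleModel_eq {w : ℂ} (hw : ∀ t : ℝ, 0 ≤ t → t ≤ 1 → w ≠ t) :
    ∃ ζ, ζ ≠ 0 ∧ ‖ζ‖ < 1 ∧ poleModel ζ = w := by
  obtain ⟨d, hd⟩ : ∃ d : ℂ, d ^ 2 = (2 * w - 1) ^ 2 - 1 :=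
    IsAlgClosed.exists_pow_nat_eq _ two_pos
  have key : ∀ e : ℂ, e ^ 2 = (2 * w - 1) ^ 2 - 1 → ‖2 * w - 1 + e‖ < 1 →
      ∃ ζ, ζ ≠ 0 ∧ ‖ζ‖ < 1 ∧ poleModel ζ = w := by
    intro e he h1
    have h0 : 2 * w - 1 + e ≠ 0 := by
      intro h0
      have : e = -(2 * w - 1) := by linear_combination h0
      rw [this] at he
      have : (1 : ℂ) = 0 := by linear_combination he
      exact one_ne_zero this
    refine ⟨_, h0, h1, ?_⟩
    rw [poleModel, div_eq_iff (by simp [h0])]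
    linear_combination he
  have hprod : (2 * w - 1 + d) * (2 * w - 1 + -d) = 1 := by linear_combination -hd
  have hnorm : ‖2 * w - 1 + d‖ * ‖2 * w - 1 + -d‖ = 1 := by rw [← norm_mul, hprod, norm_one]
  rcases lt_trichotomy ‖2 * w - 1 + d‖ 1 with h | h | h
  · exact key d hd h
  -- On the circle the two candidates are conjugate, so `2 w - 1` is the real part of a number of
  -- modulus 1 and `w` lies in `[0, 1]`.
  · exfalso
    set u := 2 * w - 1 + d
    have hinv : 2 * w - 1 + -d = (starRingEnd ℂ) u := by
      have hu : (starRingEnd ℂ) u * u = 1 := by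
        rw [mul_comm, Complex.mul_conj, Complex.normSq_eq_norm_sq, h]; norm_num
      have hu0 : u ≠ 0 := fun h0 => by rw [h0] at h; simp at h
      apply mul_left_cancel₀ hu0
      rw [hprod, mul_comm, hu]
    have h4 : w = ((1 + u.re) / 2 : ℝ) := by
      have := Complex.add_conj u
      rw [← hinv] at this
      push_cast
      have h5 : u = 2 * w - 1 + d := rfl
      push_cast at this
      linear_combination (1 / 4 : ℂ) * this - (1 / 4 : ℂ) * h5
    have hre := Complex.abs_re_le_norm u
    rw [h, abs_le] at hre
    exact hw _ (by linarith) (by linarith) h4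
  · refine key (-d) (by rw [neg_sq, hd]) ?_
    by_contra! h2
    have : 1 < ‖2 * w - 1 + d‖ * ‖2 * w - 1 + -d‖ := by nlinarith
    linarith

/-- For a value `t` in `[0, 1]` and `c = 2 t - 1`, the two solutions are `c ± i √(1 - c ^ 2)`, of
modulus 1. -/
theorem poleModel_ne {ζ : ℂ} (h0 : ζ ≠ 0) (h1 : ‖ζ‖ < 1) {t : ℝ} (ht0 : 0 ≤ t) (ht1 : t ≤ 1) :
    poleModel ζ ≠ t := by
  intro h
  rw [poleModel, div_eq_iff (by simp [h0])] at h
  set c : ℝ := 2 * t - 1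
  set d : ℝ := √(1 - c ^ 2)
  have hd : d ^ 2 = 1 - c ^ 2 := Real.sq_sqrt (by simp only [c]; nlinarith)
  have hdC : (d : ℂ) ^ 2 = 1 - (c : ℂ) ^ 2 := by exact_mod_cast hd
  have hc : (c : ℂ) = 2 * t - 1 := by simp [c]
  have hfac : (ζ - (c + d * Complex.I)) * (ζ - (c - d * Complex.I)) = 0 := by
    linear_combination h - 2 * ζ * hc - (d : ℂ) ^ 2 * Complex.I_sq + hdC
  have hnorm : ∀ e : ℝ, e ^ 2 = 1 - c ^ 2 → ‖(c : ℂ) + e * Complex.I‖ = 1 := by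
    intro e he
    rw [Complex.norm_add_mul_I, he]
    simp
  rcases mul_eq_zero.1 hfac with h2 | h2
  · rw [sub_eq_zero.1 h2, hnorm d hd] at h1
    exact lt_irrefl _ h1
  · have h3 := hnorm (-d) (by rw [neg_sq, hd])
    push_cast at h3
    rw [neg_mul, ← sub_eq_add_neg] at h3
    rw [sub_eq_zero.1 h2, h3] at h1
    exact lt_irrefl _ h1

/-! ### The lifts at the vertices and at the poles -/

theorem exists_black_lift {v : ℂ} {m : ℕ} (hm : m ≠ 0) {H : ℂ → ℂ} (hH : AnalyticAt ℂ H v)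
    (hH0 : H v ≠ 0) (hK : ∀ z, belyi z = (z - v) ^ m * H z) :
    Nonempty (HalfPlaneLift v m blackModel) := by
  obtain ⟨g, hg, hg0, hg', hgh⟩ := exists_local_uniformizer (N := blackModel) (M := fun _ => 1) hm
    hH hH0 (Eventually.of_forall hK) analyticAt_const one_ne_zero fun ζ => (mul_one ζ).symm
  obtain ⟨L, -⟩ := exists_disk_lift (h := blackModel) hm (fun ζ _ _ => differentiableAt_id)
    regular_blackModel hg hg0 hg' (eventually_nhdsWithin_of_eventually_nhds hgh)
  exact ⟨L⟩

theorem exists_white_lift {v : ℂ} {m : ℕ} (hm : m ≠ 0) {H : ℂ → ℂ} (hH : AnalyticAt ℂ H v)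
    (hH0 : H v ≠ 0) (hK : ∀ᶠ z in 𝓝 v, 1 - belyi z = (z - v) ^ m * H z) :
    Nonempty (HalfPlaneLift v m whiteModel) := by
  obtain ⟨g, hg, hg0, hg', hgh⟩ := exists_local_uniformizer (N := fun ζ => ζ) (M := fun _ => 1) hm
    hH hH0 hK analyticAt_const one_ne_zero fun ζ => (mul_one ζ).symm
  obtain ⟨L, -⟩ := exists_disk_lift (h := whiteModel) hm
    (fun ζ _ _ => (differentiableAt_const _).sub differentiableAt_id)
    regular_whiteModel hg hg0 hg' (eventually_nhdsWithin_of_eventually_nhds (by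
      filter_upwards [hgh] with ζ hζ
      rw [whiteModel, ← hζ, sub_sub_cancel]))
  exact ⟨L⟩

theorem exists_pole_disk {v : ℂ} {m : ℕ} (hm : m ≠ 0) {H : ℂ → ℂ} (hH : AnalyticAt ℂ H v)
    (hH0 : H v ≠ 0) (hK : ∀ z, (belyi z)⁻¹ = (z - v) ^ m * H z) :
    ∃ (L : HalfPlaneLift v m poleModel) (Φ : ℂ → ℂ), DifferentiableOn ℂ Φ (Metric.ball 0 1) ∧
      Φ 0 = v ∧ ∀ s ∈ leftHalfPlane, Φ (Complex.exp (s / m)) = L s := by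
  -- At a pole the equation is solved for reciprocals: `1 / poleModel ζ = ζ * (4 / (1 + ζ) ^ 2)` has
  -- a simple zero at 0.
  obtain ⟨g, hg, hg0, hg', hgh⟩ := exists_local_uniformizer (N := fun ζ => (poleModel ζ)⁻¹)
    (M := fun ζ => 4 / (1 + ζ) ^ 2) hm hH hH0 (Eventually.of_forall hK)
    (analyticAt_const.div ((analyticAt_const.add analyticAt_id).pow 2) (by simp)) (by simp)
    fun ζ => by rw [poleModel, inv_div]; ring
  exact exists_disk_lift hm (fun ζ h0 _ => differentiableAt_poleModel h0)
    regular_poleModel hg hg0 hg' (eventually_nhdsWithin_of_eventually_nhds (by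
      filter_upwards [hgh] with ζ hζ
      exact inv_injective hζ))

theorem analyticAt_belyiDen (z : ℂ) : AnalyticAt ℂ belyiDen z := by
  unfold belyiDen; fun_prop

theorem analyticAt_belyiNum (z : ℂ) : AnalyticAt ℂ belyiNum z := by
  unfold belyiNum; fun_prop

theorem exists_lift_one : Nonempty (HalfPlaneLift ((1 : ℂ) : OnePoint ℂ) 5 blackModel) := by
  have hd : belyiDen 1 ≠ 0 := by
    rw [Ne, belyiDen_eq_zero]
    rintro (h | h)
    · norm_num at h
    · exact blackTip_ne_neg_one (by rw [h, neg_neg])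
  refine exists_black_lift (H := fun z => (z - blackTip) / belyiDen z) (by norm_num)
    ((analyticAt_id.sub analyticAt_const).div (analyticAt_belyiDen 1) hd)
    (div_ne_zero (sub_ne_zero.2 blackTip_ne_one.symm) hd) fun z => ?_
  rw [belyi, belyiNum, mul_div_assoc]

theorem exists_lift_blackTip : Nonempty (HalfPlaneLift (blackTip : OnePoint ℂ) 1 blackModel) := by
  have hd : belyiDen blackTip ≠ 0 := by
    rw [Ne, belyiDen_eq_zero]
    rintro (h | h)
    · exact blackTip_ne_neg_one h
    · exact blackTip_ne_neg h
  refine exists_black_lift (H := fun z => (z - 1) ^ 5 / belyiDen z) (by norm_num)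
    (((analyticAt_id.sub analyticAt_const).pow 5).div (analyticAt_belyiDen _) hd)
    (div_ne_zero (pow_ne_zero _ (sub_ne_zero.2 blackTip_ne_one)) hd) fun z => ?_
  rw [belyi, belyiNum, mul_comm, mul_div_assoc, pow_one]

theorem one_sub_belyi {z : ℂ} (h : belyiDen z ≠ 0) :
    1 - belyi z = 2 * (blackTip + 5) * z * (z ^ 2 - whiteMid ^ 2) ^ 2 / belyiDen z := by
  rw [← belyiDen_sub_belyiNum, sub_div, div_self h, belyi]

theorem exists_lift_whiteMid {v : ℂ} (hv : v = whiteMid ∨ v = -whiteMid) :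
    Nonempty (HalfPlaneLift (v : OnePoint ℂ) 2 whiteModel) := by
  have hb : belyi v = 1 := belyi_eq_one.2 (.inr hv)
  have hd : belyiDen v ≠ 0 := belyiDen_ne_zero (by rw [hb]; exact one_ne_zero)
  have hv0 : v ≠ 0 := by rcases hv with rfl | rfl <;> simp [whiteMid_ne_zero]
  have hv2 : v ^ 2 = whiteMid ^ 2 := by rcases hv with rfl | rfl <;> simp
  refine exists_white_lift
    (H := fun z => 2 * (blackTip + 5) * z * (z + v) ^ 2 / belyiDen z) (by norm_num)
    (AnalyticAt.div (by fun_prop) (analyticAt_belyiDen _) hd) ?_ ?_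
  · have : v + v ≠ 0 := by rw [← two_mul]; simp [hv0]
    refine div_ne_zero ?_ hd
    simp [hv0, blackTip_add_five_ne_zero, this]
  · filter_upwards [continuous_belyiDen.continuousAt.eventually_ne hd] with z hz
    rw [one_sub_belyi hz, ← hv2]
    ring

theorem exists_lift_zero : Nonempty (HalfPlaneLift ((0 : ℂ) : OnePoint ℂ) 1 whiteModel) := by
  have hb : belyi 0 = 1 := belyi_eq_one.2 (.inl rfl)
  have hd : belyiDen 0 ≠ 0 := belyiDen_ne_zero (by rw [hb]; exact one_ne_zero)
  refine exists_white_lift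
    (H := fun z => 2 * (blackTip + 5) * (z ^ 2 - whiteMid ^ 2) ^ 2 / belyiDen z) (by norm_num)
    (AnalyticAt.div (by fun_prop) (analyticAt_belyiDen _) hd) ?_ ?_
  · refine div_ne_zero ?_ hd
    simp [whiteMid_ne_zero, blackTip_add_five_ne_zero]
  · filter_upwards [continuous_belyiDen.continuousAt.eventually_ne hd] with z hz
    rw [one_sub_belyi hz]
    ring

theorem exists_lift_infty : Nonempty (HalfPlaneLift OnePoint.infty 1 whiteModel) := by
  obtain ⟨L⟩ := exists_lift_zero
  exact ⟨L.reflect regular_whiteModel fun ζ => by simp [whiteModel]⟩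

/-! ### The faces as conformal images of the unit disk. -/

/-- A pole together with a conformal map from the unit disk to the face around it. -/
structure PoleDisk (v : ℂ) (m : ℕ) where
  lift : HalfPlaneLift v m poleModel
  map : ℂ → ℂ
  differentiableOn : DifferentiableOn ℂ map (Metric.ball 0 1)
  map_zero : map 0 = v
  map_exp : ∀ s ∈ leftHalfPlane, map (Complex.exp (s / m)) = lift s
  ne_zero : m ≠ 0
  pole : belyiDen v = 0

theorem exists_poleDisk_neg_one : Nonempty (PoleDisk (-1) 5) := by
  have hp : belyiDen (-1) = 0 := belyiDen_eq_zero.2 (.inl rfl)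
  have hn := belyiNum_ne_zero_of_belyiDen hp
  obtain ⟨L, Φ, h1, h2, h3⟩ := exists_pole_disk (v := -1) (m := 5)
    (H := fun z => (z + blackTip) / belyiNum z) (by norm_num)
    ((analyticAt_id.add analyticAt_const).div (analyticAt_belyiNum _) hn)
    (div_ne_zero (fun h => blackTip_ne_one (by linear_combination h)) hn)
    (fun z => by rw [belyi, inv_div, belyiDen, mul_div_assoc, sub_neg_eq_add])
  exact ⟨⟨L, Φ, h1, h2, h3, by norm_num, hp⟩⟩

theorem exists_poleDisk_neg_blackTip : Nonempty (PoleDisk (-blackTip) 1) := by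
  have hp : belyiDen (-blackTip) = 0 := belyiDen_eq_zero.2 (.inr rfl)
  have hn := belyiNum_ne_zero_of_belyiDen hp
  obtain ⟨L, Φ, h1, h2, h3⟩ := exists_pole_disk (v := -blackTip) (m := 1)
    (H := fun z => (z + 1) ^ 5 / belyiNum z) (by norm_num)
    (((analyticAt_id.add analyticAt_const).pow 5).div (analyticAt_belyiNum _) hn)
    (div_ne_zero (pow_ne_zero _ (fun h => blackTip_ne_one (by linear_combination -h))) hn)
    (fun z => by rw [belyi, inv_div, belyiDen, mul_comm, mul_div_assoc, sub_neg_eq_add, pow_one])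
  exact ⟨⟨L, Φ, h1, h2, h3, by norm_num, hp⟩⟩

namespace PoleDisk

variable {v : ℂ} {m : ℕ}

theorem exists_exp_eq (D : PoleDisk v m) {ζ : ℂ} (h0 : ζ ≠ 0) (h1 : ‖ζ‖ < 1) :
    ∃ s ∈ leftHalfPlane, Complex.exp (s / m) = ζ ∧ Complex.exp s = ζ ^ m := by
  have hm : (m : ℂ) ≠ 0 := Nat.cast_ne_zero.2 D.ne_zero
  have hmpos : (0 : ℝ) < m := by have := D.ne_zero; positivity
  refine ⟨m * Complex.log ζ, ?_, ?_, ?_⟩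
  · simp only [leftHalfPlane, Set.mem_ofPred_eq, Complex.mul_re, Complex.natCast_re,
      Complex.natCast_im, zero_mul, sub_zero, Complex.log_re]
    exact mul_neg_of_pos_of_neg hmpos (Real.log_neg (norm_pos_iff.2 h0) h1)
  · rw [mul_div_cancel_left₀ _ hm, Complex.exp_log h0]
  · rw [Complex.exp_nat_mul, Complex.exp_log h0]

theorem belyi_map_mem (D : PoleDisk v m) {ζ : ℂ} (h0 : ζ ≠ 0) (h1 : ‖ζ‖ < 1) :
    belyi (D.map ζ) ∈ regularValues := by
  obtain ⟨s, hs, rfl, hs2⟩ := D.exists_exp_eq h0 h1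
  rw [D.map_exp s hs]
  exact D.lift.belyi_mem regular_poleModel hs

theorem map_ne (D : PoleDisk v m) {ζ : ℂ} (h0 : ζ ≠ 0) (h1 : ‖ζ‖ < 1) : D.map ζ ≠ v := by
  intro h
  have := (D.belyi_map_mem h0 h1).1
  rw [h] at this
  exact this (belyi_eq_zero.2 (.inr D.pole))

/-- Away from 0 this is the injectivity of the lift modulo `m` periods, which `exp (s / m)` does not
see. The centre is the only point sent to the pole. -/
theorem injOn (D : PoleDisk v m) : Set.InjOn D.map (Metric.ball 0 1) := by
  intro ζ hζ ξ hξ heq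
  rw [mem_ball_zero_iff] at hζ hξ
  have hm : (m : ℂ) ≠ 0 := Nat.cast_ne_zero.2 D.ne_zero
  by_cases h0 : ζ = 0
  · by_cases h1 : ξ = 0
    · rw [h0, h1]
    · rw [h0, D.map_zero] at heq
      exact absurd heq.symm (D.map_ne h1 hξ)
  · by_cases h1 : ξ = 0
    · rw [h1, D.map_zero] at heq
      exact absurd heq (D.map_ne h0 hζ)
    · obtain ⟨s, hs, rfl, -⟩ := D.exists_exp_eq h0 hζ
      obtain ⟨t, ht, rfl, -⟩ := D.exists_exp_eq h1 hξ
      rw [D.map_exp s hs, D.map_exp t ht] at heq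
      obtain ⟨n, rfl⟩ := (D.lift.apply_eq_iff D.ne_zero regular_poleModel injective_poleModel
        hs ht).1 heq
      rw [add_div, mul_left_comm, mul_div_cancel_left₀ _ hm, exp_add_int_mul_period]

/-- The face around the pole. -/
def face (D : PoleDisk v m) : Set (OnePoint ℂ) :=
  Set.range fun ζ : Metric.ball (0 : ℂ) 1 => ((D.map ζ : ℂ) : OnePoint ℂ)

/-- The map is injective and not constant, so the open mapping theorem applies. -/
theorem isOpenEmbedding (D : PoleDisk v m) :
    IsOpenEmbedding fun ζ : Metric.ball (0 : ℂ) 1 => ((D.map ζ : ℂ) : OnePoint ℂ) := by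
  have hc : ContinuousOn D.map (Metric.ball 0 1) := D.differentiableOn.continuousOn
  refine IsOpenEmbedding.of_continuous_injective_isOpenMap
    (OnePoint.continuous_coe.comp (continuousOn_iff_continuous_domRestrict.1 hc)) ?_ ?_
  · intro ζ ξ h
    exact Subtype.ext (D.injOn ζ.2 ξ.2 (OnePoint.coe_injective h))
  · intro s hs
    have han := (D.differentiableOn.analyticOnNhd Metric.isOpen_ball).is_constant_or_isOpen
      (convex_ball (0 : ℂ) 1).isPreconnected
    rcases han with ⟨w, hw⟩ | hopen
    · exfalso
      have h2 : (1 / 2 : ℂ) ∈ Metric.ball (0 : ℂ) 1 := by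
        rw [mem_ball_zero_iff]; norm_num
      have h0 : (0 : ℂ) ∈ Metric.ball (0 : ℂ) 1 := by simp
      have := D.injOn h0 h2 ((hw _ h0).trans (hw _ h2).symm)
      norm_num at this
    · have h1 := hopen (Subtype.val '' s) (by rintro _ ⟨x, -, rfl⟩; exact x.2)
        (Metric.isOpen_ball.isOpenMap_subtype_val s hs)
      have h2 := OnePoint.isOpenMap_coe _ h1
      rwa [Set.image_image, Set.image_image] at h2

theorem isOpen_face (D : PoleDisk v m) : IsOpen D.face := D.isOpenEmbedding.isOpen_range

theorem nonempty_homeomorph (D : PoleDisk v m) :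
    Nonempty (D.face ≃ₜ Metric.ball (0 : ℂ) 1) :=
  ⟨D.isOpenEmbedding.isEmbedding.toHomeomorph.symm⟩

theorem vertex_mem_face (D : PoleDisk v m) : (v : OnePoint ℂ) ∈ D.face :=
  ⟨⟨0, by simp⟩, by simp [D.map_zero]⟩

theorem lift_mem_face (D : PoleDisk v m) {s : ℂ} (hs : s ∈ leftHalfPlane) :
    ((D.lift s : ℂ) : OnePoint ℂ) ∈ D.face := by
  refine ⟨⟨Complex.exp (s / m), ?_⟩, ?_⟩
  · rw [mem_ball_zero_iff, Complex.norm_exp, Real.exp_lt_one_iff, re_div_natCast]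
    have := D.ne_zero
    exact div_neg_of_neg_of_pos hs (by positivity)
  · simp only [D.map_exp s hs]

theorem mem_face (D : PoleDisk v m) {x : OnePoint ℂ} (hx : x ∈ D.face) :
    x = v ∨ ∃ s ∈ leftHalfPlane, x = (D.lift s : OnePoint ℂ) := by
  obtain ⟨⟨ζ, hζ⟩, rfl⟩ := hx
  rw [mem_ball_zero_iff] at hζ
  by_cases h0 : ζ = 0
  · left; simp [h0, D.map_zero]
  · obtain ⟨s, hs, rfl, -⟩ := D.exists_exp_eq h0 hζ
    right
    exact ⟨s, hs, by simp only [D.map_exp s hs]⟩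

theorem onSphere_lift (D : PoleDisk v m) {s : ℂ} (hs : s ∈ leftHalfPlane) :
    belyiRat.onSphere (D.lift s) = (poleModel (Complex.exp s) : OnePoint ℂ) := by
  have h := D.lift.belyi_mem regular_poleModel hs
  rw [onSphere_coe_of_ne_zero h.1, D.lift.belyi_apply s hs]

theorem face_subset (D : PoleDisk v m) : D.face ⊆ (belyiRat.onSphere ⁻¹' unitSegment)ᶜ := by
  rintro x hx ⟨t, ht⟩
  rcases D.mem_face hx with rfl | ⟨s, hs, rfl⟩
  · rw [onSphere_pole D.pole] at ht
    exact OnePoint.coe_ne_infty _ ht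
  · rw [D.onSphere_lift hs] at ht
    exact poleModel_ne (Complex.exp_ne_zero s) (norm_exp_lt_one hs) t.2.1 t.2.2
      (OnePoint.coe_injective ht.symm)

theorem eq_of_onSphere_eq_infty (D : PoleDisk v m) {x : OnePoint ℂ} (hx : x ∈ D.face)
    (h : belyiRat.onSphere x = OnePoint.infty) : x = v := by
  rcases D.mem_face hx with rfl | ⟨s, hs, rfl⟩
  · rfl
  · rw [D.onSphere_lift hs] at h
    exact absurd h (OnePoint.coe_ne_infty _)

/-- A common point that is not a pole is a common value of the two lifts, which forces their poles
to be equal. -/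
theorem disjoint_face {v' : ℂ} {m' : ℕ} (D : PoleDisk v m) (D' : PoleDisk v' m') (hv : v ≠ v') :
    Disjoint D.face D'.face := by
  have hv' : (v : OnePoint ℂ) ≠ v' := fun h => hv (OnePoint.coe_injective h)
  rw [Set.disjoint_left]
  intro x hx hx'
  by_cases hinf : belyiRat.onSphere x = OnePoint.infty
  · exact hv' ((D.eq_of_onSphere_eq_infty hx hinf).symm.trans
      (D'.eq_of_onSphere_eq_infty hx' hinf))
  · rcases D.mem_face hx with rfl | ⟨s, hs, rfl⟩
    · exact hinf (onSphere_pole D.pole)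
    rcases D'.mem_face hx' with h | ⟨s', hs', h⟩
    · rw [h] at hinf; exact hinf (onSphere_pole D'.pole)
    exact hv' (D.lift.vertex_eq D'.lift D.ne_zero D'.ne_zero regular_poleModel
      injective_poleModel hs hs' (OnePoint.coe_injective h))

end PoleDisk

/-! ### The two edges on the unit circle -/

/-- The Belyi function on the unit circle. -/
def circleValue (y : ℝ) : ℝ := y ^ 5 * (2 - y) / (2 * y + 1)

/-- The squared factor vanishes for `y ≥ 0` only at the golden ratio, the coordinate of `whiteMid`.
So the arc from `y = 0` to `y = 2` consists of two edges that meet there. -/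
theorem one_sub_circleValue {y : ℝ} (hy : 0 ≤ y) :
    1 - circleValue y = (y ^ 2 - y - 1) ^ 2 * (y ^ 2 + 1) / (2 * y + 1) := by
  have : 2 * y + 1 ≠ 0 := by positivity
  rw [circleValue, eq_div_iff this, sub_mul, div_mul_cancel₀ _ this]
  ring

theorem sq_sub_goldenRatio {y : ℝ} (hy : 0 ≤ y) (h : y ≠ Real.goldenRatio) :
    y ^ 2 - y - 1 ≠ 0 := by
  have h1 := Real.goldenRatio_sq
  have h2 := Real.goldenRatio_pos
  have h3 : y ^ 2 - y - 1 = (y - Real.goldenRatio) * (y + Real.goldenRatio - 1) := by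
    linear_combination h1
  have h4 := Real.one_lt_goldenRatio
  rw [h3]
  exact mul_ne_zero (sub_ne_zero.2 h) (by linarith : (0 : ℝ) < y + Real.goldenRatio - 1).ne'

theorem circleValue_pos {y : ℝ} (h0 : 0 < y) (h2 : y < 2) : 0 < circleValue y := by
  have : 0 < 2 - y := by linarith
  unfold circleValue
  positivity

theorem circleValue_lt_one {y : ℝ} (h0 : 0 < y) (h : y ≠ Real.goldenRatio) :
    circleValue y < 1 := by
  have h1 := one_sub_circleValue h0.le
  have h2 := sq_sub_goldenRatio h0.le h
  have h3 : 0 < (y ^ 2 - y - 1) ^ 2 * (y ^ 2 + 1) / (2 * y + 1) := by positivity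
  linarith

theorem belyi_circlePoint_eq {y : ℝ} (h0 : 0 < y) : belyi (circlePoint y) = circleValue y :=
  belyi_circlePoint (by positivity)

theorem continuousAt_circleValue {y : ℝ} (h0 : 0 ≤ y) : ContinuousAt circleValue y := by
  unfold circleValue
  exact ContinuousAt.div (by fun_prop) (by fun_prop) (by positivity)

theorem circleValue_goldenRatio : circleValue Real.goldenRatio = 1 := by
  have h1 := one_sub_circleValue Real.goldenRatio_pos.le
  rw [Real.goldenRatio_sq] at h1
  simp at h1
  linarith

theorem ofReal_log_mem_leftHalfPlane {t : ℝ} (h0 : 0 < t) (h1 : t < 1) (c : ℂ) (hc : c.re = 0) :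
    (Real.log t : ℂ) + c ∈ leftHalfPlane := by
  simpa [leftHalfPlane, hc] using Real.log_neg h0 h1

theorem exp_ofReal_log {t : ℝ} (h0 : 0 < t) : Complex.exp (Real.log t : ℂ) = t := by
  rw [← Complex.ofReal_exp, Real.exp_log h0]

theorem tendsto_log_reAtBot (c : ℂ) :
    Tendsto (fun t : ℝ => (Real.log t : ℂ) + c) (𝓝[>] 0) reAtBot := by
  refine tendsto_add_reAtBot.comp ?_
  rw [reAtBot, tendsto_comap_iff]
  have : Complex.re ∘ (fun t : ℝ => (Real.log t : ℂ)) = Real.log := by ext; simp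
  rw [this]
  exact Real.tendsto_log_nhdsGT_zero

/-! ### The lifts at all vertices -/

/-- The lift at the black vertex of degree 1. -/
def tipLift : HalfPlaneLift (blackTip : OnePoint ℂ) 1 blackModel := exists_lift_blackTip.some

/-- The black vertices. -/
def blackVertex : Fin 2 → OnePoint ℂ
  | 0 => ((1 : ℂ) : OnePoint ℂ)
  | 1 => (blackTip : OnePoint ℂ)

/-- The degrees of the black vertices. -/
def blackDegree : Fin 2 → ℕ
  | 0 => 5
  | 1 => 1

theorem blackVertex_injective : Function.Injective blackVertex := by
  have := blackTip_ne_one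
  intro i j h
  fin_cases i <;> fin_cases j <;> simp_all [blackVertex, eq_comm]

theorem exists_black_apply_eq (L : HalfPlaneLift ((1 : ℂ) : OnePoint ℂ) 5 blackModel) {s : ℂ}
    (hs : s ∈ leftHalfPlane) {x : ℂ} (hx : belyi x = Complex.exp s) :
    (∃ k : ℕ, k < 5 ∧ x = L (s + k * period)) ∨ x = tipLift s := by
  obtain ⟨i, k, hk, h⟩ := HalfPlaneLift.exists_apply_eq blackVertex_injective (m := blackDegree)
    (h := blackModel) (fun i => match i with | 0 => L | 1 => tipLift)
    (by intro i; fin_cases i <;> simp [blackDegree]) (by simp [blackDegree])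
    regular_blackModel injective_blackModel hs hx
  match i, hk, h with
  | 0, hk, h => exact .inl ⟨k, hk, h⟩
  | 1, hk, h =>
    have : k = 0 := by simpa [blackDegree] using hk
    right
    simpa [this] using h

/-- A lift agrees with the parametrized circle over an interval, up to a shift. -/
theorem circle_edge (L : HalfPlaneLift ((1 : ℂ) : OnePoint ℂ) 5 blackModel) {I : Set ℝ}
    (hI : IsPreconnected I) (h0 : ∀ y ∈ I, 0 < y) (h2 : ∀ y ∈ I, y < 2)
    (hg : ∀ y ∈ I, y ≠ Real.goldenRatio) {y₀ : ℝ} (hy₀ : y₀ ∈ I) :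
    (∃ k : ℕ, k < 5 ∧ ∀ y ∈ I, circlePoint y = L (Real.log (circleValue y) + k * period)) ∨
      ∀ y ∈ I, circlePoint y = tipLift (Real.log (circleValue y)) := by
  have hpos : ∀ y ∈ I, 0 < circleValue y := fun y hy => circleValue_pos (h0 y hy) (h2 y hy)
  have hlt : ∀ y ∈ I, circleValue y < 1 := fun y hy => circleValue_lt_one (h0 y hy) (hg y hy)
  have hmem : ∀ (k : ℕ), ∀ y ∈ I, (Real.log (circleValue y) : ℂ) + k * period ∈ leftHalfPlane :=
    fun k y hy => ofReal_log_mem_leftHalfPlane (hpos y hy) (hlt y hy) _ (nat_mul_period_re k)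
  have hmem0 : ∀ y ∈ I, (Real.log (circleValue y) : ℂ) ∈ leftHalfPlane := fun y hy => by
    simpa using hmem 0 y hy
  have hreg : ∀ y ∈ I, belyi (circlePoint y) ∈ regularValues := by
    intro y hy
    rw [belyi_circlePoint_eq (h0 y hy)]
    exact ⟨by exact_mod_cast (hpos y hy).ne', by exact_mod_cast (hlt y hy).ne⟩
  have hcont : ContinuousOn (fun y => (Real.log (circleValue y) : ℂ)) I := by
    intro y hy
    refine ContinuousAt.continuousWithinAt ?_
    refine Complex.continuous_ofReal.continuousAt.comp (f := fun y => Real.log (circleValue y)) ?_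
    exact (continuousAt_circleValue (h0 y hy).le).log (hpos y hy).ne'
  have hexp : ∀ (k : ℕ), ∀ y ∈ I,
      Complex.exp (Real.log (circleValue y) + k * period) = circleValue y := by
    intro k y hy
    have := exp_add_int_mul_period (Real.log (circleValue y)) k
    push_cast at this
    rw [this, exp_ofReal_log (hpos y hy)]
  have hexp0 : ∀ y ∈ I, Complex.exp (Real.log (circleValue y)) = circleValue y :=
    fun y hy => exp_ofReal_log (hpos y hy)
  rcases exists_black_apply_eq L (hmem0 y₀ hy₀) (x := circlePoint y₀)
      (by rw [belyi_circlePoint_eq (h0 y₀ hy₀), hexp0 y₀ hy₀]) with ⟨k, hk, heq⟩ | heq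
  · left
    refine ⟨k, hk, belyi_lift_unique hI continuous_circlePoint.continuousOn
      (L.continuousOn.comp (hcont.add continuousOn_const) (hmem k)) hreg ?_ hy₀ heq⟩
    intro y hy
    rw [belyi_circlePoint_eq (h0 y hy), L.belyi_apply _ (hmem k y hy), hexp k y hy, blackModel]
  · right
    refine belyi_lift_unique hI continuous_circlePoint.continuousOn
      (tipLift.continuousOn.comp hcont hmem0) hreg ?_ hy₀ heq
    intro y hy
    rw [belyi_circlePoint_eq (h0 y hy), tipLift.belyi_apply _ (hmem0 y hy), hexp0 y hy, blackModel]

theorem tendsto_circleValue_zero : Tendsto circleValue (𝓝[>] 0) (𝓝[>] 0) := by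
  refine tendsto_nhdsWithin_iff.2 ⟨?_, ?_⟩
  · have := (continuousAt_circleValue (le_refl 0)).tendsto
    simp only [circleValue] at this
    simpa [circleValue] using this.mono_left nhdsWithin_le_nhds
  · filter_upwards [Ioo_mem_nhdsGT (show (0 : ℝ) < 2 by norm_num)] with y hy
    exact circleValue_pos hy.1 hy.2

theorem tendsto_circleValue_two : Tendsto circleValue (𝓝[<] 2) (𝓝[>] 0) := by
  refine tendsto_nhdsWithin_iff.2 ⟨?_, ?_⟩
  · have := (continuousAt_circleValue (show (0 : ℝ) ≤ 2 by norm_num)).tendsto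
    simpa [circleValue] using this.mono_left nhdsWithin_le_nhds
  · filter_upwards [Ioo_mem_nhdsLT (show (0 : ℝ) < 2 by norm_num)] with y hy
    exact circleValue_pos hy.1 hy.2

theorem tendsto_circlePoint {y : ℝ} (s : Set ℝ) :
    Tendsto (fun y => (circlePoint y : OnePoint ℂ)) (𝓝[s] y) (𝓝 (circlePoint y : OnePoint ℂ)) :=
  ((OnePoint.continuous_coe.comp continuous_circlePoint).tendsto y).mono_left nhdsWithin_le_nhds

/-- The lift at the black vertex of degree 5 can be normalized so that it starts with the edge on
the unit circle. -/
theorem exists_centerLift : ∃ L : HalfPlaneLift ((1 : ℂ) : OnePoint ℂ) 5 blackModel,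
    ∀ y, 0 < y → y < Real.goldenRatio → circlePoint y = L (Real.log (circleValue y)) := by
  obtain ⟨L⟩ := exists_lift_one
  have hφ := Real.goldenRatio_lt_two
  have hφ1 := Real.one_lt_goldenRatio
  rcases circle_edge L (I := Set.Ioo 0 Real.goldenRatio) isPreconnected_Ioo (fun y hy => hy.1)
    (fun y hy => hy.2.trans hφ) (fun y hy => hy.2.ne) (y₀ := 1) ⟨one_pos, hφ1⟩ with
      ⟨k, -, h⟩ | h
  · refine ⟨L.shift k, fun y h0 h1 => ?_⟩
    rw [h y ⟨h0, h1⟩, HalfPlaneLift.shift_apply]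
    push_cast; rfl
  -- On the lift at `blackTip` the arc would tend to `blackTip` as `y → 0`, but it tends to 1.
  · exfalso
    have h1 : Tendsto (fun y => (tipLift (Real.log (circleValue y)) : OnePoint ℂ)) (𝓝[>] 0)
        (𝓝 (blackTip : OnePoint ℂ)) := by
      have := (tipLift.tendsto one_ne_zero).comp
        ((tendsto_log_reAtBot 0).comp tendsto_circleValue_zero)
      simpa [Function.comp_def] using this
    have h2 := tendsto_circlePoint (y := 0) (Set.Ioi 0)
    rw [circlePoint_zero] at h2
    have h3 := tendsto_nhds_unique_of_eventuallyEq h1 h2 (by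
      filter_upwards [Ioo_mem_nhdsGT (show (0 : ℝ) < Real.goldenRatio by linarith)] with y hy
      rw [h y hy])
    exact blackTip_ne_one (OnePoint.coe_injective h3)

/-- The lift at the black vertex of degree 5, starting with the edge on the unit circle. -/
def centerLift : HalfPlaneLift ((1 : ℂ) : OnePoint ℂ) 5 blackModel := exists_centerLift.choose

theorem centerLift_circle {y : ℝ} (h0 : 0 < y) (h1 : y < Real.goldenRatio) :
    circlePoint y = centerLift (Real.log (circleValue y)) :=
  exists_centerLift.choose_spec y h0 h1

/-- The arc tends to `blackTip` as `y → 2`, while every lift at the other black vertex would tend to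
1. -/
theorem tipLift_circle {y : ℝ} (h0 : Real.goldenRatio < y) (h1 : y < 2) :
    circlePoint y = tipLift (Real.log (circleValue y)) := by
  have hφ := Real.goldenRatio_lt_two
  have hφ1 := Real.one_lt_goldenRatio
  rcases circle_edge centerLift (I := Set.Ioo Real.goldenRatio 2) isPreconnected_Ioo
    (fun y hy => by linarith [hy.1]) (fun y hy => hy.2) (fun y hy => hy.1.ne') (y₀ := y) ⟨h0, h1⟩
      with ⟨k, -, h⟩ | h
  · exfalso
    have h1 : Tendsto (fun y => (centerLift (Real.log (circleValue y) + k * period) : OnePoint ℂ))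
        (𝓝[<] 2) (𝓝 ((1 : ℂ) : OnePoint ℂ)) :=
      (centerLift.tendsto (by norm_num)).comp
        ((tendsto_log_reAtBot _).comp tendsto_circleValue_two)
    have h2 := tendsto_circlePoint (y := 2) (Set.Iio 2)
    rw [circlePoint_two] at h2
    have h3 := tendsto_nhds_unique_of_eventuallyEq h1 h2 (by
      filter_upwards [Ioo_mem_nhdsLT hφ] with y hy
      rw [h y hy])
    exact blackTip_ne_one (OnePoint.coe_injective h3).symm
  · exact h y ⟨h0, h1⟩

/-- Both sides lift the same function and agree at a point of the unit circle, which the reflection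
fixes. -/
theorem circleReflection_centerLift {s : ℂ} (hs : s ∈ leftHalfPlane) :
    circleReflection (centerLift ((starRingEnd ℂ) s)) = centerLift s := by
  have h1 := Real.one_lt_goldenRatio
  have hv : 0 < circleValue 1 := circleValue_pos one_pos (by norm_num)
  have hv1 : circleValue 1 < 1 := circleValue_lt_one one_pos h1.ne
  have hmem : (Real.log (circleValue 1) : ℂ) ∈ leftHalfPlane := by
    simpa using ofReal_log_mem_leftHalfPlane hv hv1 0 rfl
  refine belyi_lift_unique (U := leftHalfPlane) (convex_re_lt 0).isPreconnected
    (centerLift.continuousOn_reflect regular_blackModel) centerLift.continuousOn ?_ ?_ hmem ?_ hs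
  · intro s hs
    rw [centerLift.belyi_reflect regular_blackModel (fun ζ => rfl) hs]
    exact regular_blackModel _ (Complex.exp_ne_zero _) (norm_exp_lt_one hs)
  · intro s hs
    rw [centerLift.belyi_reflect regular_blackModel (fun ζ => rfl) hs, centerLift.belyi_apply s hs]
  · simp only [Complex.conj_ofReal]
    rw [← centerLift_circle one_pos h1, circleReflection_circlePoint]

/-! ### The six edges -/

/-- The black end of an edge. -/
def blackEnd : Fin 6 → OnePoint ℂ
  | 0 | 1 | 2 | 3 | 4 => ((1 : ℂ) : OnePoint ℂ)
  | 5 => (blackTip : OnePoint ℂ)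

/-- The degree of the black end of an edge. -/
def blackEndDegree : Fin 6 → ℕ
  | 0 | 1 | 2 | 3 | 4 => 5
  | 5 => 1

/-- The lift at the black end of an edge that starts with the edge. -/
def edgeLift : (e : Fin 6) → HalfPlaneLift (blackEnd e) (blackEndDegree e) blackModel
  | 0 => centerLift.shift (0 : ℕ)
  | 1 => centerLift.shift (1 : ℕ)
  | 2 => centerLift.shift (2 : ℕ)
  | 3 => centerLift.shift (3 : ℕ)
  | 4 => centerLift.shift (4 : ℕ)
  | 5 => tipLift

theorem blackEndDegree_ne_zero (e : Fin 6) : blackEndDegree e ≠ 0 := by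
  fin_cases e <;> simp [blackEndDegree]

theorem edgeLift_apply {e : Fin 6} (he : (e : ℕ) < 5) (s : ℂ) :
    edgeLift e s = centerLift (s + (e : ℕ) * period) := by
  match e, he with
  | 0, _ | 1, _ | 2, _ | 3, _ | 4, _ => exact centerLift.shift_apply _ s

theorem edgeLift_five (s : ℂ) : edgeLift 5 s = tipLift s := rfl

theorem exists_edgeLift_eq {s : ℂ} (hs : s ∈ leftHalfPlane) {x : ℂ}
    (hx : belyi x = Complex.exp s) : ∃ e, x = edgeLift e s := by
  rcases exists_black_apply_eq centerLift hs hx with ⟨k, hk, h⟩ | h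
  · exact ⟨⟨k, by omega⟩, by rw [edgeLift_apply hk, h]⟩
  · exact ⟨5, h⟩

theorem edgeLift_injective {s : ℂ} (hs : s ∈ leftHalfPlane) {e e' : Fin 6}
    (h : edgeLift e s = edgeLift e' s) : e = e' := by
  have hend := (edgeLift e).vertex_eq (edgeLift e') (blackEndDegree_ne_zero e)
    (blackEndDegree_ne_zero e') regular_blackModel injective_blackModel hs hs h
  have hne : ((1 : ℂ) : OnePoint ℂ) ≠ (blackTip : OnePoint ℂ) := fun h =>
    blackTip_ne_one (OnePoint.coe_injective h).symm
  have h5 : ∀ e : Fin 6, ¬ (e : ℕ) < 5 → e = 5 := by decide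
  have hlt : ∀ e : Fin 6, (e : ℕ) < 5 → blackEnd e = ((1 : ℂ) : OnePoint ℂ) := by
    intro e he
    match e, he with
    | 0, _ | 1, _ | 2, _ | 3, _ | 4, _ => rfl
  by_cases he : (e : ℕ) < 5
  · by_cases he' : (e' : ℕ) < 5
    · rw [edgeLift_apply he, edgeLift_apply he'] at h
      exact Fin.ext (centerLift.apply_natCast_eq (by norm_num) regular_blackModel
        injective_blackModel hs he he' h)
    · rw [hlt e he, h5 e' he'] at hend
      exact absurd hend hne
  · by_cases he' : (e' : ℕ) < 5
    · rw [hlt e' he', h5 e he] at hend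
      exact absurd hend.symm hne
    · have h6 := h5 e' he'
      exact (h5 e he).trans h6.symm

/-- The rotation around the black vertices. -/
def modelσ : Equiv.Perm (Fin 6) where
  toFun := ![1, 2, 3, 4, 0, 5]
  invFun := ![4, 0, 1, 2, 3, 5]
  left_inv := by unfold Function.LeftInverse; decide
  right_inv := by unfold Function.RightInverse Function.LeftInverse; decide

/-- The rotation around the white vertices. -/
def modelα : Equiv.Perm (Fin 6) where
  toFun := ![5, 1, 3, 2, 4, 0]
  invFun := ![5, 1, 3, 2, 4, 0]
  left_inv := by unfold Function.LeftInverse; decide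
  right_inv := by unfold Function.RightInverse Function.LeftInverse; decide

/-- Only the edges 4 and 5 need periodicity: five periods lead from 4 back to 0, and the lift at the
tip has period one. -/
theorem edgeLift_modelσ (e : Fin 6) {s : ℂ} (hs : s ∈ leftHalfPlane) :
    edgeLift (modelσ e) s = edgeLift e (s + period) := by
  by_cases he : (e : ℕ) < 4
  · have h1 : (modelσ e : ℕ) = e + 1 := by
      revert e; decide
    rw [edgeLift_apply (e := e) (by omega), edgeLift_apply (by omega), h1]
    push_cast; congr 1; ring
  · have h2 : e = 4 ∨ e = 5 := by omega
    rcases h2 with rfl | rfl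
    · change edgeLift 0 s = _
      rw [edgeLift_apply (by decide), edgeLift_apply (by decide),
        ← centerLift.periodic _ (add_mem_leftHalfPlane hs _ (nat_mul_period_re _))]
      congr 1
      simp only [Fin.coe_ofNat_eq_mod]
      push_cast; ring
    · change tipLift s = tipLift (s + period)
      have := tipLift.periodic s hs
      rw [← this]
      simp

/-! ### The white ends of the edges -/

/-- The white vertices. -/
def whiteVertex : Fin 4 → OnePoint ℂ
  | 0 => (whiteMid : OnePoint ℂ)
  | 1 => ((-whiteMid : ℂ) : OnePoint ℂ)
  | 2 => ((0 : ℂ) : OnePoint ℂ)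
  | 3 => OnePoint.infty

/-- The degrees of the white vertices. -/
def whiteDegree : Fin 4 → ℕ
  | 0 | 1 => 2
  | 2 | 3 => 1

theorem whiteVertex_injective : Function.Injective whiteVertex := by
  have h1 := whiteMid_ne_zero
  have h2 := whiteMid_ne_neg
  have h3 := h2.symm
  intro i j h
  fin_cases i <;> fin_cases j <;> simp_all [whiteVertex, eq_comm]

/-- The lifts at the white vertices. -/
def whiteLift : (i : Fin 4) → HalfPlaneLift (whiteVertex i) (whiteDegree i) whiteModel
  | 0 => (exists_lift_whiteMid (.inl rfl)).some
  | 1 => (exists_lift_whiteMid (.inr rfl)).some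
  | 2 => exists_lift_zero.some
  | 3 => exists_lift_infty.some

theorem whiteDegree_ne_zero (i : Fin 4) : whiteDegree i ≠ 0 := by
  fin_cases i <;> simp [whiteDegree]

/-- The intersection of the unit disks around `0` and `1`. -/
def lens : Set ℂ := {w | ‖w‖ < 1 ∧ ‖1 - w‖ < 1}

theorem convex_lens : Convex ℝ lens := by
  have : lens = Metric.ball 0 1 ∩ Metric.ball 1 1 := by
    ext w
    simp [lens, dist_eq_norm, norm_sub_rev]
  rw [this]
  exact (convex_ball _ _).inter (convex_ball _ _)

theorem re_pos_of_mem_lens {w : ℂ} (hw : w ∈ lens) : 0 < w.re := by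
  have h1 := (Complex.re_le_norm (1 - w)).trans_lt hw.2
  simp at h1
  exact h1

theorem ne_zero_of_mem_lens {w : ℂ} (hw : w ∈ lens) : w ≠ 0 := by
  rintro rfl
  exact lt_irrefl _ (re_pos_of_mem_lens hw)

theorem one_sub_mem_lens {w : ℂ} (hw : w ∈ lens) : 1 - w ∈ lens :=
  ⟨hw.2, by simpa using hw.1⟩

theorem log_mem_leftHalfPlane {w : ℂ} (hw : w ∈ lens) : Complex.log w ∈ leftHalfPlane := by
  simp only [leftHalfPlane, Set.mem_ofPred_eq, Complex.log_re]
  exact Real.log_neg (norm_pos_iff.2 (ne_zero_of_mem_lens hw)) hw.1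

theorem continuousOn_log_lens : ContinuousOn Complex.log lens := fun _ hw =>
  (continuousAt_clog (.inl (re_pos_of_mem_lens hw))).continuousWithinAt

theorem ofReal_mem_lens {t : ℝ} (h0 : 0 < t) (h1 : t < 1) : (t : ℂ) ∈ lens := by
  have h2 : (1 : ℂ) - t = ((1 - t : ℝ) : ℂ) := by push_cast; rfl
  refine ⟨?_, ?_⟩
  · rw [Complex.norm_real, Real.norm_of_nonneg h0.le]; exact h1
  · rw [h2, Complex.norm_real, Real.norm_of_nonneg (by linarith)]; linarith

/-- On the lens both `log w` and `log (1 - w)` are available, and both sides are lifts of the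
identity. The lifts at the white vertices fill the fibre over 1/2, so one of them agrees with the
edge there, hence on the whole lens. -/
theorem exists_white_end (e : Fin 6) : ∃ i, ∃ k : Fin (whiteDegree i), ∀ w ∈ lens,
    edgeLift e (Complex.log w) = whiteLift i (Complex.log (1 - w) + (k : ℕ) * period) := by
  have hhalf : ((1 / 2 : ℝ) : ℂ) ∈ lens := ofReal_mem_lens (by norm_num) (by norm_num)
  have hb : ∀ w ∈ lens, belyi (edgeLift e (Complex.log w)) = w := fun w hw => by
    rw [(edgeLift e).belyi_apply _ (log_mem_leftHalfPlane hw), Complex.exp_log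
      (ne_zero_of_mem_lens hw), blackModel]
  have hexp : ∀ w ∈ lens, Complex.exp (Complex.log (1 - w)) = 1 - w := fun w hw =>
    Complex.exp_log (ne_zero_of_mem_lens (one_sub_mem_lens hw))
  obtain ⟨i, k, hk, h⟩ := HalfPlaneLift.exists_apply_eq whiteVertex_injective whiteLift
    whiteDegree_ne_zero (by simp [Fin.sum_univ_four, whiteDegree]) regular_whiteModel
    injective_whiteModel (log_mem_leftHalfPlane (one_sub_mem_lens hhalf))
    (x := edgeLift e (Complex.log ((1 / 2 : ℝ) : ℂ)))
    (by rw [hb _ hhalf, hexp _ hhalf, whiteModel, sub_sub_cancel])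
  have hmem : ∀ w ∈ lens, Complex.log (1 - w) + k * period ∈ leftHalfPlane := fun w hw =>
    add_mem_leftHalfPlane (log_mem_leftHalfPlane (one_sub_mem_lens hw)) _ (nat_mul_period_re k)
  refine ⟨i, ⟨k, hk⟩, belyi_lift_unique convex_lens.isPreconnected
    ((edgeLift e).continuousOn.comp continuousOn_log_lens fun _ hw => log_mem_leftHalfPlane hw)
    ((whiteLift i).continuousOn.comp ((continuousOn_log_lens.comp (by fun_prop)
      fun w hw => one_sub_mem_lens hw).add continuousOn_const) hmem) ?_ ?_ hhalf h⟩
  · intro w hw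
    exact (edgeLift e).belyi_mem regular_blackModel (log_mem_leftHalfPlane hw)
  · intro w hw
    have := exp_add_int_mul_period (Complex.log (1 - w)) k
    push_cast at this
    rw [hb w hw, (whiteLift i).belyi_apply _ (hmem w hw), this, hexp w hw, whiteModel,
      sub_sub_cancel]

/-- The number of the white end of an edge. -/
def whiteIndex (e : Fin 6) : Fin 4 := (exists_white_end e).choose

/-- The number of an edge among those at its white end. -/
def whiteNumber (e : Fin 6) : Fin (whiteDegree (whiteIndex e)) :=
  (exists_white_end e).choose_spec.choose

theorem edgeLift_eq_whiteLift (e : Fin 6) {w : ℂ} (hw : w ∈ lens) :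
    edgeLift e (Complex.log w) =
      whiteLift (whiteIndex e) (Complex.log (1 - w) + (whiteNumber e : ℕ) * period) :=
  (exists_white_end e).choose_spec.choose_spec w hw

/-- There are six edges and `2 + 2 + 1 + 1` places at white vertices; two edges in the same place
would agree over 1/2. -/
theorem white_bijective : Function.Bijective
    fun e : Fin 6 => (⟨whiteIndex e, whiteNumber e⟩ : (i : Fin 4) × Fin (whiteDegree i)) := by
  rw [Fintype.bijective_iff_injective_and_card]
  refine ⟨?_, by
    rw [Fintype.card_sigma]
    simp only [Fintype.card_fin, Fin.sum_univ_four]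
    rfl⟩
  intro e e' h
  have hhalf : ((1 / 2 : ℝ) : ℂ) ∈ lens := ofReal_mem_lens (by norm_num) (by norm_num)
  apply edgeLift_injective (log_mem_leftHalfPlane hhalf)
  rw [edgeLift_eq_whiteLift e hhalf, edgeLift_eq_whiteLift e' hhalf]
  have := congrArg (fun p : (i : Fin 4) × Fin (whiteDegree i) =>
    whiteLift p.1 (Complex.log (1 - ((1 / 2 : ℝ) : ℂ)) + (p.2 : ℕ) * period)) h
  exact this

theorem card_whiteIndex (i : Fin 4) :
    (Finset.univ.filter fun e => whiteIndex e = i).card = whiteDegree i := by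
  set F := Equiv.ofBijective _ white_bijective with hF
  rw [← Fintype.card_subtype, ← Fintype.card_fin (whiteDegree i)]
  refine Fintype.card_congr
    ((F.subtypeEquiv (q := fun p => p.1 = i) fun e => Iff.rfl).trans (Equiv.sigmaSubtype i))

/-- The white end of an edge. -/
def whiteEnd (e : Fin 6) : OnePoint ℂ := whiteVertex (whiteIndex e)

theorem ofReal_log_eq {t : ℝ} (h0 : 0 < t) : Complex.log (t : ℂ) = (Real.log t : ℂ) :=
  (Complex.ofReal_log h0.le).symm

theorem edgeLift_real (e : Fin 6) {t : ℝ} (h0 : 0 < t) (h1 : t < 1) :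
    edgeLift e (Real.log t) =
      whiteLift (whiteIndex e) (Real.log (1 - t) + (whiteNumber e : ℕ) * period) := by
  have := edgeLift_eq_whiteLift e (ofReal_mem_lens h0 h1)
  rw [ofReal_log_eq h0] at this
  rw [this, ← ofReal_log_eq (by linarith)]
  push_cast; rfl

theorem tendsto_one_sub : Tendsto (fun t : ℝ => 1 - t) (𝓝[<] 1) (𝓝[>] 0) := by
  refine tendsto_nhdsWithin_iff.2 ⟨?_, ?_⟩
  · have : ContinuousAt (fun t : ℝ => 1 - t) 1 := by fun_prop
    simpa [ContinuousAt] using this.tendsto.mono_left nhdsWithin_le_nhds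
  · filter_upwards [self_mem_nhdsWithin] with t ht
    simpa using ht

theorem tendsto_edgeLift_black (e : Fin 6) :
    Tendsto (fun t : ℝ => (edgeLift e (Real.log t) : OnePoint ℂ)) (𝓝[>] 0) (𝓝 (blackEnd e)) := by
  have := ((edgeLift e).tendsto (blackEndDegree_ne_zero e)).comp (tendsto_log_reAtBot 0)
  simpa [Function.comp_def] using this

theorem tendsto_edgeLift_white (e : Fin 6) :
    Tendsto (fun t : ℝ => (edgeLift e (Real.log t) : OnePoint ℂ)) (𝓝[<] 1) (𝓝 (whiteEnd e)) := by
  have := ((whiteLift (whiteIndex e)).tendsto (whiteDegree_ne_zero _)).comp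
    ((tendsto_log_reAtBot ((whiteNumber e : ℕ) * period)).comp tendsto_one_sub)
  refine this.congr' ?_
  filter_upwards [Ioo_mem_nhdsLT (show (0 : ℝ) < 1 by norm_num)] with t ht
  simp only [Function.comp_apply]
  rw [edgeLift_real e ht.1 ht.2]

theorem tendsto_circleValue_goldenRatio {s : Set ℝ} (hs : s ⊆ {Real.goldenRatio}ᶜ) :
    Tendsto circleValue (𝓝[s] Real.goldenRatio) (𝓝[<] 1) := by
  have hφ := Real.goldenRatio_pos
  refine tendsto_nhdsWithin_iff.2 ⟨?_, ?_⟩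
  · have := (continuousAt_circleValue hφ.le).tendsto.mono_left
      (nhdsWithin_le_nhds (s := s))
    rwa [circleValue_goldenRatio] at this
  · filter_upwards [self_mem_nhdsWithin, nhdsWithin_le_nhds (Ioi_mem_nhds hφ)] with y hy hy0
    exact circleValue_lt_one hy0 (hs hy)

/-- Edge 0 is the arc of the circle with `0 < y < φ`, which tends to `whiteMid`. Edge 5 is the arc
with `φ < y < 2` and reaches the same point from the other side. -/
theorem whiteIndex_zero : whiteIndex 0 = 0 := by
  apply whiteVertex_injective
  have hφ := Real.goldenRatio_pos
  have h1 := (tendsto_edgeLift_white 0).comp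
    (tendsto_circleValue_goldenRatio (s := Set.Iio _) fun y hy => ne_of_lt hy)
  have h2 := tendsto_circlePoint (y := Real.goldenRatio) (Set.Iio Real.goldenRatio)
  rw [circlePoint_goldenRatio] at h2
  refine tendsto_nhds_unique_of_eventuallyEq h1 h2 ?_
  filter_upwards [Ioo_mem_nhdsLT hφ] with y hy
  simp only [Function.comp_apply]
  rw [edgeLift_apply (by decide), centerLift_circle hy.1 hy.2]
  simp

theorem whiteIndex_five : whiteIndex 5 = 0 := by
  apply whiteVertex_injective
  have h1 := (tendsto_edgeLift_white 5).comp
    (tendsto_circleValue_goldenRatio (s := Set.Ioi _) fun y hy => ne_of_gt hy)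
  have h2 := tendsto_circlePoint (y := Real.goldenRatio) (Set.Ioi Real.goldenRatio)
  rw [circlePoint_goldenRatio] at h2
  refine tendsto_nhds_unique_of_eventuallyEq h1 h2 ?_
  filter_upwards [Ioo_mem_nhdsGT Real.goldenRatio_lt_two] with y hy
  simp only [Function.comp_apply]
  rw [edgeLift_five, tipLift_circle hy.1 hy.2]

/-- The reflection in the unit circle exchanges the `j`-th and the `k`-th edge at the black vertex
of degree 5 if `j + k = 5`, and so does it with the edges at the second white vertex of
degree 2. -/
theorem whiteIndex_of_add_eq_five {j k : Fin 6} (hj : (j : ℕ) < 5) (hk : (k : ℕ) < 5)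
    (hjk : (j : ℕ) + k = 5) (h : whiteIndex j = 1) : whiteIndex k = 1 := by
  apply whiteVertex_injective
  have hev : ∀ t : ℝ, 0 < t → t < 1 →
      edgeLift k (Real.log t) = circleReflection (edgeLift j (Real.log t)) := by
    intro t h0 h1
    rw [edgeLift_apply hj, edgeLift_apply hk,
      ← circleReflection_centerLift (ofReal_log_mem_leftHalfPlane h0 h1 _ (nat_mul_period_re _))]
    congr 1
    -- Conjugation turns `k` periods into `-k = j - 5` periods, and five periods do not matter at
    -- this vertex.
    have h2 : (starRingEnd ℂ) ((Real.log t : ℂ) + (k : ℕ) * period) =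
        ((Real.log t : ℂ) + (j : ℕ) * period) + (-1 : ℤ) * ((5 : ℕ) * period) := by
      have hp : (starRingEnd ℂ) period = -period := by
        simp [period, Complex.conj_ofNat]
      rw [map_add, map_mul, hp, Complex.conj_natCast, Complex.conj_ofReal, ← hjk]
      push_cast; ring
    rw [h2, centerLift.periodic_int _
      (ofReal_log_mem_leftHalfPlane h0 h1 _ (nat_mul_period_re _))]
  have h1 := tendsto_edgeLift_white k
  have h2 := tendsto_edgeLift_white j
  rw [whiteEnd, h] at h2
  have hcoe : Tendsto (fun t : ℝ => edgeLift j (Real.log t)) (𝓝[<] 1) (𝓝 (-whiteMid)) :=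
    (OnePoint.isOpenEmbedding_coe.isEmbedding.tendsto_nhds_iff).2 h2
  have hρ : ContinuousAt circleReflection (-whiteMid) := by
    unfold circleReflection
    refine ContinuousAt.inv₀ Complex.continuous_conj.continuousAt ?_
    simpa using whiteMid_ne_zero
  have hρw : circleReflection (-whiteMid) = -whiteMid := by
    rw [circleReflection, inv_eq_iff_eq_inv]
    refine eq_inv_of_mul_eq_one_left ?_
    rw [map_neg, neg_mul_neg]
    exact conj_whiteMid_mul
  have h3 : Tendsto (fun t : ℝ => (circleReflection (edgeLift j (Real.log t)) : OnePoint ℂ))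
      (𝓝[<] 1) (𝓝 ((-whiteMid : ℂ) : OnePoint ℂ)) := by
    refine (OnePoint.continuous_coe.tendsto _).comp ?_
    have := hρ.tendsto.comp hcoe
    rwa [hρw] at this
  refine tendsto_nhds_unique_of_eventuallyEq h1 h3 ?_
  filter_upwards [Ioo_mem_nhdsLT (show (0 : ℝ) < 1 by norm_num)] with t ht
  rw [hev t ht.1 ht.2]

/-! ### The cyclic order at the white ends. -/

/-- The edge `e'` follows the edge `e` counterclockwise around the white end of `e`. -/
def WhiteSucc (e e' : Fin 6) : Prop :=
  whiteIndex e' = whiteIndex e ∧ ∀ w ∈ lens,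
    edgeLift e' (Complex.log w) = whiteLift (whiteIndex e)
      (Complex.log (1 - w) + ((whiteNumber e : ℕ) + 1) * period)

/-- The two edges have the numbers 0 and 1 at this vertex, so the other edge is one period further,
up to the full period 2. -/
theorem whiteSucc_of_two {e e' : Fin 6} (hne : e ≠ e') (h : whiteIndex e' = whiteIndex e)
    (h2 : whiteDegree (whiteIndex e) = 2) : WhiteSucc e e' := by
  refine ⟨h, fun w hw => ?_⟩
  have hne' : (whiteNumber e' : ℕ) ≠ (whiteNumber e : ℕ) := by
    intro h3
    apply hne
    apply white_bijective.1
    refine Sigma.ext h.symm ?_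
    rw [Fin.heq_ext_iff (congrArg whiteDegree h.symm)]
    exact h3.symm
  have hl := (whiteNumber e).2
  have hl' := (whiteNumber e').2.trans_eq (congrArg whiteDegree h)
  rw [edgeLift_eq_whiteLift e' hw]
  have hmem := fun k : ℕ => add_mem_leftHalfPlane (log_mem_leftHalfPlane (one_sub_mem_lens hw)) _
    (nat_mul_period_re k)
  have key : ∀ (i : Fin 4) (k k' : ℕ), whiteDegree i = 2 → k < 2 → k' < 2 → k' ≠ k →
      whiteLift i (Complex.log (1 - w) + k' * period) =
        whiteLift i (Complex.log (1 - w) + (k + 1) * period) := by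
    intro i k k' hi hk hk' hkk
    have h4 : (k = 0 ∧ k' = 1) ∨ (k = 1 ∧ k' = 0) := by omega
    rcases h4 with ⟨rfl, rfl⟩ | ⟨rfl, rfl⟩
    · simp
    · have hc : ((whiteDegree i : ℕ) : ℂ) = 2 := by rw [hi]; norm_num
      rw [← (whiteLift i).periodic _ (hmem 0), hc]
      congr 1; push_cast; ring
  have h5 := key (whiteIndex e) (whiteNumber e) (whiteNumber e') h2 (by omega) (by omega) hne'
  rw [← h5]
  generalize ((whiteNumber e' : ℕ) : ℂ) = c
  rw [h]

theorem whiteSucc_of_one {e : Fin 6} (h : whiteDegree (whiteIndex e) = 1) : WhiteSucc e e := by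
  refine ⟨rfl, fun w hw => ?_⟩
  have hmem := fun k : ℕ => add_mem_leftHalfPlane (log_mem_leftHalfPlane (one_sub_mem_lens hw)) _
    (nat_mul_period_re k)
  have hc : ((whiteDegree (whiteIndex e) : ℕ) : ℂ) = 1 := by rw [h]; norm_num
  rw [edgeLift_eq_whiteLift e hw, ← (whiteLift (whiteIndex e)).periodic _ (hmem _), hc]
  congr 1; ring

/-! ### The faces -/

/-- The face of degree 5. -/
def bigDisk : PoleDisk (-1) 5 := exists_poleDisk_neg_one.some

/-- The face of degree 1. -/
def smallDisk : PoleDisk (-blackTip) 1 := exists_poleDisk_neg_blackTip.some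

/-- The poles. -/
def poleVertex : Fin 2 → OnePoint ℂ
  | 0 => ((-1 : ℂ) : OnePoint ℂ)
  | 1 => ((-blackTip : ℂ) : OnePoint ℂ)

theorem poleVertex_injective : Function.Injective poleVertex := by
  have := blackTip_ne_one
  intro i j h
  fin_cases i <;> fin_cases j <;> simp_all [poleVertex, eq_comm]

theorem disjoint_bigDisk_smallDisk : Disjoint bigDisk.face smallDisk.face :=
  bigDisk.disjoint_face smallDisk fun h => blackTip_ne_one (neg_injective h).symm

theorem notMem_unitSegment {w : ℂ} (hw : (w : OnePoint ℂ) ∉ unitSegment) {t : ℝ} (h0 : 0 ≤ t)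
    (h1 : t ≤ 1) : w ≠ t := by
  rintro rfl
  exact hw ⟨⟨t, h0, h1⟩, rfl⟩

/-- The value at a point off the graph is in the range of `poleModel`, unless it is `∞`; the lifts
at the two poles fill its fibre since `5 + 1 = 6`. -/
theorem union_face : bigDisk.face ∪ smallDisk.face = (belyiRat.onSphere ⁻¹' unitSegment)ᶜ := by
  refine Set.Subset.antisymm (Set.union_subset bigDisk.face_subset smallDisk.face_subset) ?_
  intro x hx
  by_cases hinf : belyiRat.onSphere x = OnePoint.infty
  · rcases onSphere_eq_infty_iff.1 hinf with rfl | rfl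
    · exact .inl bigDisk.vertex_mem_face
    · exact .inr smallDisk.vertex_mem_face
  · induction x using OnePoint.rec with
    | infty => exact absurd ⟨1, by rw [onSphere_infty]; simp⟩ hx
    | coe z =>
      have hd : belyiDen z ≠ 0 := fun h => hinf (onSphere_pole h)
      have hz : ((belyi z : ℂ) : OnePoint ℂ) ∉ unitSegment := by
        intro h
        apply hx
        rw [Set.mem_preimage, onSphere_coe hd]
        exact h
      obtain ⟨ζ, h0, h1, hζ⟩ := exists_poleModel_eq fun t => notMem_unitSegment hz
      have hs : Complex.log ζ ∈ leftHalfPlane := by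
        simp only [leftHalfPlane, Set.mem_ofPred_eq, Complex.log_re]
        exact Real.log_neg (norm_pos_iff.2 h0) h1
      -- `blackDegree` serves here for the poles, whose multiplicities are also 5 and 1.
      obtain ⟨i, k, hk, h⟩ := HalfPlaneLift.exists_apply_eq poleVertex_injective (m := blackDegree)
        (h := poleModel) (fun i => match i with | 0 => bigDisk.lift | 1 => smallDisk.lift)
        (by intro i; fin_cases i <;> simp [blackDegree]) (by simp [blackDegree])
        regular_poleModel injective_poleModel hs (x := z) (by rw [Complex.exp_log h0, hζ])
      have hmem := add_mem_leftHalfPlane hs _ (nat_mul_period_re k)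
      rw [h]
      match i with
      | 0 => exact .inl (bigDisk.lift_mem_face hmem)
      | 1 => exact .inr (smallDisk.lift_mem_face hmem)

theorem mem_bigDisk_iff {x : OnePoint ℂ} (hx : x ∈ (belyiRat.onSphere ⁻¹' unitSegment)ᶜ) :
    x ∈ bigDisk.face ↔ x ∉ smallDisk.face := by
  rw [← union_face] at hx
  have : x ∈ bigDisk.face → x ∉ smallDisk.face := fun h =>
    Set.disjoint_left.1 disjoint_bigDisk_smallDisk h
  rw [Set.mem_union] at hx
  tauto

/-- A connected set in the complement of the edges lies in one face. -/
theorem mem_smallDisk_iff {A : Set ℂ} (hA : IsPreconnected A) {g : ℂ → ℂ} (hg : ContinuousOn g A)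
    (hmem : ∀ s ∈ A, (g s : OnePoint ℂ) ∈ (belyiRat.onSphere ⁻¹' unitSegment)ᶜ) {s t : ℂ}
    (hs : s ∈ A) (ht : t ∈ A) :
    (g s : OnePoint ℂ) ∈ smallDisk.face ↔ (g t : OnePoint ℂ) ∈ smallDisk.face := by
  have himg : IsPreconnected ((fun s => (g s : OnePoint ℂ)) '' A) :=
    hA.image _ (OnePoint.continuous_coe.comp_continuousOn hg)
  have hsub : (fun s => (g s : OnePoint ℂ)) '' A ⊆ smallDisk.face ∪ bigDisk.face := by
    rw [Set.union_comm, union_face]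
    rintro _ ⟨s, hs, rfl⟩
    exact hmem s hs
  have key : ∀ s ∈ A, ∀ t ∈ A, (g s : OnePoint ℂ) ∈ smallDisk.face →
      (g t : OnePoint ℂ) ∈ smallDisk.face := by
    intro s hs t ht h
    exact himg.subset_left_of_subset_union smallDisk.isOpen_face bigDisk.isOpen_face
      disjoint_bigDisk_smallDisk.symm hsub ⟨_, ⟨s, hs, rfl⟩, h⟩ ⟨t, ht, rfl⟩
  exact ⟨key s hs t ht, key t ht s hs⟩

/-! ### Which face lies on which side of an edge. -/

/-- The strip of numbers in the left half-plane with imaginary part between `a` and `b`. -/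
def strip (a b : ℝ) : Set ℂ := {s | s.re < 0 ∧ a < s.im ∧ s.im < b}

theorem convex_strip (a b : ℝ) : Convex ℝ (strip a b) :=
  (convex_halfSpace_re_lt 0).inter ((convex_halfSpace_im_gt a).inter (convex_halfSpace_im_lt b))

theorem strip_subset (a b : ℝ) : strip a b ⊆ leftHalfPlane := fun _ hs => hs.1

theorem exp_ne_nonneg {s : ℂ} (h : ∀ n : ℤ, s.im ≠ n * (2 * Real.pi)) {t : ℝ} (ht : 0 ≤ t) :
    Complex.exp s ≠ t := by
  intro heq
  have ht' : 0 < t := by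
    refine lt_of_le_of_ne ht ?_
    rintro rfl
    exact Complex.exp_ne_zero s (by rw [heq, Complex.ofReal_zero])
  rw [← exp_ofReal_log ht', Complex.exp_eq_exp_iff_exists_int] at heq
  obtain ⟨n, hn⟩ := heq
  apply h n
  rw [hn]
  simp

theorem im_ne_of_mem_strip {s : ℂ} {a : ℤ} {c d : ℝ} (hc : a * (2 * Real.pi) ≤ c)
    (hd : d ≤ (a + 1) * (2 * Real.pi)) (hs : s ∈ strip c d) (n : ℤ) :
    s.im ≠ n * (2 * Real.pi) := by
  intro h
  have hpi : 0 < 2 * Real.pi := by positivity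
  obtain ⟨-, h1, h2⟩ := hs
  rw [h] at h1 h2
  have h3 : (a : ℝ) < n := lt_of_mul_lt_mul_right (hc.trans_lt h1) hpi.le
  have h4 : (n : ℝ) < a + 1 := lt_of_mul_lt_mul_right (h2.trans_le hd) hpi.le
  have h5 : a < n := by exact_mod_cast h3
  have h6 : n < a + 1 := by exact_mod_cast h4
  omega

theorem black_mem_compl {v : OnePoint ℂ} {m : ℕ} (L : HalfPlaneLift v m blackModel) {s : ℂ}
    (hs : s ∈ leftHalfPlane) (h : ∀ n : ℤ, s.im ≠ n * (2 * Real.pi)) :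
    (L s : OnePoint ℂ) ∈ (belyiRat.onSphere ⁻¹' unitSegment)ᶜ := by
  rintro ⟨t, ht⟩
  simp only at ht
  rw [onSphere_coe_of_ne_zero (L.belyi_mem regular_blackModel hs).1, L.belyi_apply s hs,
    OnePoint.coe_eq_coe, blackModel] at ht
  exact exp_ne_nonneg h t.2.1 ht.symm

theorem white_mem_compl {v : OnePoint ℂ} {m : ℕ} (L : HalfPlaneLift v m whiteModel) {s : ℂ}
    (hs : s ∈ leftHalfPlane) (h : ∀ n : ℤ, s.im ≠ n * (2 * Real.pi)) :
    (L s : OnePoint ℂ) ∈ (belyiRat.onSphere ⁻¹' unitSegment)ᶜ := by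
  rintro ⟨t, ht⟩
  simp only at ht
  rw [onSphere_coe_of_ne_zero (L.belyi_mem regular_whiteModel hs).1, L.belyi_apply s hs,
    OnePoint.coe_eq_coe, whiteModel] at ht
  refine exp_ne_nonneg h (t := 1 - t) (by linarith [t.2.2]) ?_
  push_cast
  linear_combination ht

theorem edge_strip (e : Fin 6) {c d : ℝ} (a : ℤ) (hc : a * (2 * Real.pi) ≤ c)
    (hd : d ≤ (a + 1) * (2 * Real.pi)) {s t : ℂ} (hs : s ∈ strip c d) (ht : t ∈ strip c d) :
    (edgeLift e s : OnePoint ℂ) ∈ smallDisk.face ↔ (edgeLift e t : OnePoint ℂ) ∈ smallDisk.face :=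
  mem_smallDisk_iff (convex_strip c d).isPreconnected
    ((edgeLift e).continuousOn.mono (strip_subset c d))
    (fun _ hs => black_mem_compl _ hs.1 (im_ne_of_mem_strip hc hd hs)) hs ht

/-- The right-hand side of the edge `e` belongs to the face of degree 1. -/
def RightSmall (e : Fin 6) : Prop := (edgeLift e (-1 - Complex.I) : OnePoint ℂ) ∈ smallDisk.face

/-- The left-hand side of the edge `e` belongs to the face of degree 1. -/
def LeftSmall (e : Fin 6) : Prop := (edgeLift e (-1 + Complex.I) : OnePoint ℂ) ∈ smallDisk.face

theorem right_mem_strip : -1 - Complex.I ∈ strip (-Real.pi) 0 := by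
  have := Real.pi_gt_three
  refine ⟨by simp, ?_, by simp⟩
  simp; linarith

theorem left_mem_strip : -1 + Complex.I ∈ strip 0 Real.pi := by
  have := Real.pi_gt_three
  refine ⟨by simp, by simp, ?_⟩
  simp; linarith

theorem edge_right {e : Fin 6} {s : ℂ} (hs : s ∈ strip (-Real.pi) 0) :
    (edgeLift e s : OnePoint ℂ) ∈ smallDisk.face ↔ RightSmall e :=
  edge_strip e (-1) (by push_cast; linarith [Real.pi_pos]) (by simp) hs right_mem_strip

theorem edge_left {e : Fin 6} {s : ℂ} (hs : s ∈ strip 0 Real.pi) :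
    (edgeLift e s : OnePoint ℂ) ∈ smallDisk.face ↔ LeftSmall e :=
  edge_strip e 0 (by simp) (by simp; linarith [Real.pi_pos]) hs left_mem_strip

/-- Between consecutive edges at a black vertex there is one sector. In the half-plane it is the
strip `0 < im < 2π`, where `exp` avoids the positive reals, so no edge is crossed. -/
theorem leftSmall_iff_rightSmall (e : Fin 6) : LeftSmall e ↔ RightSmall (modelσ e) := by
  have hpi := Real.pi_gt_three
  rw [LeftSmall, RightSmall, edgeLift_modelσ e right_mem_strip.1]
  refine edge_strip e (c := 0) (d := 2 * Real.pi) 0 (by simp) (by simp) ?_ ?_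
  · exact ⟨left_mem_strip.1, left_mem_strip.2.1, by linarith [left_mem_strip.2.2]⟩
  · refine ⟨by simp, ?_, ?_⟩ <;> simp
    linarith

/-- This is the sector between consecutive edges at a white vertex. Since `1 - w` reverses the
direction of the edge, the right-hand side of `e` is its counterclockwise side there. -/
theorem WhiteSucc.rightSmall_iff {e e' : Fin 6} (h : WhiteSucc e e') :
    RightSmall e ↔ LeftSmall e' := by
  have hpi := Real.pi_pos
  -- Any point of the lens below the real axis would do; its conjugate tests the left-hand side of
  -- the next edge.
  set w : ℂ := 1 / 2 - Complex.I / 4 with hw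
  have hnorm : ∀ z : ℂ, z.re = 1 / 2 → z.im ^ 2 = 1 / 16 → ‖z‖ < 1 := by
    intro z h1 h2
    rw [← sq_lt_one_iff₀ (norm_nonneg _), ← Complex.normSq_eq_norm_sq, Complex.normSq_apply, h1]
    nlinarith
  have him : w.im = -(1 / 4) := by simp [hw]
  have hre : w.re = 1 / 2 := by simp [hw]
  have hlens : w ∈ lens :=
    ⟨hnorm _ hre (by rw [him]; norm_num), hnorm _ (by simp [hre]; norm_num) (by simp [him]; norm_num)⟩
  set w' : ℂ := (starRingEnd ℂ) w with hw'
  have hlens' : w' ∈ lens :=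
    ⟨hnorm _ (by simpa [hw'] using hre) (by rw [hw', Complex.conj_im, him]; norm_num),
      hnorm _ (by simp [hw', hre]; norm_num) (by simp [hw', him]; norm_num)⟩
  have harg : ∀ z : ℂ, 0 < z.im → 0 < z.arg ∧ z.arg < Real.pi := fun z hz =>
    ⟨lt_of_le_of_ne (Complex.arg_nonneg_iff.2 hz.le) fun h0 => by
      have := (Complex.arg_eq_zero_iff.1 h0.symm).2; exact hz.ne' this,
      lt_of_le_of_ne (Complex.arg_le_pi z) fun h0 => by
      have := (Complex.arg_eq_pi_iff.1 h0).2; exact hz.ne' this⟩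
  have harg' : ∀ z : ℂ, z.im < 0 → -Real.pi < z.arg ∧ z.arg < 0 := fun z hz =>
    ⟨Complex.neg_pi_lt_arg z, Complex.arg_neg_iff.2 hz⟩
  have h1 : Complex.log w ∈ strip (-Real.pi) 0 :=
    ⟨log_mem_leftHalfPlane hlens, by rw [Complex.log_im]; exact (harg' w (by rw [him]; norm_num)).1,
      by rw [Complex.log_im]; exact (harg' w (by rw [him]; norm_num)).2⟩
  have h1' : Complex.log w' ∈ strip 0 Real.pi := by
    have := harg w' (by rw [hw', Complex.conj_im, him]; norm_num)
    exact ⟨log_mem_leftHalfPlane hlens', by rw [Complex.log_im]; exact this.1,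
      by rw [Complex.log_im]; exact this.2⟩
  rw [← edge_right h1, ← edge_left h1', edgeLift_eq_whiteLift e hlens, h.2 w' hlens']
  set k : ℕ := (whiteNumber e : ℕ)
  -- The logarithm of `1 - w` has argument in `(0, π)` and is shifted by `k` periods, that of `1 -
  -- w'` has argument in `(-π, 0)` and is shifted by `k + 1`; both land in the same strip.
  refine mem_smallDisk_iff (g := whiteLift (whiteIndex e))
    (convex_strip (k * (2 * Real.pi)) ((k + 1) * (2 * Real.pi))).isPreconnected
    ((whiteLift _).continuousOn.mono (strip_subset _ _))
    (fun s hs => white_mem_compl _ hs.1 (im_ne_of_mem_strip (a := k) (by simp) (by simp) hs)) ?_ ?_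
  · have h2 := harg (1 - w) (by simp [him])
    refine ⟨add_mem_leftHalfPlane (log_mem_leftHalfPlane (one_sub_mem_lens hlens)) _
      (nat_mul_period_re k), ?_, ?_⟩
    · simp [Complex.log_im, h2.1]
    · simp [Complex.log_im]; linarith [h2.2]
  · have h2 := harg' (1 - w') (by simp [hw', him])
    have hk : ((k : ℂ) + 1) = ((k + 1 : ℕ) : ℂ) := by push_cast; rfl
    rw [hk]
    refine ⟨add_mem_leftHalfPlane (log_mem_leftHalfPlane (one_sub_mem_lens hlens')) _
      (nat_mul_period_re _), ?_, ?_⟩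
    · simp [Complex.log_im]; linarith [h2.1]
    · simp [Complex.log_im, h2.2]

/-- The small face is mapped bijectively to the complement of the segment, its pole being simple. So
it contains exactly one of the six points over a value in the lower half-plane. -/
theorem existsUnique_rightSmall : ∃! e, RightSmall e := by
  set c : ℂ := Complex.exp (-1 - Complex.I) with hc
  have hmem : -1 - Complex.I ∈ leftHalfPlane := right_mem_strip.1
  have him := im_ne_of_mem_strip (a := -1) (by push_cast; linarith [Real.pi_pos]) (by simp)
    right_mem_strip
  obtain ⟨ζ, h0, h1, hζ⟩ := exists_poleModel_eq (w := c) fun t ht _ => exp_ne_nonneg him ht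
  have hs : Complex.log ζ ∈ leftHalfPlane := by
    simp only [leftHalfPlane, Set.mem_ofPred_eq, Complex.log_re]
    exact Real.log_neg (norm_pos_iff.2 h0) h1
  have hb : belyi (smallDisk.lift (Complex.log ζ)) = c := by
    rw [smallDisk.lift.belyi_apply _ hs, Complex.exp_log h0, hζ]
  obtain ⟨e, he⟩ := exists_edgeLift_eq hmem hb
  refine ⟨e, ?_, ?_⟩
  · change (edgeLift e (-1 - Complex.I) : OnePoint ℂ) ∈ smallDisk.face
    rw [← he]
    exact smallDisk.lift_mem_face hs
  · intro e' he'
    have hb' : belyi (edgeLift e' (-1 - Complex.I)) = c := (edgeLift e').belyi_apply _ hmem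
    rcases smallDisk.mem_face he' with h | ⟨s, hs', h⟩
    · exfalso
      have h2 := (edgeLift e').belyi_mem regular_blackModel hmem
      rw [OnePoint.coe_injective h] at h2
      exact h2.1 (belyi_eq_zero.2 (.inr smallDisk.pole))
    · have h := OnePoint.coe_injective h
      rw [h, smallDisk.lift.belyi_apply _ hs', ← hζ] at hb'
      have h3 := injective_poleModel _ _ (Complex.exp_ne_zero s) (norm_exp_lt_one hs') h0 h1 hb'
      rw [← Complex.exp_log h0] at h3
      obtain ⟨n, hn⟩ := Complex.exp_eq_exp_iff_exists_int.1 h3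
      apply edgeLift_injective hmem
      rw [h, ← he, hn]
      have := smallDisk.lift.periodic_int n hs
      rw [← this]
      simp [period]

/-- Edges 0 and 5 fill the first double vertex. The two edges at the second one are among 1, 2, 3, 4
and form a pair stable under `j ↦ 5 - j`. -/
theorem whiteIndex_dichotomy :
    (whiteIndex 1 = 1 ∧ whiteIndex 4 = 1 ∧ whiteDegree (whiteIndex 2) = 1 ∧
      whiteDegree (whiteIndex 3) = 1) ∨
    (whiteIndex 2 = 1 ∧ whiteIndex 3 = 1 ∧ whiteDegree (whiteIndex 1) = 1 ∧
      whiteDegree (whiteIndex 4) = 1) := by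
  have h14 : whiteIndex 1 = 1 ↔ whiteIndex 4 = 1 :=
    ⟨whiteIndex_of_add_eq_five (by decide) (by decide) rfl,
      whiteIndex_of_add_eq_five (by decide) (by decide) rfl⟩
  have h23 : whiteIndex 2 = 1 ↔ whiteIndex 3 = 1 :=
    ⟨whiteIndex_of_add_eq_five (by decide) (by decide) rfl,
      whiteIndex_of_add_eq_five (by decide) (by decide) rfl⟩
  have hc := card_whiteIndex
  have hsum : ∀ i : Fin 4, (Finset.univ.filter fun e => whiteIndex e = i).card =
      ∑ e, if whiteIndex e = i then 1 else 0 := fun i => by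
    rw [Finset.card_filter]
  have hc0 := hc 0
  have hc1 := hc 1
  rw [hsum] at hc0 hc1
  simp only [Fin.sum_univ_six, whiteIndex_zero, whiteIndex_five] at hc0 hc1
  revert h14 h23 hc0 hc1
  generalize whiteIndex 1 = a
  generalize whiteIndex 2 = b
  generalize whiteIndex 3 = c
  generalize whiteIndex 4 = d
  revert a b c d
  decide

theorem whiteSucc_zero_five : WhiteSucc 0 5 ∧ WhiteSucc 5 0 :=
  ⟨whiteSucc_of_two (by decide) (by rw [whiteIndex_zero, whiteIndex_five])
    (by rw [whiteIndex_zero]; rfl),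
   whiteSucc_of_two (by decide) (by rw [whiteIndex_zero, whiteIndex_five])
    (by rw [whiteIndex_five]; rfl)⟩

/-- The small face lies to the right of `e`, hence to the left of `a e`, hence to the right of the
next edge at the black vertex; uniqueness makes this edge `e` again. -/
theorem RightSmall.fixed {a : Fin 6 → Fin 6} (ha : ∀ e, WhiteSucc e (a e)) {e : Fin 6}
    (he : RightSmall e) : modelσ (a e) = e := by
  have h := (leftSmall_iff_rightSmall _).1 ((ha e).rightSmall_iff.1 he)
  exact existsUnique_rightSmall.unique h he

theorem whiteIndex_values : whiteIndex 2 = 1 ∧ whiteIndex 3 = 1 ∧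
    whiteDegree (whiteIndex 1) = 1 ∧ whiteDegree (whiteIndex 4) = 1 := by
  rcases whiteIndex_dichotomy with ⟨h1, h4, h2, h3⟩ | h
  · exfalso
    -- In the rejected case the white rotation would be `(0 5)(1 4)`, and its product with `modelσ`
    -- fixes no edge.
    have ha : ∀ e : Fin 6, WhiteSucc e ((![5, 4, 2, 3, 1, 0] : Fin 6 → Fin 6) e) := by
      intro e
      fin_cases e
      · exact whiteSucc_zero_five.1
      · exact whiteSucc_of_two (by decide) (h4.trans h1.symm) (congrArg whiteDegree h1)
      · exact whiteSucc_of_one h2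
      · exact whiteSucc_of_one h3
      · exact whiteSucc_of_two (by decide) (h1.trans h4.symm) (congrArg whiteDegree h4)
      · exact whiteSucc_zero_five.2
    obtain ⟨e, he⟩ := existsUnique_rightSmall.exists
    have := RightSmall.fixed ha he
    revert this
    clear he
    revert e
    decide
  · exact h

theorem whiteSucc_modelα (e : Fin 6) : WhiteSucc e (modelα e) := by
  obtain ⟨h2, h3, h1, h4⟩ := whiteIndex_values
  fin_cases e
  · exact whiteSucc_zero_five.1
  · exact whiteSucc_of_one h1
  · exact whiteSucc_of_two (by decide) (h3.trans h2.symm) (congrArg whiteDegree h2)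
  · exact whiteSucc_of_two (by decide) (h2.trans h3.symm) (congrArg whiteDegree h3)
  · exact whiteSucc_of_one h4
  · exact whiteSucc_zero_five.2

theorem rightSmall_iff {e : Fin 6} : RightSmall e ↔ e = 3 := by
  obtain ⟨e', he', huniq⟩ := existsUnique_rightSmall
  have h3 : e' = 3 := by
    have := RightSmall.fixed whiteSucc_modelα he'
    revert this
    clear huniq he'
    revert e'
    decide
  subst h3
  exact ⟨huniq e, by rintro rfl; assumption⟩

/-! ### The drawing of the model dessin -/

/-- The cycles of a permutation are the fibres of an invariant function that separates them. -/
theorem Equiv.Perm.sameCycle_iff_of_invariant {A B : Type*} [Finite A] {f : Equiv.Perm A}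
    {c : A → B} (hc : ∀ x, c (f x) = c x) (h : ∀ x y, c x = c y → ∃ n : ℕ, (f ^ n) x = y) {x y : A} :
    f.SameCycle x y ↔ c x = c y := by
  constructor
  · intro hxy
    obtain ⟨n, -, rfl⟩ := hxy.exists_pow_eq'
    clear hxy
    induction n with
    | zero => rfl
    | succ n ih => rw [pow_succ', Equiv.Perm.mul_apply, hc, ← ih]
  · intro hxy
    obtain ⟨n, hn⟩ := h x y hxy
    exact ⟨n, by simpa using hn⟩

theorem sameCycle_modelσ {e e' : Fin 6} :
    modelσ.SameCycle e e' ↔ (e = 5 ↔ e' = 5) := by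
  have : ∀ x y : Fin 6, decide (x = 5) = decide (y = 5) → ∃ n ∈ Finset.range 5, (modelσ ^ n) x = y := by
    decide
  rw [Equiv.Perm.sameCycle_iff_of_invariant (c := fun x : Fin 6 => decide (x = 5)) (by decide)
    fun x y h => (this x y h).imp fun n hn => hn.2]
  simp

theorem sameCycle_modelα {e e' : Fin 6} :
    modelα.SameCycle e e' ↔
      (![0, 1, 2, 2, 3, 0] : Fin 6 → Fin 4) e = (![0, 1, 2, 2, 3, 0] : Fin 6 → Fin 4) e' := by
  have : ∀ x y : Fin 6, (![0, 1, 2, 2, 3, 0] : Fin 6 → Fin 4) x =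
      (![0, 1, 2, 2, 3, 0] : Fin 6 → Fin 4) y → ∃ n ∈ Finset.range 2, (modelα ^ n) x = y := by
    decide
  exact Equiv.Perm.sameCycle_iff_of_invariant (by decide)
    fun x y h => (this x y h).imp fun n hn => hn.2

theorem sameCycle_modelFace {e e' : Fin 6} :
    (modelσ * modelα)⁻¹.SameCycle e e' ↔ (e = 3 ↔ e' = 3) := by
  have : ∀ x y : Fin 6, decide (x = 3) = decide (y = 3) →
      ∃ n ∈ Finset.range 5, ((modelσ * modelα) ^ n) x = y := by
    decide
  rw [Equiv.Perm.sameCycle_inv, Equiv.Perm.sameCycle_iff_of_invariant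
    (c := fun x : Fin 6 => decide (x = 3)) (by decide)
    fun x y h => (this x y h).imp fun n hn => hn.2]
  simp

theorem blackEnd_eq_iff {e e' : Fin 6} : blackEnd e = blackEnd e' ↔ (e = 5 ↔ e' = 5) := by
  have hne : ((1 : ℂ) : OnePoint ℂ) ≠ (blackTip : OnePoint ℂ) := fun h =>
    blackTip_ne_one (OnePoint.coe_injective h).symm
  have hne' := hne.symm
  fin_cases e <;> fin_cases e' <;> simp [blackEnd, hne, hne']

/-- Which of the edges 1 and 4 ends at 0 and which at `∞` is left undecided; only their ends being
different matters. -/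
theorem whiteIndex_eq_iff {e e' : Fin 6} : whiteIndex e = whiteIndex e' ↔
    (![0, 1, 2, 2, 3, 0] : Fin 6 → Fin 4) e = (![0, 1, 2, 2, 3, 0] : Fin 6 → Fin 4) e' := by
  obtain ⟨h2, h3, h1, h4⟩ := whiteIndex_values
  have hc := card_whiteIndex 2
  rw [Finset.card_filter, Fin.sum_univ_six, whiteIndex_zero, whiteIndex_five, h2, h3] at hc
  have key : (whiteIndex 1 = 2 ∧ whiteIndex 4 = 3) ∨ (whiteIndex 1 = 3 ∧ whiteIndex 4 = 2) := by
    revert h1 h4 hc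
    generalize whiteIndex 1 = a
    generalize whiteIndex 4 = d
    revert a d
    decide
  have h0 := whiteIndex_zero
  have h5 := whiteIndex_five
  rcases key with ⟨h1', h4'⟩ | ⟨h1', h4'⟩ <;> fin_cases e <;> fin_cases e' <;>
    simp [h0, h1', h2, h3, h4', h5]

theorem whiteEnd_eq_iff {e e' : Fin 6} : whiteEnd e = whiteEnd e' ↔ modelα.SameCycle e e' := by
  rw [sameCycle_modelα, ← whiteIndex_eq_iff, whiteEnd, whiteEnd, whiteVertex_injective.eq_iff]

theorem mult_blackEnd (e : Fin 6) : belyiRat.mult (blackEnd e) = blackEndDegree e := by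
  match e with
  | 0 | 1 | 2 | 3 | 4 => exact mult_one
  | 5 => exact mult_blackTip

theorem mult_whiteEnd (e : Fin 6) : belyiRat.mult (whiteEnd e) = whiteDegree (whiteIndex e) := by
  unfold whiteEnd
  match whiteIndex e with
  | 0 => exact mult_whiteMid
  | 1 => exact mult_neg_whiteMid
  | 2 => exact mult_zero
  | 3 => exact mult_infty

theorem ncard_blackEnd (e : Fin 6) : {e' | blackEnd e' = blackEnd e}.ncard = blackEndDegree e := by
  simp only [blackEnd_eq_iff]
  rw [Set.ncard_eq_toFinset_card']
  revert e
  decide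

theorem ncard_whiteEnd (e : Fin 6) :
    {e' | whiteEnd e' = whiteEnd e}.ncard = whiteDegree (whiteIndex e) := by
  rw [← card_whiteIndex, ← Set.ncard_coe_finset]
  simp [whiteEnd, whiteVertex_injective.eq_iff]

theorem onSphere_blackEnd (e : Fin 6) : belyiRat.onSphere (blackEnd e) = ((0 : ℂ) : OnePoint ℂ) := by
  rw [onSphere_eq_zero_iff]
  match e with
  | 0 | 1 | 2 | 3 | 4 => exact .inl rfl
  | 5 => exact .inr rfl

theorem onSphere_whiteVertex (i : Fin 4) :
    belyiRat.onSphere (whiteVertex i) = ((1 : ℂ) : OnePoint ℂ) := by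
  rw [onSphere_eq_one_iff]
  match i with
  | 0 => exact .inl rfl
  | 1 => exact .inr (.inl rfl)
  | 2 => exact .inr (.inr (.inl rfl))
  | 3 => exact .inr (.inr (.inr rfl))

theorem exists_blackEnd {x : OnePoint ℂ} (h : belyiRat.onSphere x = ((0 : ℂ) : OnePoint ℂ)) :
    ∃ e, x = blackEnd e := by
  rcases onSphere_eq_zero_iff.1 h with h | h
  exacts [⟨0, h⟩, ⟨5, h⟩]

theorem exists_whiteEnd {x : OnePoint ℂ} (h : belyiRat.onSphere x = ((1 : ℂ) : OnePoint ℂ)) :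
    ∃ e, x = whiteEnd e := by
  obtain ⟨i, rfl⟩ : ∃ i, x = whiteVertex i := by
    rcases onSphere_eq_one_iff.1 h with h | h | h | h
    exacts [⟨0, h⟩, ⟨1, h⟩, ⟨2, h⟩, ⟨3, h⟩]
  have hc := card_whiteIndex i
  obtain ⟨e, he⟩ := Finset.card_pos.1 (hc ▸ Nat.pos_of_ne_zero (whiteDegree_ne_zero i))
  exact ⟨e, by rw [whiteEnd, (Finset.mem_filter.1 he).2]⟩

/-! ### The arcs of the drawing and the faces beside them. -/

/-- The points of an edge, without its ends. -/
def openArc (e : Fin 6) (t : ℝ) : OnePoint ℂ := (edgeLift e (Real.log t) : OnePoint ℂ)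

theorem log_mem {t : ℝ} (h0 : 0 < t) (h1 : t < 1) : (Real.log t : ℂ) ∈ leftHalfPlane := by
  simpa using ofReal_log_mem_leftHalfPlane h0 h1 0 (by simp)

theorem continuousOn_openArc (e : Fin 6) : ContinuousOn (openArc e) (Set.Ioo 0 1) := by
  refine OnePoint.continuous_coe.comp_continuousOn ((edgeLift e).continuousOn.comp
    (Complex.continuous_ofReal.comp_continuousOn
      (Real.continuousOn_log.mono fun t ht => ?_)) fun t ht => log_mem ht.1 ht.2)
  exact ne_of_gt ht.1

/-- An edge, as a curve parametrized by the value of the Belyi function. -/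
def edgeArc (e : Fin 6) : C(unitInterval, OnePoint ℂ) where
  toFun t := extendFrom (Set.Ioo 0 1) (openArc e) t
  continuous_toFun := (continuousOn_Icc_extendFrom_Ioo (continuousOn_openArc e)
    (tendsto_edgeLift_black e) (tendsto_edgeLift_white e)).domRestrict

theorem edgeArc_zero (e : Fin 6) : edgeArc e 0 = blackEnd e :=
  eq_lim_at_left_extendFrom_Ioo zero_lt_one (tendsto_edgeLift_black e)

theorem edgeArc_one (e : Fin 6) : edgeArc e 1 = whiteEnd e :=
  eq_lim_at_right_extendFrom_Ioo zero_lt_one (tendsto_edgeLift_white e)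

theorem edgeArc_apply (e : Fin 6) {t : unitInterval} (h0 : 0 < t) (h1 : t < 1) :
    edgeArc e t = (edgeLift e (Real.log t) : OnePoint ℂ) :=
  extendFrom_extends (continuousOn_openArc e) (t : ℝ) ⟨h0, h1⟩

theorem belyi_edgeLift_log (e : Fin 6) {t : ℝ} (h0 : 0 < t) (h1 : t < 1) :
    belyi (edgeLift e (Real.log t)) = t := by
  rw [(edgeLift e).belyi_apply _ (log_mem h0 h1), exp_ofReal_log h0, blackModel]

theorem onSphere_edgeArc (e : Fin 6) (t : unitInterval) :
    belyiRat.onSphere (edgeArc e t) = (((t : ℝ) : ℂ) : OnePoint ℂ) := by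
  rcases eq_or_lt_of_le (show 0 ≤ t from t.2.1) with rfl | h0
  · rw [edgeArc_zero, onSphere_blackEnd]; simp
  rcases eq_or_lt_of_le (show t ≤ 1 from t.2.2) with rfl | h1
  · rw [edgeArc_one, whiteEnd, onSphere_whiteVertex]; simp
  rw [edgeArc_apply e h0 h1, onSphere_coe_of_ne_zero
    ((edgeLift e).belyi_mem regular_blackModel (log_mem h0 h1)).1, belyi_edgeLift_log e h0 h1]

theorem iUnion_edgeArc :
    ⋃ e, Set.range (edgeArc e) = belyiRat.onSphere ⁻¹' unitSegment := by
  apply Set.Subset.antisymm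
  · refine Set.iUnion_subset fun e => ?_
    rintro _ ⟨t, rfl⟩
    exact ⟨t, (onSphere_edgeArc e t).symm⟩
  · rintro x ⟨t, ht⟩
    simp only at ht
    rw [Set.mem_iUnion]
    rcases eq_or_lt_of_le (show 0 ≤ t from t.2.1) with rfl | h0
    · obtain ⟨e, rfl⟩ := exists_blackEnd (x := x) (by rw [← ht]; simp)
      exact ⟨e, 0, edgeArc_zero e⟩
    rcases eq_or_lt_of_le (show t ≤ 1 from t.2.2) with rfl | h1
    · obtain ⟨e, rfl⟩ := exists_whiteEnd (x := x) (by rw [← ht]; simp)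
      exact ⟨e, 1, edgeArc_one e⟩
    induction x using OnePoint.rec with
    | infty =>
      rw [onSphere_infty, OnePoint.coe_eq_coe] at ht
      exact absurd (Complex.ofReal_eq_one.1 ht) (ne_of_lt h1)
    | coe z =>
      obtain ⟨-, hz⟩ := onSphere_eq_coe_iff.1 ht.symm
      rw [← exp_ofReal_log h0] at hz
      obtain ⟨e, he⟩ := exists_edgeLift_eq (log_mem h0 h1) hz
      exact ⟨e, t, by rw [edgeArc_apply e h0 h1, he]⟩

theorem tendsto_coe_zero :
    Tendsto (fun t : unitInterval => (t : ℝ)) (𝓝[>] 0) (𝓝[>] 0) := by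
  refine tendsto_nhdsWithin_iff.2 ⟨?_, ?_⟩
  · exact (continuous_subtype_val.tendsto (0 : unitInterval)).mono_left nhdsWithin_le_nhds
  · filter_upwards [self_mem_nhdsWithin] with t ht using ht

theorem tendsto_coe_one :
    Tendsto (fun t : unitInterval => (t : ℝ)) (𝓝[<] 1) (𝓝[<] 1) := by
  refine tendsto_nhdsWithin_iff.2 ⟨?_, ?_⟩
  · exact (continuous_subtype_val.tendsto (1 : unitInterval)).mono_left nhdsWithin_le_nhds
  · filter_upwards [self_mem_nhdsWithin] with t ht using ht

theorem tendsto_black (e : Fin 6) : Tendsto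
    (fun t => localCoord (edgeArc e 0) (edgeArc (modelσ e) t) /
      localCoord (edgeArc e 0) (edgeArc e t)) (𝓝[>] 0)
    (𝓝 (Complex.exp (2 * Real.pi * Complex.I / belyiRat.mult (edgeArc e 0)))) := by
  rw [edgeArc_zero, mult_blackEnd]
  have h := ((edgeLift e).tendsto_localCoord_div 1).comp
    ((tendsto_log_reAtBot 0).comp tendsto_coe_zero)
  simp only [Int.cast_one, one_mul, period] at h
  refine h.congr' ?_
  filter_upwards [self_mem_nhdsWithin, nhdsWithin_le_nhds
    (Iio_mem_nhds (show (0 : unitInterval) < 1 from zero_lt_one))] with t h0 h1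
  simp only [Function.comp_apply, add_zero]
  rw [edgeArc_apply _ h0 h1, edgeArc_apply _ h0 h1, edgeLift_modelσ e (log_mem h0 h1), period]

theorem tendsto_white (e : Fin 6) : Tendsto
    (fun t => localCoord (edgeArc e 1) (edgeArc (modelα e) t) /
      localCoord (edgeArc e 1) (edgeArc e t)) (𝓝[<] 1)
    (𝓝 (Complex.exp (2 * Real.pi * Complex.I / belyiRat.mult (edgeArc e 1)))) := by
  rw [edgeArc_one, mult_whiteEnd]
  have h := ((whiteLift (whiteIndex e)).tendsto_localCoord_div 1).comp
    ((tendsto_log_reAtBot ((whiteNumber e : ℕ) * period)).comp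
      (tendsto_one_sub.comp tendsto_coe_one))
  simp only [Int.cast_one, one_mul] at h
  refine h.congr' ?_
  filter_upwards [self_mem_nhdsWithin, nhdsWithin_le_nhds
    (Ioi_mem_nhds (show (0 : unitInterval) < 1 from zero_lt_one))] with t h1 h0
  have h3 := (whiteSucc_modelα e).2 _ (ofReal_mem_lens h0 h1)
  have h4 : (1 : ℂ) - ((t : ℝ) : ℂ) = ((1 - t : ℝ) : ℂ) := by push_cast; rfl
  have h5 : (0 : ℝ) < 1 - t := sub_pos.2 h1
  rw [ofReal_log_eq h0, h4, ofReal_log_eq h5] at h3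
  simp only [Function.comp_apply]
  rw [edgeArc_apply _ h0 h1, edgeArc_apply _ h0 h1, h3, edgeLift_real e h0 h1, add_mul, one_mul,
    add_assoc]
  rfl

/-- The face to the right of an edge. -/
def edgeFace (e : Fin 6) : Set (OnePoint ℂ) := if e = 3 then smallDisk.face else bigDisk.face

theorem edgeLift_mem_edgeFace (e : Fin 6) {s : ℂ} (hs : s ∈ strip (-Real.pi) 0) :
    (edgeLift e s : OnePoint ℂ) ∈ edgeFace e := by
  have h := (edge_right (e := e) hs).trans rightSmall_iff
  unfold edgeFace
  split_ifs with he
  · exact h.2 he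
  · rw [mem_bigDisk_iff (black_mem_compl _ hs.1 (im_ne_of_mem_strip (a := -1)
      (by push_cast; linarith [Real.pi_pos]) (by simp) hs)), h]
    exact he

/-- Near an interior point of an edge, the edge's lift inverts the Belyi function. -/
theorem eventually_eq_edgeLift (e : Fin 6) {t : ℝ} (h0 : 0 < t) (h1 : t < 1) :
    ∀ᶠ x in 𝓝 (edgeLift e (Real.log t)), Complex.log (belyi x) ∈ leftHalfPlane ∧
      x = edgeLift e (Complex.log (belyi x)) := by
  have hb := belyi_edgeLift_log e h0 h1
  have hmem := log_mem h0 h1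
  have hreg := (edgeLift e).belyi_mem regular_blackModel hmem
  set z := edgeLift e (Real.log t) with hz
  obtain ⟨V, hV, hinj⟩ := exists_nhds_injOn_belyi hreg
  have hcb : ContinuousAt belyi z := continuousAt_belyi (belyiDen_ne_zero hreg.1)
  have hclog : ContinuousAt (fun x => Complex.log (belyi x)) z :=
    hcb.clog (by rw [hb]; exact .inl (by simpa using h0))
  have hval : Complex.log (belyi z) = (Real.log t : ℂ) := by rw [hb, ofReal_log_eq h0]
  have hopen : IsOpen leftHalfPlane := isOpen_lt Complex.continuous_re continuous_const
  have hlift : ContinuousAt (fun x => edgeLift e (Complex.log (belyi x))) z := by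
    refine ContinuousAt.comp (g := edgeLift e) ?_ hclog
    rw [hval]
    exact (edgeLift e).continuousOn.continuousAt (hopen.mem_nhds hmem)
  have hV' : V ∈ 𝓝 (edgeLift e (Complex.log (belyi z))) := by rw [hval, ← hz]; exact hV
  filter_upwards [hV, hlift.preimage_mem_nhds hV',
    hclog.preimage_mem_nhds (by rw [hval]; exact hopen.mem_nhds hmem),
    hcb.preimage_mem_nhds (isOpen_ne.mem_nhds hreg.1)] with x hx hx' hx2 hx3
  refine ⟨hx2, hinj hx hx' ?_⟩
  rw [(edgeLift e).belyi_apply _ hx2, Complex.exp_log hx3, blackModel]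

/-- Near the edge, `x` is the lift of `log (belyi x)`, and a negative imaginary part of the value
puts this logarithm into the strip on the right-hand side. -/
theorem eventually_mem_edgeFace (e : Fin 6) {t : unitInterval} (h0 : 0 < t) (h1 : t < 1) :
    ∀ᶠ x in 𝓝 (edgeArc e t), (∃ c : ℂ, belyiRat.onSphere x = c ∧ c.im < 0) → x ∈ edgeFace e := by
  rw [edgeArc_apply e h0 h1, OnePoint.nhds_coe_eq, eventually_map]
  filter_upwards [eventually_eq_edgeLift e (t := t) h0 h1] with x hx
  rintro ⟨c, hc, him⟩
  obtain ⟨-, rfl⟩ := onSphere_eq_coe_iff.1 hc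
  rw [hx.2]
  refine edgeLift_mem_edgeFace e ⟨hx.1, ?_, ?_⟩
  · rw [Complex.log_im]; exact Complex.neg_pi_lt_arg _
  · rw [Complex.log_im]; exact Complex.arg_neg_iff.2 him

theorem ncard_face (e : Fin 6) :
    {e' | (modelσ * modelα)⁻¹.SameCycle e e'}.ncard = if e = 3 then 1 else 5 := by
  simp only [sameCycle_modelFace]
  rw [Set.ncard_eq_toFinset_card']
  revert e
  decide

/-- The quotient dessin, with the edges numbered. -/
def modelDessin : Dessin (Fin 6) where
  σ := modelσ
  α := modelα
  finite := inferInstance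
  nonempty := ⟨0⟩
  transitive := by
    have hσ : modelσ ∈ Subgroup.closure {modelσ, modelα} := Subgroup.subset_closure (by simp)
    have hα : modelα ∈ Subgroup.closure {modelσ, modelα} := Subgroup.subset_closure (by simp)
    have h : ∀ x : Fin 6, x ∈ MulAction.orbit (Subgroup.closure {modelσ, modelα}) (0 : Fin 6) := by
      have h1 : ∀ x : Fin 6, ∃ n ∈ Finset.range 5, ∃ m ∈ Finset.range 2,
          (modelα ^ m) ((modelσ ^ n) 0) = x := by decide
      intro x
      obtain ⟨n, -, m, -, h⟩ := h1 x
      exact ⟨⟨modelα ^ m * modelσ ^ n, mul_mem (pow_mem hα m) (pow_mem hσ n)⟩, h⟩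
    constructor
    intro x y
    have h : y ∈ MulAction.orbit (Subgroup.closure {modelσ, modelα}) x :=
      MulAction.orbit_eq_iff.2 (h x) ▸ h y
    exact h

/-- The model dessin, drawn by the Belyi function. -/
def modelDrawing : modelDessin.Drawing belyiRat where
  arc := edgeArc
  apply_arc := onSphere_edgeArc
  iUnion_arc := iUnion_edgeArc
  arc_inj e e' t h0 h1 h := by
    rw [edgeArc_apply e h0 h1, edgeArc_apply e' h0 h1] at h
    exact edgeLift_injective (log_mem h0 h1) (OnePoint.coe_injective h)
  black e e' := by
    rw [edgeArc_zero, edgeArc_zero]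
    exact blackEnd_eq_iff.trans sameCycle_modelσ.symm
  black_mult e := by
    simp only [edgeArc_zero]
    rw [mult_blackEnd, ncard_blackEnd]
  black_ccw := tendsto_black
  white e e' := by
    rw [edgeArc_one, edgeArc_one]
    exact whiteEnd_eq_iff
  white_mult e := by
    simp only [edgeArc_one]
    rw [mult_whiteEnd, ncard_whiteEnd]
  white_ccw := tendsto_white
  face := edgeFace
  face_isOpen e := by
    unfold edgeFace
    split_ifs
    exacts [smallDisk.isOpen_face, bigDisk.isOpen_face]
  face_disk e := by
    by_cases h : e = 3
    · rw [edgeFace, if_pos h]; exact smallDisk.nonempty_homeomorph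
    · rw [edgeFace, if_neg h]; exact bigDisk.nonempty_homeomorph
  iUnion_face := by
    rw [← union_face]
    refine Set.Subset.antisymm (Set.iUnion_subset fun e => ?_) (Set.union_subset ?_ ?_)
    · unfold edgeFace
      split_ifs
      exacts [Set.subset_union_right, Set.subset_union_left]
    · exact Set.subset_iUnion edgeFace 0
    · exact Set.subset_iUnion edgeFace 3
  face_eq e e' h := by
    have h := sameCycle_modelFace.1 h
    unfold edgeFace
    simp only [h]
  face_disjoint e e' h := by
    have h := mt sameCycle_modelFace.2 h
    unfold edgeFace
    split_ifs with h1 h2 h2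
    · exact absurd (iff_of_true h1 h2) h
    · exact disjoint_bigDisk_smallDisk.symm
    · exact disjoint_bigDisk_smallDisk
    · exact absurd (iff_of_false h1 h2) h
  face_right e t h0 h1 := eventually_mem_edgeFace e h0 h1
  face_pole e := by
    change ∃ p ∈ edgeFace e, belyiRat.onSphere p = OnePoint.infty ∧
      belyiRat.mult p = {e' | (modelσ * modelα)⁻¹.SameCycle e e'}.ncard ∧
      ∀ q ∈ edgeFace e, belyiRat.onSphere q = OnePoint.infty → q = p
    rw [ncard_face]
    unfold edgeFace
    split_ifs
    · exact ⟨_, smallDisk.vertex_mem_face, onSphere_pole smallDisk.pole, mult_neg_blackTip,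
        fun q hq h => smallDisk.eq_of_onSphere_eq_infty hq h⟩
    · exact ⟨_, bigDisk.vertex_mem_face, onSphere_pole bigDisk.pole, mult_neg_one,
        fun q hq h => bigDisk.eq_of_onSphere_eq_infty hq h⟩

/-! ### Drawings of isomorphic dessins -/

theorem Equiv.sameCycle_iff {A B : Type*} (ψ : A ≃ B) {f : Equiv.Perm A} {g : Equiv.Perm B}
    (h : ∀ x, ψ (f x) = g (ψ x)) {x y : A} : f.SameCycle x y ↔ g.SameCycle (ψ x) (ψ y) := by
  have hg : g = ψ.permCongrHom f := by
    ext b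
    obtain ⟨a, rfl⟩ := ψ.surjective b
    simp [Equiv.permCongrHom, ← h]
  have hz : ∀ n : ℤ, (g ^ n) (ψ x) = ψ ((f ^ n) x) := by
    intro n
    rw [hg, ← map_zpow]
    simp [Equiv.permCongrHom]
  simp [Equiv.Perm.SameCycle, hz]

theorem Equiv.ncard_setOf {A B : Type*} (ψ : A ≃ B) (p : B → Prop) :
    {x | p (ψ x)}.ncard = {y | p y}.ncard := by
  rw [← Set.ncard_image_of_injective _ ψ.injective]
  congr 1
  ext y
  simp only [Set.mem_image, Set.mem_ofPred_eq]
  exact ⟨by rintro ⟨x, hx, rfl⟩; exact hx, fun h => ⟨ψ.symm y, by simpa using h, by simp⟩⟩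

/-- A drawing of a dessin is a drawing of each dessin isomorphic to it. -/
def Dessin.Drawing.congr {E F : Type} {D : Dessin E} {D' : Dessin F} {f : RatFunc ℂ}
    (d : D'.Drawing f) (ψ : E ≃ F) (hσ : ∀ e, ψ (D.σ e) = D'.σ (ψ e))
    (hα : ∀ e, ψ (D.α e) = D'.α (ψ e)) : D.Drawing f :=
  have hφ : ∀ {e e' : E}, (D.σ * D.α)⁻¹.SameCycle e e' ↔
      (D'.σ * D'.α)⁻¹.SameCycle (ψ e) (ψ e') := by
    intro e e'
    rw [Equiv.Perm.sameCycle_inv, Equiv.Perm.sameCycle_inv]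
    exact ψ.sameCycle_iff fun x => by simp [hσ, hα]
  { arc e := d.arc (ψ e)
    apply_arc e := d.apply_arc (ψ e)
    iUnion_arc := by
      rw [← d.iUnion_arc]
      exact ψ.surjective.iUnion_comp fun e => Set.range (d.arc e)
    arc_inj e e' t h0 h1 h := ψ.injective (d.arc_inj _ _ t h0 h1 h)
    black e e' := (d.black _ _).trans (ψ.sameCycle_iff hσ).symm
    black_mult e := (d.black_mult (ψ e)).trans
      (ψ.ncard_setOf fun e' => d.arc e' 0 = d.arc (ψ e) 0).symm
    black_ccw e := by
      rw [hσ]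
      exact d.black_ccw (ψ e)
    white e e' := (d.white _ _).trans (ψ.sameCycle_iff hα).symm
    white_mult e := (d.white_mult (ψ e)).trans
      (ψ.ncard_setOf fun e' => d.arc e' 1 = d.arc (ψ e) 1).symm
    white_ccw e := by
      rw [hα]
      exact d.white_ccw (ψ e)
    face e := d.face (ψ e)
    face_isOpen e := d.face_isOpen (ψ e)
    face_disk e := d.face_disk (ψ e)
    iUnion_face := by
      rw [← d.iUnion_face]
      exact ψ.surjective.iUnion_comp fun e => d.face e
    face_eq e e' h := d.face_eq _ _ (hφ.1 h)
    face_disjoint e e' h := d.face_disjoint _ _ (mt hφ.2 h)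
    face_right e := d.face_right (ψ e)
    face_pole e := by
      simp only [hφ]
      rw [ψ.ncard_setOf fun e' => (D'.σ * D'.α)⁻¹.SameCycle (ψ e) e']
      exact d.face_pole (ψ e) }

/-! ### Equivariant maps of dessins -/

namespace Dessin

variable {E F : Type}

/-- Two equivariant maps that agree at one edge are equal. -/
theorem eq_of_equivariant (D : Dessin E) {τ υ : Equiv.Perm F} {q q' : E → F}
    (hσ : ∀ x, q (D.σ x) = τ (q x)) (hα : ∀ x, q (D.α x) = υ (q x))
    (hσ' : ∀ x, q' (D.σ x) = τ (q' x)) (hα' : ∀ x, q' (D.α x) = υ (q' x)) {x₀ : E}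
    (h : q x₀ = q' x₀) : q = q' := by
  have := D.transitive
  funext y
  obtain ⟨⟨g, hg⟩, hy⟩ := MulAction.exists_smul_eq (Subgroup.closure {D.σ, D.α}) x₀ y
  change g x₀ = y at hy
  subst hy
  suffices hP : ∀ x, q x = q' x ↔ q (g x) = q' (g x) from (hP x₀).1 h
  induction hg using Subgroup.closure_induction with
  | mem ρ hρ =>
    rcases hρ with rfl | rfl
    · intro x; rw [hσ, hσ', τ.apply_eq_iff_eq]
    · intro x; rw [hα, hα', υ.apply_eq_iff_eq]
  | one => exact fun x => Iff.rfl
  | mul a b _ _ ha hb => exact fun x => (hb x).trans (ha (b x))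
  | inv a _ ha => exact fun x => by simpa using (ha (a⁻¹ x)).symm

theorem aut_apply_σ (D : Dessin E) (g : D.aut) (x : E) : g.1 (D.σ x) = D.σ (g.1 x) :=
  Equiv.congr_fun (D.aut_comm_σ g.1 g.2) x

theorem aut_apply_α (D : Dessin E) (g : D.aut) (x : E) : g.1 (D.α x) = D.α (g.1 x) :=
  Equiv.congr_fun (D.aut_comm_α g.1 g.2) x

/-- An automorphism with a fixed edge is trivial. -/
theorem aut_eq_one (D : Dessin E) {g : D.aut} {x : E} (h : g.1 x = x) : g = 1 := by
  apply Subtype.ext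
  apply Equiv.ext
  exact congrFun (D.eq_of_equivariant (q := g.1) (q' := id) (D.aut_apply_σ g) (D.aut_apply_α g)
    (fun _ => rfl) (fun _ => rfl) h)

/-- A finite group of automorphisms has orbits of the same size. -/
theorem card_quotientEdge_mul (D : Dessin E) (G : Subgroup D.aut) :
    Nat.card (D.QuotientEdge G) * Nat.card G = Nat.card E := by
  classical
  have := D.finite
  have := Fintype.ofFinite E
  have := Fintype.ofFinite G
  have := Fintype.ofFinite (D.QuotientEdge G)
  -- In Burnside's formula only the identity contributes, because other automorphisms have no fixed
  -- edge.
  rw [Nat.card_eq_fintype_card, Nat.card_eq_fintype_card, Nat.card_eq_fintype_card,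
    ← MulAction.sum_card_fixedBy_eq_card_orbits_mul_card_group G E,
    Finset.sum_eq_single (1 : G)]
  · exact Fintype.card_congr ((Equiv.setCongr (MulAction.fixedBy_one_eq_univ E G)).trans
      (Equiv.Set.univ E))
  · intro g _ hg
    rw [Fintype.card_eq_zero_iff]
    exact ⟨fun x => hg (Subtype.ext (D.aut_eq_one (g := g.1) x.2))⟩
  · simp

end Dessin

/-! ### Rotations of the icosahedron -/

/-- The rotation by `72 i` degrees about the axis through the poles. -/
def icoRotate (i : Fin 5) : IcoDart → IcoDart
  | (.north, j) => (.north, j + i)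
  | (.south, j) => (.south, j - i)
  | (.upper k, j) => (.upper (k + i), j)
  | (.lower k, j) => (.lower (k + i), j)

/-- A half-turn that exchanges the poles. -/
def icoSwap : IcoDart → IcoDart
  | (.north, j) => (.south, j)
  | (.south, j) => (.north, j)
  | (.upper k, j) => (.lower (-k), j)
  | (.lower k, j) => (.upper (-k), j)

/-- The half-turn about the mid-point of the edge between `north` and `upper 0`. -/
def icoTurn : IcoDart → IcoDart
  | (.north, j) => (.upper 0, j)
  | (.south, j) => (.lower 2, j + 2)
  | (.upper k, j) =>
    ((![.north, .upper 4, .lower 4, .lower 0, .upper 1] : Fin 5 → IcoVertex) k,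
      j + (![0, 4, 2, 3, 1] : Fin 5 → Fin 5) k)
  | (.lower k, j) =>
    ((![.upper 3, .lower 3, .south, .lower 1, .upper 2] : Fin 5 → IcoVertex) k,
      j + (![2, 4, 3, 1, 3] : Fin 5 → Fin 5) k)

theorem icoRotate_zero : ∀ d, icoRotate 0 d = d := by decide

theorem icoRotate_add (i j : Fin 5) (d : IcoDart) :
    icoRotate (i + j) d = icoRotate i (icoRotate j d) := by
  rcases d with ⟨_ | _ | k | k, l⟩ <;> simp only [icoRotate, Prod.mk.injEq, IcoVertex.upper.injEq,
    IcoVertex.lower.injEq, true_and, and_true] <;> abel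

theorem icoSwap_icoSwap : ∀ d, icoSwap (icoSwap d) = d := by decide

theorem icoTurn_icoTurn : ∀ d, icoTurn (icoTurn d) = d := by decide

theorem icoSwap_icoRotate (i : Fin 5) (d : IcoDart) :
    icoSwap (icoRotate i d) = icoRotate (-i) (icoSwap d) := by
  rcases d with ⟨_ | _ | k | k, l⟩ <;> simp only [icoSwap, icoRotate, Prod.mk.injEq,
    IcoVertex.upper.injEq, IcoVertex.lower.injEq, true_and, and_true] <;> abel

/-- A permutation of the half-edges that preserves the structure of the icosahedron is an
automorphism of the icosahedron of genus 4. -/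
theorem mem_aut_of_comm {g : Equiv.Perm IcoDart} (hσ : ∀ d, g (icoσ d) = icoσ (g d))
    (hα : ∀ d, g (icoFlip d) = icoFlip (g d)) : g ∈ icosahedronGenusFour.aut := by
  refine Subgroup.mem_centralizer_iff.2 ?_
  rintro _ (rfl | rfl)
  · ext1 d
    change icoσ (icoσ (g d)) = g (icoσ (icoσ d))
    rw [hσ, hσ]
  · ext1 d
    exact (hα d).symm

/-- The rotations about the axis through the poles, as automorphisms. -/
def rotateAut (i : Fin 5) : icosahedronGenusFour.aut :=
  ⟨⟨icoRotate i, icoRotate (-i),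
    fun d => by rw [← icoRotate_add, neg_add_cancel, icoRotate_zero],
    fun d => by rw [← icoRotate_add, add_neg_cancel, icoRotate_zero]⟩,
    mem_aut_of_comm (by revert i; decide) (by revert i; decide)⟩

/-- The half-turn that exchanges the poles, as an automorphism. -/
def swapAut : icosahedronGenusFour.aut :=
  ⟨Function.Involutive.toPerm icoSwap icoSwap_icoSwap, mem_aut_of_comm (by decide) (by decide)⟩

/-- The half-turn about the mid-point of an edge, as an automorphism. -/
def turnAut : icosahedronGenusFour.aut :=
  ⟨Function.Involutive.toPerm icoTurn icoTurn_icoTurn, mem_aut_of_comm (by decide) (by decide)⟩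

theorem rotateAut_add (i j : Fin 5) : rotateAut (i + j) = rotateAut i * rotateAut j := by
  ext1; ext1 d
  exact icoRotate_add i j d

theorem swapAut_mul_swapAut : swapAut * swapAut = 1 := by
  ext1; ext1 d
  exact icoSwap_icoSwap d

theorem rotateAut_mul_swapAut (i : Fin 5) : rotateAut i * swapAut = swapAut * rotateAut (-i) := by
  ext1; ext1 d
  change icoRotate i (icoSwap d) = icoSwap (icoRotate (-i) d)
  rw [icoSwap_icoRotate, neg_neg]

theorem swapAut_mul_rotateAut_sub (i j : Fin 5) :
    swapAut * rotateAut (j - i) = rotateAut i * (swapAut * rotateAut j) := by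
  rw [← mul_assoc, rotateAut_mul_swapAut, mul_assoc, ← rotateAut_add, sub_eq_neg_add]

theorem rotateAut_sub (i j : Fin 5) :
    rotateAut (j - i) = swapAut * rotateAut i * (swapAut * rotateAut j) := by
  rw [mul_assoc, ← swapAut_mul_rotateAut_sub, ← mul_assoc, swapAut_mul_swapAut, one_mul]

/-- The dihedral group of the rotations that preserve the axis through the poles. -/
def dihedralHom : DihedralGroup 5 →* icosahedronGenusFour.aut where
  toFun
    | .r i => rotateAut i
    | .sr i => swapAut * rotateAut i
  map_one' := by
    ext1; ext1 d
    exact icoRotate_zero d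
  map_mul' := by
    rintro (i | i) (j | j)
    · exact rotateAut_add i j
    · exact swapAut_mul_rotateAut_sub i j
    · exact (congrArg (swapAut * ·) (rotateAut_add i j)).trans (mul_assoc _ _ _).symm
    · exact rotateAut_sub i j

theorem dihedralHom_injective : Function.Injective dihedralHom := by
  rw [injective_iff_map_eq_one]
  rintro (i | i) h
  · have h1 : icoRotate i (.north, 0) = (.north, 0) :=
      congrArg (fun g : icosahedronGenusFour.aut => g.1 (.north, 0)) h
    have h2 : ∀ i : Fin 5, icoRotate i (.north, 0) = (.north, 0) → i = 0 := by decide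
    exact congrArg DihedralGroup.r (h2 i h1)
  · have h1 : icoSwap (icoRotate i (.north, 0)) = (.north, 0) :=
      congrArg (fun g : icosahedronGenusFour.aut => g.1 (.north, 0)) h
    simp [icoRotate, icoSwap] at h1

/-! ### Maps from the icosahedron of genus 4 to the model dessin -/

/-- The equivariant maps from the icosahedron of genus 4 to the model dessin. -/
abbrev ModelMap : Type :=
  {q : IcoDart → Fin 6 // (∀ d, q (icosahedronGenusFour.σ d) = modelσ (q d)) ∧
    ∀ d, q (icosahedronGenusFour.α d) = modelα (q d)}

namespace ModelMap

instance : Finite ModelMap := Subtype.finite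

/-- Composition with the inverse of an automorphism. -/
instance : MulAction icosahedronGenusFour.aut ModelMap where
  smul g q := ⟨fun d => q.1 (g⁻¹.1 d),
    fun d => by simp only [icosahedronGenusFour.aut_apply_σ, q.2.1],
    fun d => by simp only [icosahedronGenusFour.aut_apply_α, q.2.2]⟩
  one_smul q := Subtype.ext (funext fun d => by change q.1 ((1 : icosahedronGenusFour.aut)⁻¹.1 d) = _; simp)
  mul_smul g h q := Subtype.ext (funext fun d => by
    change q.1 ((g * h)⁻¹.1 d) = q.1 (h⁻¹.1 (g⁻¹.1 d))
    rw [mul_inv_rev]; rfl)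

theorem inv_smul_apply (g : icosahedronGenusFour.aut) (q : ModelMap) (d : IcoDart) :
    (g⁻¹ • q).1 d = q.1 (g.1 d) := by
  change q.1 (g⁻¹⁻¹.1 d) = _
  rw [inv_inv]

theorem ext_of_apply {q p : ModelMap} {d : IcoDart} (h : q.1 d = p.1 d) : q = p :=
  Subtype.ext (icosahedronGenusFour.eq_of_equivariant q.2.1 q.2.2 p.2.1 p.2.2 h)

/-- The quotient by the rotations that preserve the axis through the poles. -/
def axis : ModelMap :=
  ⟨fun
    | (.north, _) | (.south, _) => 5
    -- The rotation `σ ^ 2` raises `i` by 2, so the table is division by 2 modulo 5.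
    | (.upper _, i) | (.lower _, i) => (![0, 3, 1, 4, 2] : Fin 5 → Fin 6) i, by decide, by decide⟩

/-- A map is determined by the image of one edge, and all six images occur for `axis` and its
translates, which belong to the other axes of the icosahedron. -/
theorem bijective_apply : Function.Bijective fun q : ModelMap => q.1 (.north, 0) := by
  refine ⟨fun q q' h => ext_of_apply h, fun j => ?_⟩
  have h : ∀ j : Fin 6, axis.1 (.north, 0) = j ∨
      ∃ i, axis.1 (icoTurn (icoRotate i (.north, 0))) = j := by decide
  rcases h j with h | ⟨i, h⟩
  · exact ⟨axis, h⟩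
  · exact ⟨(turnAut * rotateAut i)⁻¹ • axis, by simp only [inv_smul_apply]; exact h⟩

theorem natCard : Nat.card ModelMap = 6 := by
  rw [Nat.card_congr (Equiv.ofBijective _ bijective_apply), Nat.card_fin]

/-- The automorphisms act faithfully on the maps. -/
theorem eq_one_of_smul {g : icosahedronGenusFour.aut} (h : ∀ q : ModelMap, g⁻¹ • q = q) : g = 1 := by
  -- The map `axis` and five of its translates together separate the edge `(north, 0)` from all
  -- others; an automorphism fixing every map therefore fixes this edge.
  have hsep : ∀ d : IcoDart, axis.1 d = axis.1 (.north, 0) →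
      (∀ i, axis.1 (icoTurn (icoRotate i d)) = axis.1 (icoTurn (icoRotate i (.north, 0)))) →
      d = (.north, 0) := by decide
  have h' : ∀ (q : ModelMap) d, q.1 (g.1 d) = q.1 d := fun q d => by
    rw [← inv_smul_apply, h]
  refine icosahedronGenusFour.aut_eq_one (x := (.north, 0)) (hsep _ (h' axis _) fun i => ?_)
  have := h' ((turnAut * rotateAut i)⁻¹ • axis) (.north, 0)
  simp only [inv_smul_apply] at this
  exact this

theorem surjective (q : ModelMap) : Function.Surjective q.1 := by
  have hσ : ∀ (n : ℕ) d, q.1 ((icosahedronGenusFour.σ ^ n) d) = (modelσ ^ n) (q.1 d) := by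
    intro n d
    induction n with
    | zero => rfl
    | succ n ih => rw [pow_succ', pow_succ', Equiv.Perm.mul_apply, q.2.1, ih]; rfl
  have h : ∀ i j : Fin 6, (∃ a ∈ Finset.range 5, (modelσ ^ a) i = j) ∨
      ∃ a ∈ Finset.range 5, ∃ b ∈ Finset.range 5, (modelσ ^ a) (modelα ((modelσ ^ b) i)) = j := by
    decide
  intro j
  rcases h (q.1 (.north, 0)) j with ⟨a, -, h⟩ | ⟨a, -, b, -, h⟩
  · exact ⟨_, (hσ a _).trans h⟩
  · exact ⟨(icosahedronGenusFour.σ ^ a) (icosahedronGenusFour.α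
    ((icosahedronGenusFour.σ ^ b) (.north, 0))), by rw [hσ, q.2.2, hσ, h]⟩

/-- An automorphism of order 5 fixes exactly one of the maps. -/
theorem existsUnique_smul_eq {g : icosahedronGenusFour.aut} (hg : orderOf g = 5) :
    ∃! q : ModelMap, g • q = q := by
  have : Fact (Nat.Prime 5) := ⟨by norm_num⟩
  set P := Subgroup.zpowers g
  have hP : IsPGroup 5 P := IsPGroup.of_card (n := 1) (by rw [Nat.card_zpowers, hg, pow_one])
  -- Orbits of a group of order 5 have 1 or 5 elements, so the number of fixed maps is 1 or 6.
  have hmod := hP.card_modEq_card_fixedPoints ModelMap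
  have hfix : ∀ q : ModelMap, q ∈ MulAction.fixedPoints P ModelMap ↔ g • q = q := by
    intro q
    constructor
    · exact fun h => h ⟨g, Subgroup.mem_zpowers g⟩
    · intro h ⟨x, hx⟩
      exact (Subgroup.zpowers_le (H := MulAction.stabilizer _ q)).2 h hx
  set S := MulAction.fixedPoints P ModelMap with hS
  rw [natCard, Nat.card_coe_set_eq] at hmod
  have hle : S.ncard ≤ 6 := natCard ▸ Set.ncard_univ ModelMap ▸ Set.ncard_le_ncard (Set.subset_univ S)
  have hne : S.ncard ≠ 6 := by
    intro h6
    have hu : S = Set.univ := by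
      refine Set.eq_of_subset_of_ncard_le (Set.subset_univ _) ?_
      rw [Set.ncard_univ, natCard, h6]
    have h1 : g = 1 := eq_one_of_smul fun q => by
      rw [inv_smul_eq_iff]
      exact ((hfix q).1 (hu ▸ Set.mem_univ q)).symm
    rw [h1, orderOf_one] at hg
    norm_num at hg
  have h1 : S.ncard = 1 := by
    unfold Nat.ModEq at hmod
    omega
  obtain ⟨q, hq⟩ := Set.ncard_eq_one.1 h1
  refine ⟨q, (hfix q).1 (hq ▸ rfl), fun q' h' => ?_⟩
  have := (hfix q').2 h'
  rw [hq] at this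
  exact this

/-- A dihedral group of order 10 fixes one of the maps. -/
theorem exists_smul_eq {G : Subgroup icosahedronGenusFour.aut} (φ : G ≃* DihedralGroup 5) :
    ∃ q : ModelMap, ∀ g ∈ G, g • q = q := by
  set r : G := φ.symm (.r 1) with hr
  have hord : orderOf (r : icosahedronGenusFour.aut) = 5 := by
    rw [Subgroup.orderOf_coe, hr, MulEquiv.orderOf_eq, DihedralGroup.orderOf_r_one]
  obtain ⟨q, hq, huniq⟩ := existsUnique_smul_eq hord
  refine ⟨q, fun g hg => huniq _ ?_⟩
  -- Conjugation sends the rotation to itself or its inverse, both of which fix `q`. So `g • q` is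
  -- fixed by the rotation too, and uniqueness gives `g • q = q`.
  have hconj : ∀ x : DihedralGroup 5, x⁻¹ * .r 1 * x = .r 1 ∨ x⁻¹ * .r 1 * x = (.r 1)⁻¹ := by
    decide
  have h : g⁻¹ * r * g = r ∨ g⁻¹ * r * g = (r : icosahedronGenusFour.aut)⁻¹ := by
    have key : ∀ x y : DihedralGroup 5, x = y → ((φ.symm x : G) : icosahedronGenusFour.aut) =
        (φ.symm y : G) := fun x y h => by rw [h]
    refine (hconj (φ ⟨g, hg⟩)).imp (fun h => ?_) fun h => ?_
    · simpa [hr] using key _ _ h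
    · simpa [hr, -DihedralGroup.inv_r] using key _ _ h
  have hfix : (g⁻¹ * r * g) • q = q := by
    rcases h with h | h
    · rw [h, hq]
    · rw [h, inv_smul_eq_iff, hq]
  have : (r : icosahedronGenusFour.aut) • g • q = g • (g⁻¹ * r * g) • q := by
    simp only [smul_smul]
    congr 1
    group
  exact this.trans (congrArg (g • ·) hfix)

end ModelMap

/-- The quotient by a dihedral group of order 10 is isomorphic to the model dessin. -/
theorem exists_quotient_equiv {G : Subgroup icosahedronGenusFour.aut} (φ : G ≃* DihedralGroup 5) :
    ∃ ψ : icosahedronGenusFour.QuotientEdge G ≃ Fin 6,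
      (∀ e, ψ ((icosahedronGenusFour.quotient G).σ e) = modelDessin.σ (ψ e)) ∧
      ∀ e, ψ ((icosahedronGenusFour.quotient G).α e) = modelDessin.α (ψ e) := by
  obtain ⟨q, hq⟩ := ModelMap.exists_smul_eq φ
  have hinv : ∀ a b : IcoDart, MulAction.orbitRel G IcoDart a b → q.1 a = q.1 b := by
    rintro a b ⟨g, rfl⟩
    have h := hq _ (inv_mem g.2)
    have h2 := ModelMap.inv_smul_apply g.1 q b
    rw [h] at h2
    exact h2.symm
  let ψ : icosahedronGenusFour.QuotientEdge G → Fin 6 := Quotient.lift q.1 hinv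
  have hcard : Nat.card (icosahedronGenusFour.QuotientEdge G) = Nat.card (Fin 6) := by
    have h := icosahedronGenusFour.card_quotientEdge_mul G
    rw [Nat.card_congr φ.toEquiv, DihedralGroup.nat_card, Nat.card_eq_fintype_card (α := IcoDart),
      show Fintype.card IcoDart = 60 from by decide] at h
    rw [Nat.card_fin]
    omega
  have hsurj : Function.Surjective ψ := fun j => by
    obtain ⟨d, hd⟩ := q.surjective j
    exact ⟨Quotient.mk _ d, hd⟩
  have := (icosahedronGenusFour.quotient G).finite
  refine ⟨Equiv.ofBijective ψ (hsurj.bijective_of_nat_card_le hcard.le), ?_, ?_⟩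
  · intro e
    induction e using Quotient.inductionOn with | _ d
    exact q.2.1 d
  · intro e
    induction e using Quotient.inductionOn with | _ d
    exact q.2.2 d

end

theorem mainTheorem7 :
    (∃ G : Subgroup icosahedronGenusFour.aut, Nonempty (G ≃* DihedralGroup 5)) ∧
    ∀ G : Subgroup icosahedronGenusFour.aut, Nonempty (G ≃* DihedralGroup 5) →
      (icosahedronGenusFour.quotient G).IsBelyiFunction
        (((RatFunc.X - 1) ^ 5 *
            (RatFunc.C (2 + Complex.I) * RatFunc.X + RatFunc.C (2 - Complex.I))) /
          ((RatFunc.X + 1) ^ 5 *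
            (RatFunc.C (2 + Complex.I) * RatFunc.X - RatFunc.C (2 - Complex.I)))) := by
  refine ⟨⟨dihedralHom.range, ⟨(MonoidHom.ofInjective dihedralHom_injective).symm⟩⟩, ?_⟩
  rintro G ⟨φ⟩
  obtain ⟨ψ, hσ, hα⟩ := exists_quotient_equiv φ
  -- The displayed quotient is `belyiRat` by definition; the isomorphism transports the drawing of
  -- the model to the quotient.
  exact ⟨isBelyi_belyiRat, ⟨modelDrawing.congr ψ hσ hα⟩⟩
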